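/- Let $M$ be a complex manifold of dimension $n$, with holomorphic tangent sheaf $\mathcal T_M$. Definitions. A Higgs bundle $(K\to M,C)$ is a holomorphic vector bundle $K\to M$ with an $\mathcal O_M$-linear map $C:\mathcal O(K)\to\Omega^1_M\otimes\mathcal O(K)$ such that $C_XC_Y=C_YC_X$ for $X,Y\in\mathcal T_M$. A good connection on it is a holomorphic connection $D$ on $K$ with $D_X(C_Y)-D_Y(C_X)=C_{[X,Y]}$ for $X,Y\in\mathcal T_M$. The Higgs bundle is primitive if there is a global holomorphic section $\zeta$ of $K$ (a primitive section) such that $\mathcal T_M\to\mathcal O(K)$, $X\mapsto C_X\zeta$, is an isomorphism. It then induces a multiplication $\circ$ on $TM$ and a unit field $e$, determined by $C_{X\circ Y}\zeta=C_XC_Y\zeta$ and $C_e\zeta=\zeta$. A $(T)$-structure $(H\to\mathbb C\times M,\nabla)$ is a holomorphic vector bundle $H\to\mathbb C\times M$ (with $z$ the coordinate on $\mathbb C$) with a map $\nabla:\mathcal O(H)\to\frac1z\mathcal O_{\mathbb C\times M}\cdot\Omega^1_M\otimes\mathcal O(H)$ that satisfies the Leibniz rule $\nabla_X(as)=X(a)s+a\nabla_Xs$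 and the flatness condition $\nabla_X\nabla_Y-\nabla_Y\nabla_X=\nabla_{[X,Y]}$ for $X,Y\in\mathcal T_M$. Its underlying Higgs bundle is $K=H|_{\{0\}\times M}$ with $C=[z\nabla]$; the $(T)$-structure is called a $(T)$-structure over an F-manifold if this Higgs bundle is primitive, and then $M$ carries the induced $\circ$ and $e$. Let $t=(t_1,\dots,t_n)$ be local coordinates on $M$, $\partial_k=\partial/\partial t_k$, and let $(t,y)$ be the corresponding canonical coordinates on $T^*M$, with canonical $1$-form $\sum_k y_k\,dt_k$, symplectic form $\omega=\sum_k dy_k\wedge dt_k$ and Poisson bracket $\{f,g\}=\sum_k\bigl(\frac{\partial f}{\partial t_k}\frac{\partial g}{\partial y_k}-\frac{\partial f}{\partial y_k}\frac{\partial g}{\partial t_k}\bigr)$. Write $\partial_i\circ\partial_j=\sum_k a_{ij}^k\partial_k$ and $e=\sum_k e^k\partial_k$. The analytic spectrum (spectral cover) $L_M\subset T^*M$ is the complex subspace defined by the ideal sheaf $$\mathcal I_M=\Bigl(\sum_k e^ky_k-1,\ y_iy_j-\sum_k a_{ij}^ky_k\ (1\le i,j\le n)\Bigr)\subset\mathcal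 O_{T^*M}.$$ Theorem. (a) Let $(K\to M,C,D)$ be a primitive Higgs bundle with a good connection, and let $\mathcal I_M$ be the ideal sheaf of the analytic spectrum of the induced multiplication. Then $$\{\sqrt{\mathcal I_M},\sqrt{\mathcal I_M}\}\subset\sqrt{\mathcal I_M}.\qquad(*)$$ (b) Let $(H\to\mathbb C\times M,\nabla)$ be a $(T)$-structure over an F-manifold. Then $(*)$ holds. Moreover, in both cases the reduced spectral cover $L_M^{red}$ is Lagrangian at its smooth points: if the set $L_M$ is a complex submanifold of $T^*M$ near $p\in L_M$, then $T_pL_M$ equals its own $\omega$-orthogonal complement. -/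

import Mathlib

open Bundle Filter
open scoped Manifold ContDiff Topology

/-! ### Holomorphic germs and the Poisson bracket on `T*ℂⁿ = ℂⁿ × ℂⁿ` -/

namespace FMan

/-- The ring `𝒪_{V,q}` of germs at `q` of holomorphic functions on the complex vector space `V`. -/
def holGerm {V : Type*} [NormedAddCommGroup V] [NormedSpace ℂ V] (q : V) :
    Subring (Germ (𝓝 q) ℂ) where
  carrier := {g | ∃ f : V → ℂ, AnalyticAt ℂ f q ∧ (f : Germ (𝓝 q) ℂ) = g}
  mul_mem' := by
    rintro _ _ ⟨f, hf, rfl⟩ ⟨g, hg, rfl⟩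
    exact ⟨f * g, hf.mul hg, rfl⟩
  one_mem' := ⟨fun _ => 1, analyticAt_const, rfl⟩
  add_mem' := by
    rintro _ _ ⟨f, hf, rfl⟩ ⟨g, hg, rfl⟩
    exact ⟨f + g, hf.add hg, rfl⟩
  zero_mem' := ⟨fun _ => 0, analyticAt_const, rfl⟩
  neg_mem' := by
    rintro _ ⟨f, hf, rfl⟩
    exact ⟨-f, hf.neg, rfl⟩

/-- Canonical coordinates `(t, y) = (t₁, …, tₙ, y₁, …, yₙ)` on a cotangent bundle. -/
abbrev CotCoord (n : ℕ) : Type := EuclideanSpace ℂ (Fin n) × EuclideanSpace ℂ (Fin n)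

/-- `∂f/∂tₖ`. -/
noncomputable def dt {n : ℕ} (k : Fin n) (f : CotCoord n → ℂ) (q : CotCoord n) : ℂ :=
  fderiv ℂ f q (EuclideanSpace.single k 1, 0)

/-- `∂f/∂yₖ`. -/
noncomputable def dy {n : ℕ} (k : Fin n) (f : CotCoord n → ℂ) (q : CotCoord n) : ℂ :=
  fderiv ℂ f q (0, EuclideanSpace.single k 1)

/-- The Poisson bracket `{f, g} = H_f(g) = ∑ₖ (∂f/∂tₖ · ∂g/∂yₖ - ∂f/∂yₖ · ∂g/∂tₖ)`. -/
noncomputable def poissonFun {n : ℕ} (f g : CotCoord n → ℂ) (q : CotCoord n) : ℂ :=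
  ∑ k, (dt k f q * dy k g q - dy k f q * dt k g q)

theorem poissonFun_congr {n : ℕ} {q : CotCoord n} {f f' g g' : CotCoord n → ℂ}
    (hf : f =ᶠ[𝓝 q] f') (hg : g =ᶠ[𝓝 q] g') : poissonFun f g =ᶠ[𝓝 q] poissonFun f' g' := by
  filter_upwards [hf.fderiv (𝕜 := ℂ), hg.fderiv (𝕜 := ℂ)] with x h1 h2
  simp only [poissonFun, dt, dy, h1, h2]

theorem analyticAt_poissonFun {n : ℕ} {q : CotCoord n} {f g : CotCoord n → ℂ}
    (hf : AnalyticAt ℂ f q) (hg : AnalyticAt ℂ g q) : AnalyticAt ℂ (poissonFun f g) q := by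
  have key : ∀ {h : CotCoord n → ℂ} (_ : AnalyticAt ℂ h q) (v : CotCoord n),
      AnalyticAt ℂ (fun x => fderiv ℂ h x v) q := fun hh v =>
    (ContinuousLinearMap.apply ℂ ℂ v).analyticAt _ |>.comp hh.fderiv
  unfold poissonFun dt dy
  refine Finset.analyticAt_fun_sum _ fun k _ => ?_
  exact ((key hf _).mul (key hg _)).sub ((key hf _).mul (key hg _))

/-- The Poisson bracket of two germs of functions, computed with arbitrary representatives. -/
noncomputable def poissonGerm {n : ℕ} {q : CotCoord n} (f g : Germ (𝓝 q) ℂ) : Germ (𝓝 q) ℂ :=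
  Quotient.map₂ (fun f g => poissonFun f g) (fun _ _ hf _ _ hg => poissonFun_congr hf hg) f g

/-- The Poisson bracket on the ring of germs of holomorphic functions on `T*ℂⁿ` at `q`. -/
noncomputable def poisson {n : ℕ} {q : CotCoord n} (f g : holGerm q) : holGerm q :=
  ⟨poissonGerm f.1 g.1, by
    obtain ⟨_, f, hf, rfl⟩ := f
    obtain ⟨_, g, hg, rfl⟩ := g
    exact ⟨poissonFun f g, analyticAt_poissonFun hf hg, rfl⟩⟩

/-! ### Lagrangian submanifolds of `T*ℂⁿ` -/

/-- The symplectic form `ω = dα = ∑ₖ dyₖ ∧ dtₖ`, where `α = ∑ₖ yₖ dtₖ`. -/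
def symplecticForm {n : ℕ} (v w : CotCoord n) : ℂ := ∑ k, (v.2 k * w.1 k - v.1 k * w.2 k)

/-- A subspace is Lagrangian if it equals its own symplectic orthogonal. -/
def IsLagrangian {n : ℕ} (T : Submodule ℂ (CotCoord n)) : Prop :=
  ∀ v, v ∈ T ↔ ∀ w ∈ T, symplecticForm v w = 0

/-- Near its point `q` the set `L` is a complex submanifold of `V`, with tangent space `T` at `q`:
a biholomorphic map `Φ` between open sets straightens `L` to a linear subspace `W`. -/
def IsSmoothPoint {V : Type*} [NormedAddCommGroup V] [NormedSpace ℂ V]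
    (L : Set V) (q : V) (T : Submodule ℂ V) : Prop :=
  q ∈ L ∧ ∃ (Φ : OpenPartialHomeomorph V V) (W : Submodule ℂ V),
    q ∈ Φ.source ∧ AnalyticOnNhd ℂ Φ Φ.source ∧ AnalyticOnNhd ℂ Φ.symm Φ.target ∧
    (∀ x ∈ Φ.source, x ∈ L ↔ Φ x ∈ W) ∧
    T = W.comap (fderiv ℂ Φ q : V →ₗ[ℂ] V)

/-! ### Multiplications on the tangent bundle and their analytic spectrum -/

section Spectrum

variable {n : ℕ} {M : Type*} [TopologicalSpace M] [ChartedSpace (EuclideanSpace ℂ (Fin n)) M]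

/-- The coordinate vector field `∂ᵢ = ∂/∂tᵢ` of the chart `φ = (t₁, …, tₙ)`, at the point with
coordinates `t`. -/
noncomputable def coordField (φ : OpenPartialHomeomorph M (EuclideanSpace ℂ (Fin n))) (i : Fin n)
    (t : EuclideanSpace ℂ (Fin n)) : TangentSpace 𝓘(ℂ, EuclideanSpace ℂ (Fin n)) (φ.symm t) :=
  mfderiv 𝓘(ℂ, EuclideanSpace ℂ (Fin n)) 𝓘(ℂ, EuclideanSpace ℂ (Fin n)) φ.symm t
    (EuclideanSpace.single i 1 : EuclideanSpace ℂ (Fin n))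

/-- The `k`-th component `dtₖ(X)` of a tangent vector `X` in the chart `φ = (t₁, …, tₙ)`. -/
noncomputable def component (φ : OpenPartialHomeomorph M (EuclideanSpace ℂ (Fin n))) (k : Fin n) {x : M}
    (X : TangentSpace 𝓘(ℂ, EuclideanSpace ℂ (Fin n)) x) : ℂ :=
  (mvfderiv 𝓘(ℂ, EuclideanSpace ℂ (Fin n)) φ x X) k

variable (mul : ∀ x : M, TangentSpace 𝓘(ℂ, EuclideanSpace ℂ (Fin n)) x →
    TangentSpace 𝓘(ℂ, EuclideanSpace ℂ (Fin n)) x →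
    TangentSpace 𝓘(ℂ, EuclideanSpace ℂ (Fin n)) x)
  (e : ∀ x : M, TangentSpace 𝓘(ℂ, EuclideanSpace ℂ (Fin n)) x)

/-- The function `yᵢ yⱼ - ∑ₖ aᵢⱼᵏ yₖ`, where `∂ᵢ ∘ ∂ⱼ = ∑ₖ aᵢⱼᵏ ∂ₖ`. -/
noncomputable def mulGen (φ : OpenPartialHomeomorph M (EuclideanSpace ℂ (Fin n))) (i j : Fin n)
    (q : CotCoord n) : ℂ :=
  q.2 i * q.2 j -
    ∑ k, component φ k (mul (φ.symm q.1) (coordField φ i q.1) (coordField φ j q.1)) * q.2 k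

/-- The function `∑ₖ eᵏ yₖ - 1`, where `e = ∑ₖ eᵏ ∂ₖ`; it is `y₁ - 1` in coordinates with
`e = ∂₁`. -/
noncomputable def unitGen (φ : OpenPartialHomeomorph M (EuclideanSpace ℂ (Fin n))) (q : CotCoord n) : ℂ :=
  ∑ k, component φ k (e (φ.symm q.1)) * q.2 k - 1

/-- The stalk at `q` of the ideal sheaf of the analytic spectrum of `(TM, ∘, e)`, in the canonical
coordinates `(t, y)` of `T*M` given by the chart `φ`. -/
noncomputable def spectrumIdeal (φ : OpenPartialHomeomorph M (EuclideanSpace ℂ (Fin n))) (q : CotCoord n) :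
    Ideal (holGerm q) :=
  Ideal.span ({h | h.1 = (unitGen e φ : Germ (𝓝 q) ℂ)} ∪
    {h | ∃ i j, h.1 = (mulGen mul φ i j : Germ (𝓝 q) ℂ)})

/-- The set of points of the analytic spectrum (spectral cover), in the canonical coordinates
`(t, y)` of `T*M` given by the chart `φ`. -/
def spectrumSet (φ : OpenPartialHomeomorph M (EuclideanSpace ℂ (Fin n))) : Set (CotCoord n) :=
  {q | q.1 ∈ φ.target ∧ unitGen e φ q = 0 ∧ ∀ i j, mulGen mul φ i j q = 0}

/-- The radical of the ideal sheaf of the analytic spectrum is closed under the Poisson bracket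
(at each stalk, in all local coordinates). -/
def RadicalPoissonClosed : Prop :=
  ∀ φ ∈ IsManifold.maximalAtlas 𝓘(ℂ, EuclideanSpace ℂ (Fin n)) ω M, ∀ q : CotCoord n, q.1 ∈ φ.target →
    ∀ f ∈ (spectrumIdeal mul e φ q).radical, ∀ g ∈ (spectrumIdeal mul e φ q).radical,
      poisson f g ∈ (spectrumIdeal mul e φ q).radical

/-- The reduced analytic spectrum is a Lagrangian submanifold of `T*M` near its smooth points. -/
def ReducedSpectrumLagrangian : Prop :=
  ∀ φ ∈ IsManifold.maximalAtlas 𝓘(ℂ, EuclideanSpace ℂ (Fin n)) ω M, ∀ (q : CotCoord n)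
    (T : Submodule ℂ (CotCoord n)), IsSmoothPoint (spectrumSet mul e φ) q T → IsLagrangian T

end Spectrum

/-! ### Higgs bundles -/

section Higgs

variable {n : ℕ} {M : Type*} [TopologicalSpace M] [ChartedSpace (EuclideanSpace ℂ (Fin n)) M]

/-- `ζ` is a section such that `X ↦ C_X ζ` is an isomorphism `TM → K`. -/
def IsPrimitive {K : M → Type*} [∀ x, AddCommGroup (K x)] [∀ x, Module ℂ (K x)]
    (C : ∀ x : M, TangentSpace 𝓘(ℂ, EuclideanSpace ℂ (Fin n)) x →ₗ[ℂ] K x →ₗ[ℂ] K x) (ζ : ∀ x, K x) : Prop :=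
  ∀ x, Function.Bijective ((C x).flip (ζ x))

section Induced

variable {K : M → Type*} [∀ x, AddCommGroup (K x)] [∀ x, Module ℂ (K x)]
  {C : ∀ x : M, TangentSpace 𝓘(ℂ, EuclideanSpace ℂ (Fin n)) x →ₗ[ℂ] K x →ₗ[ℂ] K x} {ζ : ∀ x, K x}

/-- The induced multiplication on `TM`, determined by `C_{X ∘ Y} ζ = C_X C_Y ζ`. -/
noncomputable def inducedMul (h : IsPrimitive C ζ) (x : M)
    (X Y : TangentSpace 𝓘(ℂ, EuclideanSpace ℂ (Fin n)) x) : TangentSpace 𝓘(ℂ, EuclideanSpace ℂ (Fin n)) x :=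
  (LinearEquiv.ofBijective _ (h x)).symm (C x X (C x Y (ζ x)))

/-- The induced unit field, determined by `C_e ζ = ζ`. -/
noncomputable def inducedUnit (h : IsPrimitive C ζ) (x : M) : TangentSpace 𝓘(ℂ, EuclideanSpace ℂ (Fin n)) x :=
  (LinearEquiv.ofBijective _ (h x)).symm (ζ x)

end Induced

variable (F : Type*) [NormedAddCommGroup F] [NormedSpace ℂ F]
  {K : M → Type*} [TopologicalSpace (TotalSpace F K)]
  [∀ x, AddCommGroup (K x)] [∀ x, Module ℂ (K x)] [∀ x, TopologicalSpace (K x)]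
  [FiberBundle F K]

variable (n) in
/-- The vector field `X` is holomorphic near `x`. -/
def HolVectorFieldAt [IsManifold 𝓘(ℂ, EuclideanSpace ℂ (Fin n)) ω M]
    (X : ∀ x : M, TangentSpace 𝓘(ℂ, EuclideanSpace ℂ (Fin n)) x) (x : M) : Prop :=
  ContMDiffAt 𝓘(ℂ, EuclideanSpace ℂ (Fin n))
    (𝓘(ℂ, EuclideanSpace ℂ (Fin n)).prod 𝓘(ℂ, EuclideanSpace ℂ (Fin n))) ω
    (fun y => TotalSpace.mk' (EuclideanSpace ℂ (Fin n)) y (X y)) x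

variable (n) in
/-- The section `s` of `K → M` is holomorphic near `x`. -/
def HolSectionAt (s : ∀ x : M, K x) (x : M) : Prop :=
  ContMDiffAt 𝓘(ℂ, EuclideanSpace ℂ (Fin n))
    (𝓘(ℂ, EuclideanSpace ℂ (Fin n)).prod 𝓘(ℂ, F)) ω
    (fun y => TotalSpace.mk' F y (s y)) x

/-- `C` is a Higgs field on `K → M`: it is holomorphic and the endomorphisms `C_X` commute. -/
structure IsHiggsField [IsManifold 𝓘(ℂ, EuclideanSpace ℂ (Fin n)) ω M]
    (C : ∀ x : M, TangentSpace 𝓘(ℂ, EuclideanSpace ℂ (Fin n)) x →ₗ[ℂ] K x →ₗ[ℂ] K x) : Prop where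
  holomorphic : ∀ (X : ∀ x : M, TangentSpace 𝓘(ℂ, EuclideanSpace ℂ (Fin n)) x) (s : ∀ x : M, K x) (x : M),
    HolVectorFieldAt n X x → HolSectionAt n F s x → HolSectionAt n F (fun y => C y (X y) (s y)) x
  comm : ∀ (x : M) (X Y : TangentSpace 𝓘(ℂ, EuclideanSpace ℂ (Fin n)) x), C x X ∘ₗ C x Y = C x Y ∘ₗ C x X

/-- The connection `D` on `K → M` is holomorphic. -/
def IsHolomorphicConnection [IsManifold 𝓘(ℂ, EuclideanSpace ℂ (Fin n)) ω M]
    [∀ x, IsTopologicalAddGroup (K x)] [∀ x, ContinuousSMul ℂ (K x)]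
    (D : CovariantDerivative 𝓘(ℂ, EuclideanSpace ℂ (Fin n)) F K) : Prop :=
  ∀ (X : ∀ x : M, TangentSpace 𝓘(ℂ, EuclideanSpace ℂ (Fin n)) x) (s : ∀ x : M, K x) (x : M),
    HolVectorFieldAt n X x → HolSectionAt n F s x → HolSectionAt n F (fun y => D s y (X y)) x

/-- The potentiality condition `D(C) = 0`, that is `D_X(C_Y) - D_Y(C_X) = C_{[X,Y]}` for holomorphic
vector fields `X` and `Y`, where `D_X(C_Y) s = D_X(C_Y s) - C_Y(D_X s)`. -/
def IsPotential [IsManifold 𝓘(ℂ, EuclideanSpace ℂ (Fin n)) ω M]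
    [∀ x, IsTopologicalAddGroup (K x)] [∀ x, ContinuousSMul ℂ (K x)]
    (C : ∀ x : M, TangentSpace 𝓘(ℂ, EuclideanSpace ℂ (Fin n)) x →ₗ[ℂ] K x →ₗ[ℂ] K x)
    (D : CovariantDerivative 𝓘(ℂ, EuclideanSpace ℂ (Fin n)) F K) : Prop :=
  ∀ (X Y : ∀ x : M, TangentSpace 𝓘(ℂ, EuclideanSpace ℂ (Fin n)) x) (s : ∀ x : M, K x) (x : M),
    HolVectorFieldAt n X x → HolVectorFieldAt n Y x → HolSectionAt n F s x →
      (D (fun y => C y (Y y) (s y)) x (X x) - C x (Y x) (D s x (X x))) -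
        (D (fun y => C y (X y) (s y)) x (Y x) - C x (X x) (D s x (Y x))) =
      C x (VectorField.mlieBracket 𝓘(ℂ, EuclideanSpace ℂ (Fin n)) X Y x) (s x)

end Higgs

/-! ### (T)-structures -/

section TStructure

variable {n : ℕ} {M : Type*} [TopologicalSpace M] [ChartedSpace (EuclideanSpace ℂ (Fin n)) M]
  (F : Type*) [NormedAddCommGroup F] [NormedSpace ℂ F]
  {H : ℂ × M → Type*} [TopologicalSpace (TotalSpace F H)]
  [∀ p, AddCommGroup (H p)] [∀ p, Module ℂ (H p)] [∀ p, TopologicalSpace (H p)]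
  [FiberBundle F H]

variable (n) in
/-- The section `s` of `H → ℂ × M` is holomorphic near `p`. -/
def HolSectionProdAt (s : ∀ p : ℂ × M, H p) (p : ℂ × M) : Prop :=
  ContMDiffAt (𝓘(ℂ, ℂ).prod 𝓘(ℂ, EuclideanSpace ℂ (Fin n)))
    ((𝓘(ℂ, ℂ).prod 𝓘(ℂ, EuclideanSpace ℂ (Fin n))).prod 𝓘(ℂ, F)) ω
    (fun q => TotalSpace.mk' F q (s q)) p

variable (n) in
/-- A section of the restriction `K = H|_{0} × M` of `H → ℂ × M` is holomorphic near `x`. -/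
def HolSectionZeroAt (s : ∀ x : M, H (0, x)) (x : M) : Prop :=
  ContMDiffAt 𝓘(ℂ, EuclideanSpace ℂ (Fin n))
    ((𝓘(ℂ, ℂ).prod 𝓘(ℂ, EuclideanSpace ℂ (Fin n))).prod 𝓘(ℂ, F)) ω
    (fun y => TotalSpace.mk' F ((0, y) : ℂ × M) (s y)) x

variable (n H) in
/-- A (T)-structure `(H → ℂ × M, ∇)`: a relative flat connection
`∇ : 𝒪(H) → z⁻¹ 𝒪_{ℂ × M} · Ω¹_M ⊗ 𝒪(H)`. It is given by the operator `z∇`, which has no pole: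
`zNabla s p X` is `(z∇_X s)(p)` for a tangent vector `X` of `M` at `p.2`. As for covariant
derivatives in Mathlib, the operator is defined on all sections, and the axioms concern those that
are differentiable at the point considered. -/
structure TStructure [IsManifold 𝓘(ℂ, EuclideanSpace ℂ (Fin n)) ω M]
    [∀ p, IsTopologicalAddGroup (H p)] [∀ p, ContinuousSMul ℂ (H p)] where
  /-- the operator `z∇` -/
  zNabla : (∀ p : ℂ × M, H p) → ∀ p : ℂ × M, TangentSpace 𝓘(ℂ, EuclideanSpace ℂ (Fin n)) p.2 →L[ℂ] H p
  add : ∀ (s s' : ∀ p : ℂ × M, H p) (p : ℂ × M),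
    MDifferentiableAt (𝓘(ℂ, ℂ).prod 𝓘(ℂ, EuclideanSpace ℂ (Fin n)))
      ((𝓘(ℂ, ℂ).prod 𝓘(ℂ, EuclideanSpace ℂ (Fin n))).prod 𝓘(ℂ, F)) (fun q => TotalSpace.mk' F q (s q)) p →
    MDifferentiableAt (𝓘(ℂ, ℂ).prod 𝓘(ℂ, EuclideanSpace ℂ (Fin n)))
      ((𝓘(ℂ, ℂ).prod 𝓘(ℂ, EuclideanSpace ℂ (Fin n))).prod 𝓘(ℂ, F)) (fun q => TotalSpace.mk' F q (s' q)) p →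
    zNabla (s + s') p = zNabla s p + zNabla s' p
  /-- the Leibniz rule `∇_X(a s) = X(a) s + a ∇_X s`, multiplied by `z` -/
  leibniz : ∀ (a : ℂ × M → ℂ) (s : ∀ p : ℂ × M, H p) (p : ℂ × M)
    (X : TangentSpace 𝓘(ℂ, EuclideanSpace ℂ (Fin n)) p.2),
    MDifferentiableAt (𝓘(ℂ, ℂ).prod 𝓘(ℂ, EuclideanSpace ℂ (Fin n))) 𝓘(ℂ, ℂ) a p →
    MDifferentiableAt (𝓘(ℂ, ℂ).prod 𝓘(ℂ, EuclideanSpace ℂ (Fin n)))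
      ((𝓘(ℂ, ℂ).prod 𝓘(ℂ, EuclideanSpace ℂ (Fin n))).prod 𝓘(ℂ, F)) (fun q => TotalSpace.mk' F q (s q)) p →
    zNabla (a • s) p X =
      (p.1 * mvfderiv 𝓘(ℂ, EuclideanSpace ℂ (Fin n)) (fun x => a (p.1, x)) p.2 X) • s p + a p • zNabla s p X
  /-- `z∇` maps holomorphic sections to holomorphic ones, also along `z = 0` -/
  holomorphic : ∀ (X : ∀ x : M, TangentSpace 𝓘(ℂ, EuclideanSpace ℂ (Fin n)) x) (s : ∀ p : ℂ × M, H p)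
    (p : ℂ × M), HolVectorFieldAt n X p.2 → HolSectionProdAt n F s p →
    HolSectionProdAt n F (fun q => zNabla s q (X q.2)) p
  /-- flatness `∇_X ∇_Y - ∇_Y ∇_X = ∇_{[X,Y]}` at the points with `z ≠ 0`, where
  `∇ = z⁻¹ (z∇)` -/
  flat : ∀ (X Y : ∀ x : M, TangentSpace 𝓘(ℂ, EuclideanSpace ℂ (Fin n)) x) (s : ∀ p : ℂ × M, H p) (p : ℂ × M),
    p.1 ≠ 0 → HolVectorFieldAt n X p.2 → HolVectorFieldAt n Y p.2 → HolSectionProdAt n F s p →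
    p.1⁻¹ • zNabla (fun q => q.1⁻¹ • zNabla s q (Y q.2)) p (X p.2) -
      p.1⁻¹ • zNabla (fun q => q.1⁻¹ • zNabla s q (X q.2)) p (Y p.2) =
    p.1⁻¹ • zNabla s p (VectorField.mlieBracket 𝓘(ℂ, EuclideanSpace ℂ (Fin n)) X Y p.2)

variable {F} [IsManifold 𝓘(ℂ, EuclideanSpace ℂ (Fin n)) ω M]
  [∀ p, IsTopologicalAddGroup (H p)] [∀ p, ContinuousSMul ℂ (H p)]

theorem TStructure.tensorialAt_zero (S : TStructure n F H) (x : M) :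
    TensorialAt (𝓘(ℂ, ℂ).prod 𝓘(ℂ, EuclideanSpace ℂ (Fin n))) F
      (fun s => S.zNabla s ((0, x) : ℂ × M)) ((0, x) : ℂ × M) where
  smul {f s} hf hs := by
    ext X
    have := S.leibniz f s (0, x) X hf hs
    simpa using this
  add {s s'} hs hs' := S.add s s' (0, x) hs hs'

/-- The Higgs field `C = [z∇]` on `K = H|_{0} × M`: `C_X w` is `(z∇_X s)(0, x)` for any section `s`
of `H` with `s(0, x) = w` which is differentiable at `(0, x)`. -/
noncomputable def TStructure.higgs [VectorBundle ℂ F H] [FiniteDimensional ℂ F]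
    [ContMDiffVectorBundle ω F H (𝓘(ℂ, ℂ).prod 𝓘(ℂ, EuclideanSpace ℂ (Fin n)))] (S : TStructure n F H) (x : M) :
    TangentSpace 𝓘(ℂ, EuclideanSpace ℂ (Fin n)) x →ₗ[ℂ] H (0, x) →ₗ[ℂ] H (0, x) :=
  LinearMap.mk₂ ℂ (fun X w => TensorialAt.mkHom _ _ (S.tensorialAt_zero x) w X)
    (fun _ _ _ => map_add _ _ _) (fun _ _ _ => map_smul _ _ _)
    (fun _ _ _ => by rw [map_add]; rfl) (fun _ _ _ => by rw [map_smul]; rfl)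

end TStructure

end FMan

/-!
In a chart, let `aₖ(t)` be the matrix of the multiplication by `∂ₖ`. The point `(t, y)` lies on the
spectral cover exactly if `y` is a character of the algebra `T_tM`. A good connection, or the first
order term in `z` of the flatness of a `(T)`-structure, provides matrices `Γₖ` such that
`∂ₖaₗ + [Γₖ, aₗ]` is symmetric in `k` and `l`.

Idempotents extend holomorphically, so an idempotent of minimal trace separates one sheet: near a
dense set of its points the spectral cover is a graph `y = Y(t)` with `Yₗ = tr(v aₗ) / tr v` for a
holomorphic family of idempotents `v`. Both `tr(v [Γₖ, aₗ])` and `tr(v' aₗ)`, for a derivative `v'`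
of `v`, vanish, so `∑ₗ Yₗ dtₗ` is closed and the graph is Lagrangian. By continuity, Poisson brackets
of functions vanishing on the spectral cover vanish on it.

It remains to identify the radical of the ideal with the germs vanishing on the spectral cover.
Division by the characteristic matrices of the `aₖ`, through Cauchy's integral formula, reduces every
germ modulo the ideal to the form `∑ₖ cₖ(t) yₖ`. If such a germ vanishes on the whole fibres, then
`∑ₖ cₖ(t) ∂ₖ` is killed by all characters of `T_tM`, so its `n`-th power is zero.
-/

namespace FMan

open Matrix

section FiniteAlgebra

variable {k B : Type*} [Field k] [CommRing B] [Algebra k B] [Module.Finite k B]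

theorem isNilpotent_of_forall_algHom [IsAlgClosed k] {x : B} (hx : ∀ χ : B →ₐ[k] k, χ x = 0) :
    IsNilpotent x := by
  rw [nilpotent_iff_mem_prime]
  intro J hJ
  have hs : Function.Bijective (Algebra.ofId k (B ⧸ J)) :=
    IsAlgClosed.algebraMap_bijective_of_isIntegral
  have h0 := hx ((AlgEquiv.ofBijective (Algebra.ofId k (B ⧸ J)) hs).symm.toAlgHom.comp
    (Ideal.Quotient.mkₐ k J))
  simpa [Ideal.Quotient.eq_zero_iff_mem] using h0

theorem exists_algHom_eq_one_and_forall_ne (χ₀ : B →ₐ[k] k) :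
    ∃ b, χ₀ b = 1 ∧ ∀ χ : B →ₐ[k] k, χ ≠ χ₀ → χ b = 0 := by
  classical
  have : Fintype (B →ₐ[k] k) := Fintype.ofFinite _
  have separate : ∀ χ : B →ₐ[k] k, ∃ b, χ ≠ χ₀ → χ₀ b = 1 ∧ χ b = 0 := by
    intro χ
    rcases eq_or_ne χ χ₀ with rfl | hne
    · exact ⟨0, fun h => (h rfl).elim⟩
    obtain ⟨c, hc⟩ := DFunLike.ne_iff.1 hne
    exact ⟨(χ₀ c - χ c)⁻¹ • (c - algebraMap k B (χ c)),
      fun _ => ⟨by simp [sub_ne_zero.2 hc.symm], by simp⟩⟩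
  choose b hb using separate
  refine ⟨∏ χ ∈ Finset.univ.erase χ₀, b χ, ?_, fun χ hχ => ?_⟩
  · rw [map_prod]
    exact Finset.prod_eq_one fun χ hχ => (hb χ (Finset.ne_of_mem_erase hχ)).1
  · rw [map_prod]
    exact Finset.prod_eq_zero (Finset.mem_erase.2 ⟨hχ, Finset.mem_univ _⟩) (hb χ hχ).2

theorem exists_isIdempotentElem_algHom [IsAlgClosed k] (χ₀ : B →ₐ[k] k) :
    ∃ b : B, IsIdempotentElem b ∧ χ₀ b = 1 ∧ ∀ χ : B →ₐ[k] k, χ ≠ χ₀ → χ b = 0 := by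
  obtain ⟨b, hb₁, hb₀⟩ := exists_algHom_eq_one_and_forall_ne χ₀
  obtain ⟨N, hN⟩ : IsNilpotent (b - b ^ 2) := by
    refine isNilpotent_of_forall_algHom (k := k) fun χ => ?_
    rcases eq_or_ne χ χ₀ with rfl | hne
    · simp [hb₁]
    · simp [hb₀ χ hne]
  have hN' : (b - b ^ 2) ^ (N + 1) = 0 := by rw [pow_succ, hN, zero_mul]
  exact ⟨1 - (1 - b ^ (N + 1)) ^ (N + 1), isIdempotentElem_one_sub_one_sub_pow_pow b (N + 1) hN',
    by simp [hb₁], fun χ hχ => by simp [hb₀ χ hχ]⟩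

end FiniteAlgebra

section CommRing

variable {ι R S : Type*} [Fintype ι] [CommRing R] [CommRing S]

/-- Multiplication by the vector `x`, for the bilinear multiplication on `Rⁿ` under which the
`i`-th basis vector acts by the matrix `a i`. -/
noncomputable def opMatrix (a : ι → Matrix ι ι R) : (ι → R) →ₗ[R] Matrix ι ι R :=
  Fintype.linearCombination R a

/-- Characters of the algebra `Rⁿ` with unit `e` in which the `i`-th basis vector acts by the
matrix `a i`: the linear form with coefficients `y` is a unital algebra homomorphism to `R`. -/
def IsChar (a : ι → Matrix ι ι R) (e y : ι → R) : Prop :=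
  e ⬝ᵥ y = 1 ∧ ∀ i j, y i * y j = ∑ l, a i l j * y l

theorem opMatrix_apply (a : ι → Matrix ι ι R) (x : ι → R) : opMatrix a x = ∑ i, x i • a i := rfl

theorem opMatrix_mulVec_apply (a : ι → Matrix ι ι R) (x x' : ι → R) (l : ι) :
    (opMatrix a x *ᵥ x') l = ∑ i, ∑ j, x i * x' j * a i l j := by
  simp only [opMatrix_apply, Matrix.mulVec, dotProduct, Matrix.sum_apply, Matrix.smul_apply,
    smul_eq_mul, Finset.sum_mul]
  rw [Finset.sum_comm]
  simp only [mul_right_comm]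

variable {a : ι → Matrix ι ι R} {e y : ι → R}

theorem IsChar.vecMul (hy : IsChar a e y) (x : ι → R) : y ᵥ* opMatrix a x = (y ⬝ᵥ x) • y := by
  ext j
  simp only [Matrix.vecMul, dotProduct, opMatrix_apply, Matrix.sum_apply, Matrix.smul_apply,
    smul_eq_mul, Finset.mul_sum, Pi.smul_apply, Finset.sum_mul]
  rw [Finset.sum_comm]
  refine Finset.sum_congr rfl fun i _ => ?_
  rw [mul_right_comm, hy.2 i j, Finset.sum_mul]
  exact Finset.sum_congr rfl fun l _ => by ring

theorem IsChar.dotProduct_mulVec (hy : IsChar a e y) (x x' : ι → R) :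
    y ⬝ᵥ (opMatrix a x *ᵥ x') = (y ⬝ᵥ x) * (y ⬝ᵥ x') := by
  rw [Matrix.dotProduct_mulVec, hy.vecMul, smul_dotProduct, smul_eq_mul]

theorem IsChar.dotProduct_eq_zero_or_one [NoZeroDivisors R] (hy : IsChar a e y) {v : ι → R}
    (hv : opMatrix a v *ᵥ v = v) : y ⬝ᵥ v = 0 ∨ y ⬝ᵥ v = 1 := by
  have h := hy.dotProduct_mulVec v v
  rw [hv] at h
  exact IsIdempotentElem.iff_eq_zero_or_one.1 h.symm

theorem map_opMatrix (φ : R →+* S) (a : ι → Matrix ι ι R) (x : ι → R) :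
    (opMatrix a x).map φ = opMatrix (fun i => (a i).map φ) (φ ∘ x) := by
  ext l j
  simp [opMatrix_apply, Matrix.sum_apply]

theorem map_opMatrix_mulVec (φ : R →+* S) (a : ι → Matrix ι ι R) (x x' : ι → R) :
    φ ∘ (opMatrix a x *ᵥ x') = opMatrix (fun i => (a i).map φ) (φ ∘ x) *ᵥ (φ ∘ x') := by
  ext l
  rw [← map_opMatrix]
  exact φ.map_mulVec _ _ l

variable [DecidableEq ι]

theorem opMatrix_single (a : ι → Matrix ι ι R) (i : ι) : opMatrix a (Pi.single i 1) = a i := by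
  simp [opMatrix]

theorem IsChar.vecMul_pow (hy : IsChar a e y) (x : ι → R) (m : ℕ) :
    y ᵥ* opMatrix a x ^ m = (y ⬝ᵥ x) ^ m • y := by
  induction m with
  | zero => simp
  | succ m ih => rw [pow_succ, ← vecMul_vecMul, ih, smul_vecMul, hy.vecMul, smul_smul, pow_succ]

theorem IsChar.dotProduct_pow_eq_zero (hy : IsChar a e y) {x : ι → R} {m : ℕ}
    (hx : opMatrix a x ^ m = 0) : (y ⬝ᵥ x) ^ m = 0 := by
  have h : (y ⬝ᵥ x) ^ m • y = 0 := by rw [← hy.vecMul_pow, hx, vecMul_zero]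
  rw [← mul_one (_ ^ m), ← hy.1, ← smul_eq_mul, ← dotProduct_smul, h, dotProduct_zero]

/-- The matrices `a i` of the multiplications by the basis vectors of `Rⁿ`, and the vector `e`,
define a commutative associative algebra with unit: `a i l j` is the structure constant `aᵢⱼˡ`. -/
structure IsAlgebraTable (a : ι → Matrix ι ι R) (e : ι → R) : Prop where
  mul : ∀ i j, a i * a j = ∑ l, a i l j • a l
  unit : ∑ l, e l • a l = 1
  symm : ∀ i j l, a i l j = a j l i

namespace IsAlgebraTable

theorem opMatrix_unit (h : IsAlgebraTable a e) : opMatrix a e = 1 := h.unit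

theorem commute (h : IsAlgebraTable a e) (i j : ι) : Commute (a i) (a j) := by
  rw [commute_iff_eq, h.mul, h.mul]
  simp only [h.symm i j]

theorem opMatrix_commute (h : IsAlgebraTable a e) (x x' : ι → R) :
    Commute (opMatrix a x) (opMatrix a x') :=
  Commute.sum_right _ _ _ fun j _ => Commute.sum_left _ _ _ fun i _ =>
    ((h.commute i j).smul_left _).smul_right _

theorem opMatrix_mulVec_unit (h : IsAlgebraTable a e) (x : ι → R) : opMatrix a x *ᵥ e = x := by
  ext l
  have unit_apply : ∀ i, ∑ j, e j * a i l j = (1 : Matrix ι ι R) l i := by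
    intro i
    rw [← h.unit, Matrix.sum_apply]
    exact Finset.sum_congr rfl fun j _ => by rw [h.symm i j]; rfl
  rw [opMatrix_mulVec_apply]
  simp only [mul_assoc, ← Finset.mul_sum, unit_apply]
  simp [Matrix.one_apply]

theorem opMatrix_injective (h : IsAlgebraTable a e) : Function.Injective (opMatrix a) :=
  fun x x' hx => by rw [← h.opMatrix_mulVec_unit x, hx, h.opMatrix_mulVec_unit]

theorem opMatrix_mul (h : IsAlgebraTable a e) (x x' : ι → R) :
    opMatrix a x * opMatrix a x' = opMatrix a (opMatrix a x *ᵥ x') := by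
  have basis : ∀ i j, a i * a j = opMatrix a (a i *ᵥ Pi.single j 1) := fun i j => by
    rw [h.mul, opMatrix_apply, Matrix.mulVec_single_one]; rfl
  have linear : ∀ i, a i * opMatrix a x' = opMatrix a (a i *ᵥ x') := fun i => by
    conv_rhs => rw [pi_eq_sum_univ' x', Matrix.mulVec_sum, map_sum]
    simp only [opMatrix_apply a x', Finset.mul_sum, Matrix.mul_smul, basis, Matrix.mulVec_smul,
      map_smul]
  conv_lhs => rw [opMatrix_apply a x]
  rw [opMatrix_apply a x, Finset.sum_mul, Matrix.sum_mulVec, map_sum]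
  simp only [Matrix.smul_mul, linear, Matrix.smul_mulVec, map_smul]

theorem mulVec_comm (h : IsAlgebraTable a e) (x x' : ι → R) :
    opMatrix a x *ᵥ x' = opMatrix a x' *ᵥ x :=
  h.opMatrix_injective (by rw [← h.opMatrix_mul, ← h.opMatrix_mul, h.opMatrix_commute])

/-- The algebra of all multiplication operators, isomorphic to the algebra `Rⁿ` with the given
multiplication table. -/
def algebra (h : IsAlgebraTable a e) : Subalgebra R (Matrix ι ι R) where
  carrier := LinearMap.range (opMatrix a)
  mul_mem' := by
    rintro _ _ ⟨x, rfl⟩ ⟨x', rfl⟩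
    exact ⟨_, (h.opMatrix_mul x x').symm⟩
  add_mem' := add_mem
  algebraMap_mem' c := ⟨c • e, by
    rw [map_smul, h.opMatrix_unit, Algebra.algebraMap_eq_smul_one]⟩

/-- A vector of `Rⁿ` as an element of the algebra of multiplication operators. -/
noncomputable def toAlgebra (h : IsAlgebraTable a e) : (ι → R) ≃ₗ[R] h.algebra :=
  LinearEquiv.ofInjective (opMatrix a) h.opMatrix_injective

theorem toAlgebra_mul (h : IsAlgebraTable a e) (x x' : ι → R) :
    h.toAlgebra x * h.toAlgebra x' = h.toAlgebra (opMatrix a x *ᵥ x') :=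
  Subtype.ext (h.opMatrix_mul x x')

theorem toAlgebra_unit (h : IsAlgebraTable a e) : h.toAlgebra e = 1 :=
  Subtype.ext h.opMatrix_unit

noncomputable instance commRing (h : IsAlgebraTable a e) : CommRing h.algebra :=
  { h.algebra.toRing with
    mul_comm := fun A B => by
      obtain ⟨x, rfl⟩ := h.toAlgebra.surjective A
      obtain ⟨x', rfl⟩ := h.toAlgebra.surjective B
      exact Subtype.ext (h.opMatrix_commute x x') }

theorem exists_algHom (h : IsAlgebraTable a e) (hy : IsChar a e y) :
    ∃ χ : h.algebra →ₐ[R] R, ∀ x, χ (h.toAlgebra x) = y ⬝ᵥ x := by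
  let ψ : h.algebra →ₗ[R] R := dotProductBilin R R y ∘ₗ h.toAlgebra.symm.toLinearMap
  have hψ : ∀ x, ψ (h.toAlgebra x) = y ⬝ᵥ x := fun x => by simp [ψ]
  refine ⟨AlgHom.ofLinearMap ψ ?_ ?_, hψ⟩
  · rw [← h.toAlgebra_unit, hψ, dotProduct_comm, hy.1]
  · intro A B
    obtain ⟨x, rfl⟩ := h.toAlgebra.surjective A
    obtain ⟨x', rfl⟩ := h.toAlgebra.surjective B
    rw [h.toAlgebra_mul, hψ, hψ, hψ, hy.dotProduct_mulVec]

theorem exists_isChar (h : IsAlgebraTable a e) (χ : h.algebra →ₐ[R] R) :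
    ∃ y, IsChar a e y ∧ ∀ x, χ (h.toAlgebra x) = y ⬝ᵥ x := by
  have eval : ∀ x, χ (h.toAlgebra x) = (fun i => χ (h.toAlgebra (Pi.single i 1))) ⬝ᵥ x := by
    intro x
    conv_lhs => rw [pi_eq_sum_univ' x]
    simp only [map_sum, map_smul, smul_eq_mul, dotProduct, mul_comm]
  refine ⟨_, ⟨?_, fun i j => ?_⟩, eval⟩
  · rw [dotProduct_comm, ← eval, h.toAlgebra_unit, map_one]
  · rw [← map_mul, h.toAlgebra_mul, eval, opMatrix_single]
    simp [dotProduct, mul_comm]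

theorem isIdempotentElem_opMatrix (h : IsAlgebraTable a e) {v : ι → R}
    (hv : opMatrix a v *ᵥ v = v) : IsIdempotentElem (opMatrix a v) := by
  rw [IsIdempotentElem, h.opMatrix_mul, hv]

theorem idempotent_mul (h : IsAlgebraTable a e) {v w : ι → R} (hv : opMatrix a v *ᵥ v = v)
    (hw : opMatrix a w *ᵥ w = w) :
    opMatrix a (opMatrix a w *ᵥ v) *ᵥ (opMatrix a w *ᵥ v) = opMatrix a w *ᵥ v := by
  apply h.opMatrix_injective
  rw [← h.opMatrix_mul, ← h.opMatrix_mul]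
  exact IsIdempotentElem.mul_of_commute (h.opMatrix_commute w v)
    (h.isIdempotentElem_opMatrix hw) (h.isIdempotentElem_opMatrix hv)

theorem idempotent_sub (h : IsAlgebraTable a e) {v w : ι → R} (hv : opMatrix a v *ᵥ v = v)
    (hw : opMatrix a w *ᵥ w = w) :
    opMatrix a (v - opMatrix a w *ᵥ v) *ᵥ (v - opMatrix a w *ᵥ v) = v - opMatrix a w *ᵥ v := by
  have absorb : opMatrix a v *ᵥ (opMatrix a w *ᵥ v) = opMatrix a w *ᵥ v := by
    rw [mulVec_mulVec, h.opMatrix_commute v w, ← mulVec_mulVec, hv]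
  rw [map_sub, sub_mulVec, mulVec_sub, mulVec_sub, hv, absorb, h.idempotent_mul hv hw,
    h.mulVec_comm (opMatrix a w *ᵥ v) v, absorb, sub_self, sub_zero]

end IsAlgebraTable

end CommRing

section Field

variable {ι k : Type*} [Fintype ι] [Field k] [DecidableEq ι]

variable {a : ι → Matrix ι ι k} {e y : ι → k}

namespace IsAlgebraTable

theorem isNilpotent_opMatrix [IsAlgClosed k] (h : IsAlgebraTable a e) {x : ι → k}
    (hx : ∀ y, IsChar a e y → y ⬝ᵥ x = 0) : IsNilpotent (opMatrix a x) := by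
  refine IsNilpotent.map (f := h.algebra.val) (r := h.toAlgebra x) ?_
  refine isNilpotent_of_forall_algHom (k := k) fun χ => ?_
  obtain ⟨y, hy, hyx⟩ := h.exists_isChar χ
  rw [hyx, hx y hy]

theorem opMatrix_pow_card_eq_zero [IsAlgClosed k] (h : IsAlgebraTable a e) {x : ι → k}
    (hx : ∀ y, IsChar a e y → y ⬝ᵥ x = 0) : opMatrix a x ^ Fintype.card ι = 0 := by
  have charpoly_eq := sub_eq_zero.1 (Matrix.isNilpotent_charpoly_sub_pow_of_isNilpotent
    (h.isNilpotent_opMatrix hx)).eq_zero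
  simpa [charpoly_eq] using Matrix.aeval_self_charpoly (opMatrix a x)

theorem exists_primitive_idempotent [IsAlgClosed k] (h : IsAlgebraTable a e) (hy : IsChar a e y) :
    ∃ v, opMatrix a v *ᵥ v = v ∧ y ⬝ᵥ v = 1 ∧ ∀ y', IsChar a e y' → y' ≠ y → y' ⬝ᵥ v = 0 := by
  obtain ⟨χ₀, hχ₀⟩ := h.exists_algHom hy
  obtain ⟨b, hb, hb₁, hb₀⟩ := exists_isIdempotentElem_algHom χ₀
  obtain ⟨v, rfl⟩ := h.toAlgebra.surjective b
  refine ⟨v, h.toAlgebra.injective ?_, hχ₀ v ▸ hb₁, fun y' hy' hne => ?_⟩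
  · rw [← h.toAlgebra_mul]
    exact hb
  · obtain ⟨χ, hχ⟩ := h.exists_algHom hy'
    rw [← hχ]
    refine hb₀ χ ?_
    rintro rfl
    refine hne (funext fun i => ?_)
    simpa using (hχ (Pi.single i 1)).symm.trans (hχ₀ (Pi.single i 1))

theorem exists_isChar_dotProduct_eq_one [IsAlgClosed k] (h : IsAlgebraTable a e) {v : ι → k}
    (hv : opMatrix a v *ᵥ v = v) (hv₀ : v ≠ 0) : ∃ y, IsChar a e y ∧ y ⬝ᵥ v = 1 := by
  by_contra! hne
  have hzero : IsNilpotent (opMatrix a v) := h.isNilpotent_opMatrix fun y hy =>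
    (hy.dotProduct_eq_zero_or_one hv).resolve_right (hne y hy)
  refine hv₀ (h.opMatrix_injective ?_)
  rw [(h.isIdempotentElem_opMatrix hv).eq_zero_of_isNilpotent hzero, map_zero]

theorem trace_opMatrix_mul [IsAlgClosed k] (h : IsAlgebraTable a e) {v y : ι → k}
    (hv : opMatrix a v *ᵥ v = v) (huniq : ∀ z, IsChar a e z → z ⬝ᵥ v = 1 → z = y) (l : ι) :
    (opMatrix a v * a l).trace = (opMatrix a v).trace * y l := by
  have hnil : IsNilpotent (opMatrix a (opMatrix a v *ᵥ (Pi.single l 1 - y l • e))) := by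
    refine h.isNilpotent_opMatrix fun z hz => ?_
    rw [hz.dotProduct_mulVec]
    rcases hz.dotProduct_eq_zero_or_one hv with h₀ | h₁
    · rw [h₀, zero_mul]
    · obtain rfl := huniq z hz h₁
      rw [dotProduct_sub, dotProduct_smul, dotProduct_comm z e, hz.1]
      simp
  have htrace := (isNilpotent_trace_of_isNilpotent hnil).eq_zero
  rw [← h.opMatrix_mul, map_sub, map_smul, h.opMatrix_unit, opMatrix_single, mul_sub, trace_sub,
    mul_smul_comm, mul_one, trace_smul, sub_eq_zero] at htrace
  rw [htrace, smul_eq_mul, mul_comm]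

section CharZero

variable [CharZero k]

theorem exists_trace_opMatrix_eq_natCast (h : IsAlgebraTable a e) {v : ι → k}
    (hv : opMatrix a v *ᵥ v = v) : ∃ m : ℕ, (opMatrix a v).trace = m ∧ (m = 0 → v = 0) := by
  have hidem : IsIdempotentElem (toLin' (opMatrix a v)) := by
    rw [IsIdempotentElem, Module.End.mul_eq_comp, ← toLin'_mul, h.isIdempotentElem_opMatrix hv]
  have htrace : (opMatrix a v).trace = Module.finrank k (LinearMap.range (toLin' (opMatrix a v))) :=
    trace_toLin'_eq (opMatrix a v) ▸ (LinearMap.IsIdempotentElem.isProj_range _ hidem).trace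
  refine ⟨_, htrace, fun hzero => h.opMatrix_injective ?_⟩
  rw [hzero, ← trace_toLin'_eq, Nat.cast_zero] at htrace
  rw [map_zero, ← toLin'.map_eq_zero_iff]
  exact LinearMap.IsIdempotentElem.eq_zero_of_trace_eq_zero hidem htrace

-- Otherwise a primitive idempotent `w` at one of the characters splits off a proper part of `v`.
theorem isChar_eq_of_minimal_trace [IsAlgClosed k] (h : IsAlgebraTable a e) {v : ι → k}
    (hv : opMatrix a v *ᵥ v = v) {m : ℕ} (hm : (opMatrix a v).trace = m)
    (hmin : ∀ w, opMatrix a w *ᵥ w = w → w ≠ 0 →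
      (∀ y, IsChar a e y → y ⬝ᵥ w = 1 → y ⬝ᵥ v = 1) →
        ∀ m' : ℕ, (opMatrix a w).trace = m' → m ≤ m')
    (hy : IsChar a e y) (hyv : y ⬝ᵥ v = 1) {y' : ι → k} (hy' : IsChar a e y')
    (hyv' : y' ⬝ᵥ v = 1) : y' = y := by
  by_contra hne
  obtain ⟨w, hw, hyw, hother⟩ := h.exists_primitive_idempotent hy
  have hwv := h.idempotent_mul hv hw
  have hsub := h.idempotent_sub hv hw
  obtain ⟨m₁, hm₁, -⟩ := h.exists_trace_opMatrix_eq_natCast hwv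
  obtain ⟨m₂, hm₂, hm₂zero⟩ := h.exists_trace_opMatrix_eq_natCast hsub
  have hle : m ≤ m₁ := by
    refine hmin _ hwv (fun hzero => ?_) (fun z hz hzwv => ?_) m₁ hm₁
    · have := hy.dotProduct_mulVec w v
      simp [hzero, hyw, hyv] at this
    · rw [hz.dotProduct_mulVec] at hzwv
      exact (hz.dotProduct_eq_zero_or_one hv).resolve_left fun hzero => by simp [hzero] at hzwv
  have hm₂ne : m₂ ≠ 0 := fun hzero => by
    have : y' ⬝ᵥ (v - opMatrix a w *ᵥ v) = 1 := by
      rw [dotProduct_sub, hy'.dotProduct_mulVec, hother y' hy' hne, hyv', zero_mul, sub_zero]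
    simp [hm₂zero hzero] at this
  have hadd : m = m₁ + m₂ := by
    have : (m : k) = m₁ + m₂ := by
      rw [← hm, ← hm₁, ← hm₂, ← trace_add, map_sub, add_sub_cancel]
    exact_mod_cast this
  lia

end CharZero

end IsAlgebraTable

end Field

section EntrywiseAnalytic

variable {𝕜 X ι κ ν : Type*} [NontriviallyNormedField 𝕜] [NormedAddCommGroup X] [NormedSpace 𝕜 X]
  [Fintype ι] {x : X}

theorem analyticAt_matrix_mul {A : X → Matrix κ ι 𝕜} {B : X → Matrix ι ν 𝕜}
    (hA : ∀ i j, AnalyticAt 𝕜 (fun s => A s i j) x) (hB : ∀ i j, AnalyticAt 𝕜 (fun s => B s i j) x)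
    (i : κ) (j : ν) : AnalyticAt 𝕜 (fun s => (A s * B s) i j) x := by
  simp only [mul_apply]
  exact Finset.analyticAt_fun_sum _ fun l _ => (hA i l).mul (hB l j)

theorem analyticAt_dotProduct {v w : X → ι → 𝕜} (hv : ∀ i, AnalyticAt 𝕜 (fun s => v s i) x)
    (hw : ∀ i, AnalyticAt 𝕜 (fun s => w s i) x) : AnalyticAt 𝕜 (fun s => v s ⬝ᵥ w s) x :=
  Finset.analyticAt_fun_sum _ fun i _ => (hv i).mul (hw i)

theorem analyticAt_trace {A : X → Matrix ι ι 𝕜} (hA : ∀ i j, AnalyticAt 𝕜 (fun s => A s i j) x) :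
    AnalyticAt 𝕜 (fun s => (A s).trace) x :=
  Finset.analyticAt_fun_sum _ fun i _ => hA i i

theorem analyticAt_opMatrix {a : ι → X → Matrix ι ι 𝕜} {v : X → ι → 𝕜}
    (ha : ∀ i j l, AnalyticAt 𝕜 (fun s => a i s j l) x)
    (hv : ∀ i, AnalyticAt 𝕜 (fun s => v s i) x) (j l : ι) :
    AnalyticAt 𝕜 (fun s => opMatrix (fun i => a i s) (v s) j l) x := by
  simp only [opMatrix_apply, Matrix.sum_apply, Matrix.smul_apply, smul_eq_mul]
  exact Finset.analyticAt_fun_sum _ fun i _ => (hv i).mul (ha i j l)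

end EntrywiseAnalytic

section AlgebraFamily

variable {n : ℕ}

/-- A holomorphic family of commutative algebras over the open set `U`. -/
structure IsAlgebraFamily (U : Set (EuclideanSpace ℂ (Fin n)))
    (a : Fin n → EuclideanSpace ℂ (Fin n) → Matrix (Fin n) (Fin n) ℂ)
    (e : EuclideanSpace ℂ (Fin n) → Fin n → ℂ) : Prop where
  isOpen : IsOpen U
  analyticAt : ∀ i j k, ∀ t ∈ U, AnalyticAt ℂ (fun s => a i s j k) t
  analyticAt_unit : ∀ k, ∀ t ∈ U, AnalyticAt ℂ (fun s => e s k) t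
  table : ∀ t ∈ U, IsAlgebraTable (fun i => a i t) (e t)

/-- The set of all characters of the algebras of a family: the points of its analytic spectrum. -/
def charSet (U : Set (EuclideanSpace ℂ (Fin n)))
    (a : Fin n → EuclideanSpace ℂ (Fin n) → Matrix (Fin n) (Fin n) ℂ)
    (e : EuclideanSpace ℂ (Fin n) → Fin n → ℂ) : Set (CotCoord n) :=
  {q | q.1 ∈ U ∧ IsChar (fun i => a i q.1) (e q.1) q.2}

theorem norm_le_of_isChar {b : Fin n → Matrix (Fin n) (Fin n) ℂ} {u y : Fin n → ℂ}
    (hy : IsChar b u y) : ‖y‖ ≤ ∑ i, ∑ k, ‖b i k i‖ := by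
  set R := ∑ i, ∑ k, ‖b i k i‖
  rcases eq_or_ne y 0 with rfl | hy₀
  · rw [norm_zero]
    positivity
  have hpos : 0 < ‖y‖ := norm_pos_iff.2 hy₀
  have norm_mul_self_le : ∀ i, ‖y i‖ * ‖y i‖ ≤ R * ‖y‖ := fun i => by
    calc ‖y i‖ * ‖y i‖ = ‖∑ k, b i k i * y k‖ := by rw [← norm_mul, hy.2 i i]
      _ ≤ ∑ k, ‖b i k i‖ * ‖y‖ := norm_sum_le_of_le _ fun k _ => by
          rw [norm_mul]
          exact mul_le_mul_of_nonneg_left (norm_le_pi_norm y k) (norm_nonneg _)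
      _ = (∑ k, ‖b i k i‖) * ‖y‖ := by rw [Finset.sum_mul]
      _ ≤ R * ‖y‖ := by
          gcongr
          exact Finset.single_le_sum (f := fun i => ∑ k, ‖b i k i‖)
            (fun i _ => by positivity) (Finset.mem_univ i)
  have norm_le_sqrt : ‖y‖ ≤ √(R * ‖y‖) :=
    (pi_norm_le_iff_of_nonneg (Real.sqrt_nonneg _)).2 fun i => Real.le_sqrt_of_sq_le (by
      rw [sq]
      exact norm_mul_self_le i)
  rw [Real.le_sqrt' hpos, sq] at norm_le_sqrt
  exact le_of_mul_le_mul_right norm_le_sqrt hpos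

namespace IsAlgebraFamily

variable {U : Set (EuclideanSpace ℂ (Fin n))}
  {a : Fin n → EuclideanSpace ℂ (Fin n) → Matrix (Fin n) (Fin n) ℂ}
  {e : EuclideanSpace ℂ (Fin n) → Fin n → ℂ} {t₀ : EuclideanSpace ℂ (Fin n)}

theorem eventually_not_isChar (h : IsAlgebraFamily U a e) (ht₀ : t₀ ∈ U) {y : Fin n → ℂ}
    (hy : ¬ IsChar (fun i => a i t₀) (e t₀) y) :
    ∀ᶠ z in 𝓝 (t₀, y), ¬ IsChar (fun i => a i z.1) (e z.1) z.2 := by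
  have snd : ∀ k, AnalyticAt ℂ (fun z : EuclideanSpace ℂ (Fin n) × (Fin n → ℂ) => z.2 k) (t₀, y) :=
    fun k => analyticAt_pi_iff.1 analyticAt_snd k
  have unit : AnalyticAt ℂ (fun z : EuclideanSpace ℂ (Fin n) × (Fin n → ℂ) => e z.1 ⬝ᵥ z.2)
      (t₀, y) :=
    analyticAt_dotProduct (fun k => (h.analyticAt_unit k t₀ ht₀).comp_of_eq analyticAt_fst rfl) snd
  have mul : ∀ i j, AnalyticAt ℂ (fun z : EuclideanSpace ℂ (Fin n) × (Fin n → ℂ) =>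
      (fun k => a i z.1 k j) ⬝ᵥ z.2) (t₀, y) := fun i j =>
    analyticAt_dotProduct (fun k => (h.analyticAt i k j t₀ ht₀).comp_of_eq analyticAt_fst rfl) snd
  rw [IsChar, not_and_or] at hy
  push Not at hy
  rcases hy with hunit | ⟨i, j, hmul⟩
  · filter_upwards [unit.continuousAt.eventually_ne hunit] with z hz hchar using hz hchar.1
  · filter_upwards [(((snd i).mul (snd j)).sub (mul i j)).continuousAt.eventually_ne
      (sub_ne_zero.2 hmul)] with z hz hchar using hz (sub_eq_zero.2 (hchar.2 i j))

-- The characters over a compact neighbourhood form a compact set.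
theorem eventually_forall_isChar (h : IsAlgebraFamily U a e) (ht₀ : t₀ ∈ U)
    {v : EuclideanSpace ℂ (Fin n) → Fin n → ℂ} (hv : ContinuousAt v t₀)
    {p : EuclideanSpace ℂ (Fin n) → (Fin n → ℂ) → Prop}
    (hp : ∀ y, IsChar (fun i => a i t₀) (e t₀) y → y ⬝ᵥ v t₀ = 1 →
      ∀ᶠ z in 𝓝 (t₀, y), p z.1 z.2) :
    ∀ᶠ t in 𝓝 t₀, ∀ y, IsChar (fun i => a i t) (e t) y → y ⬝ᵥ v t = 1 → p t y := by
  have bound_continuousAt : ContinuousAt (fun t => ∑ i, ∑ k, ‖a i t k i‖) t₀ :=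
    tendsto_finsetSum _ fun i _ => tendsto_finsetSum _ fun k _ =>
      (h.analyticAt i k i t₀ ht₀).continuousAt.norm
  set R := ∑ i, ∑ k, ‖a i t₀ k i‖ + 1
  have bound_lt : ∀ᶠ t in 𝓝 t₀, ∑ i, ∑ k, ‖a i t k i‖ < R :=
    bound_continuousAt.eventually_lt continuousAt_const (lt_add_one _)
  have on_closedBall :=
    (isCompact_closedBall (0 : Fin n → ℂ) R).eventually_forall_of_forall_eventually
    (x₀ := t₀) (P := fun t y => IsChar (fun i => a i t) (e t) y → y ⬝ᵥ v t = 1 → p t y) ?_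
  · filter_upwards [on_closedBall, bound_lt] with t hall hlt y hy
    exact hall y (by simpa using (norm_le_of_isChar hy).trans hlt.le) hy
  · intro y _
    have pairing : ContinuousAt (fun z : EuclideanSpace ℂ (Fin n) × (Fin n → ℂ) => z.2 ⬝ᵥ v z.1)
        (t₀, y) := tendsto_finsetSum _ fun k _ => ContinuousAt.mul (by fun_prop)
      (((continuous_apply k).continuousAt.comp hv).comp_of_eq continuousAt_fst rfl)
    by_cases hy : IsChar (fun i => a i t₀) (e t₀) y
    · by_cases hyv : y ⬝ᵥ v t₀ = 1
      · filter_upwards [hp y hy hyv] with z hz _ _ using hz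
      · filter_upwards [pairing.eventually_ne hyv] with z hz _ hzv using absurd hzv hz
    · filter_upwards [h.eventually_not_isChar ht₀ hy] with z hz hchar using absurd hchar hz

end IsAlgebraFamily

/-- The map `(t, v) ↦ v² - v`, whose zeros are the idempotents of the algebras of a family. -/
noncomputable def idempotentDefect
    (a : Fin n → EuclideanSpace ℂ (Fin n) → Matrix (Fin n) (Fin n) ℂ)
    (z : EuclideanSpace ℂ (Fin n) × (Fin n → ℂ)) : Fin n → ℂ :=
  opMatrix (fun i => a i z.1) z.2 *ᵥ z.2 - z.2

namespace IsAlgebraFamily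

variable {U : Set (EuclideanSpace ℂ (Fin n))}
  {a : Fin n → EuclideanSpace ℂ (Fin n) → Matrix (Fin n) (Fin n) ℂ}
  {e : EuclideanSpace ℂ (Fin n) → Fin n → ℂ} {t₀ : EuclideanSpace ℂ (Fin n)} {v₀ : Fin n → ℂ}

theorem analyticAt_idempotentDefect (h : IsAlgebraFamily U a e) (ht₀ : t₀ ∈ U) (v₀ : Fin n → ℂ) :
    AnalyticAt ℂ (idempotentDefect a) (t₀, v₀) := by
  have snd : ∀ k, AnalyticAt ℂ (fun z : EuclideanSpace ℂ (Fin n) × (Fin n → ℂ) => z.2 k)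
      (t₀, v₀) := fun k => analyticAt_pi_iff.1 analyticAt_snd k
  refine AnalyticAt.sub (analyticAt_pi_iff.2 fun j => ?_) analyticAt_snd
  refine analyticAt_dotProduct (fun l => ?_) snd
  exact analyticAt_opMatrix (a := fun i (z : EuclideanSpace ℂ (Fin n) × (Fin n → ℂ)) => a i z.1)
    (fun i j l => (h.analyticAt i j l t₀ ht₀).comp_of_eq analyticAt_fst rfl) snd j l

theorem fderiv_idempotentDefect_inr (h : IsAlgebraFamily U a e) (ht₀ : t₀ ∈ U)
    (v₀ w : Fin n → ℂ) :
    fderiv ℂ (idempotentDefect a) (t₀, v₀) (0, w) =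
      (2 • opMatrix (fun i => a i t₀) v₀ - 1) *ᵥ w := by
  set b := fun i => a i t₀
  have expand : ∀ c : ℂ, idempotentDefect a ((t₀, v₀) + c • (0, w)) = idempotentDefect a (t₀, v₀) +
      (c • ((2 • opMatrix b v₀ - 1) *ᵥ w) + (c * c) • (opMatrix b w *ᵥ w)) := by
    intro c
    have hadd : (t₀, v₀) + c • ((0 : EuclideanSpace ℂ (Fin n)), w) = (t₀, v₀ + c • w) := by simp
    rw [hadd]
    simp only [idempotentDefect]
    change opMatrix b _ *ᵥ _ - _ = opMatrix b v₀ *ᵥ v₀ - v₀ + _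
    rw [map_add, map_smul, add_mulVec, mulVec_add, mulVec_add, mulVec_smul, smul_mulVec,
      smul_mulVec, mulVec_smul, (h.table t₀ ht₀).mulVec_comm w v₀, sub_mulVec, smul_mulVec,
      one_mulVec, two_smul]
    module
  have hline : HasLineDerivAt ℂ (idempotentDefect a) ((2 • opMatrix b v₀ - 1) *ᵥ w) (t₀, v₀)
      (0, w) := by
    rw [HasLineDerivAt]
    simp only [expand]
    have hid := hasDerivAt_id (0 : ℂ)
    have hpoly := (hid.smul_const ((2 • opMatrix b v₀ - 1) *ᵥ w)).add
      ((hid.mul hid).smul_const (opMatrix b w *ᵥ w))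
    simp only [id, zero_mul, mul_zero, add_zero, one_smul, zero_smul] at hpoly
    exact hpoly.const_add _
  exact ((h.analyticAt_idempotentDefect ht₀ v₀).differentiableAt.hasFDerivAt.hasLineDerivAt
    (0, w)).unique hline

theorem isInvertible_fderiv_idempotentDefect (h : IsAlgebraFamily U a e) (ht₀ : t₀ ∈ U)
    (hv₀ : opMatrix (fun i => a i t₀) v₀ *ᵥ v₀ = v₀) :
    (fderiv ℂ (idempotentDefect a) (t₀, v₀) ∘L .inr ℂ _ _).IsInvertible := by
  set A := opMatrix (fun i => a i t₀) v₀
  have involution : (2 • A - 1) * (2 • A - 1) = 1 := by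
    have : (2 • A - 1) * (2 • A - 1) = 4 • (A * A) - 4 • A + 1 := by noncomm_ring
    rw [this, (h.table t₀ ht₀).isIdempotentElem_opMatrix hv₀, sub_self, zero_add]
  have self_inverse : ∀ w, (fderiv ℂ (idempotentDefect a) (t₀, v₀) ∘L .inr ℂ _ _)
      ((fderiv ℂ (idempotentDefect a) (t₀, v₀) ∘L .inr ℂ _ _) w) = w := fun w => by
    simp only [ContinuousLinearMap.comp_apply, ContinuousLinearMap.inr_apply,
      h.fderiv_idempotentDefect_inr ht₀]
    rw [mulVec_mulVec, involution, one_mulVec]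
  exact ⟨ContinuousLinearEquiv.equivOfInverse _ _ self_inverse self_inverse, rfl⟩

theorem exists_idempotent_extension (h : IsAlgebraFamily U a e) (ht₀ : t₀ ∈ U)
    (hv₀ : opMatrix (fun i => a i t₀) v₀ *ᵥ v₀ = v₀) :
    ∃ v : EuclideanSpace ℂ (Fin n) → Fin n → ℂ, AnalyticAt ℂ v t₀ ∧ v t₀ = v₀ ∧
      ∀ᶠ t in 𝓝 t₀, opMatrix (fun i => a i t) (v t) *ᵥ v t = v t := by
  have hsmooth : ContDiffAt ℂ ω (idempotentDefect a) (t₀, v₀) :=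
    (h.analyticAt_idempotentDefect ht₀ v₀).contDiffAt
  have hω : (ω : WithTop ℕ∞) ≠ 0 := by simp
  have hinv := h.isInvertible_fderiv_idempotentDefect ht₀ hv₀
  refine ⟨hsmooth.implicitFunction hω hinv,
    (hsmooth.contDiffAt_implicitFunction hω hinv).analyticAt,
    hsmooth.implicitFunction_apply_self hω hinv, ?_⟩
  have hzero : idempotentDefect a (t₀, v₀) = 0 := sub_eq_zero.2 hv₀
  filter_upwards [hsmooth.eventually_apply_implicitFunction hω hinv] with t ht
  exact sub_eq_zero.1 (ht.trans hzero)

theorem eventually_trace_eq (h : IsAlgebraFamily U a e) (ht₀ : t₀ ∈ U)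
    {v : EuclideanSpace ℂ (Fin n) → Fin n → ℂ} (hv : AnalyticAt ℂ v t₀)
    (hid : ∀ᶠ t in 𝓝 t₀, opMatrix (fun i => a i t) (v t) *ᵥ v t = v t) {m : ℕ}
    (hm : (opMatrix (fun i => a i t₀) (v t₀)).trace = m) :
    ∀ᶠ t in 𝓝 t₀, (opMatrix (fun i => a i t) (v t)).trace = m := by
  have trace_continuousAt : ContinuousAt (fun t => (opMatrix (fun i => a i t) (v t)).trace) t₀ :=
    (analyticAt_trace (analyticAt_opMatrix (fun i j l => h.analyticAt i j l t₀ ht₀)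
      (analyticAt_pi_iff.1 hv))).continuousAt
  have close : ∀ᶠ t in 𝓝 t₀, dist (opMatrix (fun i => a i t) (v t)).trace m < 1 :=
    hm ▸ Metric.tendsto_nhds.1 trace_continuousAt 1 one_pos
  filter_upwards [hid, close, h.isOpen.mem_nhds ht₀] with t ht hlt htU
  obtain ⟨m', hm', -⟩ := (h.table t htU).exists_trace_opMatrix_eq_natCast ht
  have hdist : dist (m' : ℤ) m < 1 := by
    rw [hm'] at hlt
    rw [← Complex.isometry_intCast.dist_eq]
    exact_mod_cast hlt
  have heq : (m' : ℤ) = m := Int.pairwise_one_le_dist.eq (not_le.2 hdist)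
  rw [hm', Int.ofNat_inj.1 heq]

end IsAlgebraFamily

end AlgebraFamily

section PrimitiveIdempotents

variable {n : ℕ} {U : Set (EuclideanSpace ℂ (Fin n))}
  {a : Fin n → EuclideanSpace ℂ (Fin n) → Matrix (Fin n) (Fin n) ℂ}
  {e : EuclideanSpace ℂ (Fin n) → Fin n → ℂ}

/-- There is a nonzero idempotent `v` of trace `m` in one of the algebras of the family such that
all characters with the value `1` on `v` lie in `V`. -/
def HasIdempotentOfTrace (U : Set (EuclideanSpace ℂ (Fin n)))
    (a : Fin n → EuclideanSpace ℂ (Fin n) → Matrix (Fin n) (Fin n) ℂ)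
    (e : EuclideanSpace ℂ (Fin n) → Fin n → ℂ) (V : Set (CotCoord n)) (m : ℕ) : Prop :=
  ∃ t ∈ U, ∃ v : Fin n → ℂ, v ≠ 0 ∧ opMatrix (fun i => a i t) v *ᵥ v = v ∧
    (opMatrix (fun i => a i t) v).trace = m ∧
    ∀ y, IsChar (fun i => a i t) (e t) y → y ⬝ᵥ v = 1 → (t, WithLp.toLp 2 y) ∈ V

/-- The family of vectors `v` consists, near `t₁`, of idempotents of the constant trace `m ≠ 0`,
each of which separates one character in `V` from all the other ones. -/
structure IsSeparatingFamily (a : Fin n → EuclideanSpace ℂ (Fin n) → Matrix (Fin n) (Fin n) ℂ)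
    (e : EuclideanSpace ℂ (Fin n) → Fin n → ℂ) (V : Set (CotCoord n))
    (v : EuclideanSpace ℂ (Fin n) → Fin n → ℂ) (m : ℕ) (t₁ : EuclideanSpace ℂ (Fin n)) :
    Prop where
  analyticAt : AnalyticAt ℂ v t₁
  idempotent : ∀ᶠ t in 𝓝 t₁, opMatrix (fun i => a i t) (v t) *ᵥ v t = v t
  trace_ne_zero : m ≠ 0
  trace_eq : ∀ᶠ t in 𝓝 t₁, (opMatrix (fun i => a i t) (v t)).trace = m
  exists_unique : ∀ᶠ t in 𝓝 t₁, ∃ y, (t, WithLp.toLp 2 y) ∈ V ∧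
    IsChar (fun i => a i t) (e t) y ∧ y ⬝ᵥ v t = 1 ∧
    ∀ z, IsChar (fun i => a i t) (e t) z → z ⬝ᵥ v t = 1 → z = y

namespace IsAlgebraFamily

theorem exists_hasIdempotentOfTrace (h : IsAlgebraFamily U a e) {q : CotCoord n}
    (hq : q ∈ charSet U a e) {V : Set (CotCoord n)} (hqV : q ∈ V) :
    ∃ m, HasIdempotentOfTrace U a e V m := by
  have htable := h.table _ hq.1
  obtain ⟨v, hv, hqv, hother⟩ := htable.exists_primitive_idempotent hq.2
  obtain ⟨m, hm, -⟩ := htable.exists_trace_opMatrix_eq_natCast hv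
  refine ⟨m, q.1, hq.1, v, ?_, hv, hm, fun y hy hyv => ?_⟩
  · rintro rfl
    simp at hqv
  · rcases eq_or_ne y q.2.ofLp with rfl | hne
    · exact hqV
    · exact absurd ((hother y hy hne).symm.trans hyv) zero_ne_one

-- Among the idempotents all of whose characters lie in `V`, choose one of minimal trace.
theorem exists_isSeparatingFamily (h : IsAlgebraFamily U a e) {q : CotCoord n}
    (hq : q ∈ charSet U a e) {V : Set (CotCoord n)} (hV : IsOpen V) (hqV : q ∈ V) :
    ∃ t₁ ∈ U, ∃ v m, IsSeparatingFamily a e V v m t₁ := by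
  classical
  have hex := h.exists_hasIdempotentOfTrace hq hqV
  obtain ⟨t₁, ht₁, v₁, hv₁, hidem₁, htrace₁, hV₁⟩ := Nat.find_spec hex
  set m := Nat.find hex
  obtain ⟨v, hv, rfl, hidem⟩ := h.exists_idempotent_extension ht₁ hidem₁
  have htrace := h.eventually_trace_eq ht₁ hv hidem htrace₁
  have hne : ∀ᶠ t in 𝓝 t₁, v t ≠ 0 := hv.continuousAt.eventually_ne hv₁
  have htrace_ne : m ≠ 0 := by
    obtain ⟨m', hm', hzero⟩ := (h.table _ ht₁).exists_trace_opMatrix_eq_natCast hidem₁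
    have hmm' : m = m' := Nat.cast_injective (htrace₁.symm.trans hm')
    exact fun hm => hv₁ (hzero (hmm' ▸ hm))
  have mem_V := h.eventually_forall_isChar ht₁ hv.continuousAt
    (p := fun t y => (t, WithLp.toLp 2 y) ∈ V) fun y hy hyv =>
      (show Continuous fun z : EuclideanSpace ℂ (Fin n) × (Fin n → ℂ) =>
        ((z.1, WithLp.toLp 2 z.2) : CotCoord n) by fun_prop).continuousAt.eventually_mem
          (hV.mem_nhds (hV₁ y hy hyv))
  refine ⟨t₁, ht₁, v, m, hv, hidem, htrace_ne, htrace, ?_⟩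
  filter_upwards [hidem, mem_V, htrace, hne, h.isOpen.mem_nhds ht₁] with t ht hVt hm hvt htU
  have htable := h.table t htU
  obtain ⟨y, hy, hyv⟩ := htable.exists_isChar_dotProduct_eq_one ht hvt
  refine ⟨y, hVt y hy hyv, hy, hyv, fun z hz hzv => ?_⟩
  exact htable.isChar_eq_of_minimal_trace ht hm (fun w hw hw₀ hwv m' hm' =>
    Nat.find_min' hex ⟨t, htU, w, hw₀, hw, hm', fun x hx hxw => hVt x hx (hwv x hx hxw)⟩)
    hy hyv hz hzv

end IsAlgebraFamily

end PrimitiveIdempotents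

section TraceForm

variable {n : ℕ}

/-- The matrix of the partial derivatives `∂/∂tₖ` of the entries of a matrix. -/
noncomputable def matrixDeriv (k : Fin n)
    (A : EuclideanSpace ℂ (Fin n) → Matrix (Fin n) (Fin n) ℂ) (t : EuclideanSpace ℂ (Fin n)) :
    Matrix (Fin n) (Fin n) ℂ :=
  Matrix.of fun i j => fderiv ℂ (fun s => A s i j) t (EuclideanSpace.single k 1)

/-- There are connection matrices `Γₖ` at `t` such that the covariant derivatives
`∂ₖ aₗ + [Γₖ, aₗ]` are symmetric in `k` and `l`. -/
def IsPotentialAt (a : Fin n → EuclideanSpace ℂ (Fin n) → Matrix (Fin n) (Fin n) ℂ)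
    (t : EuclideanSpace ℂ (Fin n)) : Prop :=
  ∃ Γ : Fin n → Matrix (Fin n) (Fin n) ℂ, ∀ k l,
    matrixDeriv k (a l) t + Γ k * a l t - a l t * Γ k =
      matrixDeriv l (a k) t + Γ l * a k t - a k t * Γ l

/-- The coefficients of the `1`-form `∑ₗ tr(v · ∂ₗ) dtₗ`. -/
noncomputable def traceForm (a : Fin n → EuclideanSpace ℂ (Fin n) → Matrix (Fin n) (Fin n) ℂ)
    (v : EuclideanSpace ℂ (Fin n) → Fin n → ℂ) (t : EuclideanSpace ℂ (Fin n)) :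
    EuclideanSpace ℂ (Fin n) :=
  WithLp.toLp 2 fun l => (opMatrix (fun i => a i t) (v t) * a l t).trace

/-- The `1`-form `∑ₗ Yₗ dtₗ` is closed at `t`. -/
def IsClosedAt (Y : EuclideanSpace ℂ (Fin n) → EuclideanSpace ℂ (Fin n))
    (t : EuclideanSpace ℂ (Fin n)) : Prop :=
  ∀ k l, fderiv ℂ Y t (EuclideanSpace.single k 1) l = fderiv ℂ Y t (EuclideanSpace.single l 1) k

variable {t : EuclideanSpace ℂ (Fin n)} {A B : EuclideanSpace ℂ (Fin n) → Matrix (Fin n) (Fin n) ℂ}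

theorem matrixDeriv_congr (hAB : A =ᶠ[𝓝 t] B) (k : Fin n) :
    matrixDeriv k A t = matrixDeriv k B t := by
  ext i j
  have entry : (fun s => A s i j) =ᶠ[𝓝 t] fun s => B s i j :=
    hAB.fun_comp fun C : Matrix (Fin n) (Fin n) ℂ => C i j
  simp only [matrixDeriv, of_apply, entry.fderiv_eq]

theorem matrixDeriv_mul (hA : ∀ i j, DifferentiableAt ℂ (fun s => A s i j) t)
    (hB : ∀ i j, DifferentiableAt ℂ (fun s => B s i j) t) (k : Fin n) :
    matrixDeriv k (fun s => A s * B s) t =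
      matrixDeriv k A t * B t + A t * matrixDeriv k B t := by
  ext i j
  simp only [matrixDeriv, of_apply, Matrix.add_apply, mul_apply]
  rw [fderiv_fun_sum fun l _ => (hA i l).fun_mul (hB l j), _root_.sum_apply,
    ← Finset.sum_add_distrib]
  refine Finset.sum_congr rfl fun l _ => ?_
  rw [fderiv_fun_mul (hA i l) (hB l j)]
  simp only [_root_.add_apply, _root_.smul_apply, smul_eq_mul]
  ring

theorem fderiv_trace (hA : ∀ i j, DifferentiableAt ℂ (fun s => A s i j) t) (k : Fin n) :
    fderiv ℂ (fun s => (A s).trace) t (EuclideanSpace.single k 1) = (matrixDeriv k A t).trace := by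
  simp only [trace, diag, matrixDeriv, of_apply]
  rw [fderiv_fun_sum fun l _ => hA l l, _root_.sum_apply]

theorem fderiv_euclidean_apply {E : Type*} [NormedAddCommGroup E] [NormedSpace ℂ E]
    {Y : E → EuclideanSpace ℂ (Fin n)} {x : E} (hY : DifferentiableAt ℂ Y x) (w : E) (l : Fin n) :
    fderiv ℂ Y x w l = fderiv ℂ (fun s => Y s l) x w :=
  (DFunLike.congr_fun ((EuclideanSpace.proj l : EuclideanSpace ℂ (Fin n) →L[ℂ] ℂ).hasFDerivAt.comp x
    hY.hasFDerivAt).fderiv w).symm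

-- The derivative of an idempotent is off-diagonal with respect to its eigenspaces.
theorem trace_mul_eq_zero_of_idempotent {ι R : Type*} [Fintype ι] [CommRing R]
    {A A' B : Matrix ι ι R} (hA : A * A = A) (hA' : A' * A + A * A' = A') (hAB : Commute A B) :
    (A' * B).trace = 0 := by
  have diagonal : A * A' * A = 0 := by
    have : A * (A' * A + A * A') = A * A' := by rw [hA']
    rw [mul_add, ← mul_assoc, ← mul_assoc, hA] at this
    simpa using this
  have left : (A' * A * B).trace = 0 := by
    rw [← hA, mul_assoc, mul_assoc, hAB, ← mul_assoc, ← mul_assoc, trace_mul_comm, ← mul_assoc,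
      ← mul_assoc, diagonal, zero_mul, trace_zero]
  have right : (A * A' * B).trace = 0 := by
    rw [← hA, mul_assoc, mul_assoc, trace_mul_comm, ← mul_assoc, mul_assoc _ B A, ← hAB,
      ← mul_assoc, diagonal, zero_mul, trace_zero]
  rw [← hA', add_mul, trace_add, left, right, add_zero]

namespace IsAlgebraFamily

variable {U : Set (EuclideanSpace ℂ (Fin n))}
  {a : Fin n → EuclideanSpace ℂ (Fin n) → Matrix (Fin n) (Fin n) ℂ}
  {e : EuclideanSpace ℂ (Fin n) → Fin n → ℂ} {v : EuclideanSpace ℂ (Fin n) → Fin n → ℂ}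

theorem analyticAt_opMatrix_mul (h : IsAlgebraFamily U a e) (ht : t ∈ U) (hv : AnalyticAt ℂ v t)
    (l i j : Fin n) :
    AnalyticAt ℂ (fun s => (opMatrix (fun i => a i s) (v s) * a l s) i j) t :=
  analyticAt_matrix_mul (analyticAt_opMatrix (fun i j l => h.analyticAt i j l t ht)
    (analyticAt_pi_iff.1 hv)) (fun i j => h.analyticAt l i j t ht) i j

theorem differentiableAt_traceForm (h : IsAlgebraFamily U a e) (ht : t ∈ U)
    (hv : AnalyticAt ℂ v t) : DifferentiableAt ℂ (traceForm a v) t :=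
  differentiableAt_euclidean.2 fun l =>
    (analyticAt_trace (h.analyticAt_opMatrix_mul ht hv l)).differentiableAt

theorem fderiv_traceForm (h : IsAlgebraFamily U a e) (ht : t ∈ U) (hv : AnalyticAt ℂ v t)
    (hidem : ∀ᶠ s in 𝓝 t, opMatrix (fun i => a i s) (v s) *ᵥ v s = v s) (k l : Fin n) :
    fderiv ℂ (traceForm a v) t (EuclideanSpace.single k 1) l =
      (opMatrix (fun i => a i t) (v t) * matrixDeriv k (a l) t).trace := by
  set A := fun s => opMatrix (fun i => a i s) (v s)
  have hA : ∀ i j, DifferentiableAt ℂ (fun s => A s i j) t := fun i j =>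
    (analyticAt_opMatrix (fun i j l => h.analyticAt i j l t ht)
      (analyticAt_pi_iff.1 hv) i j).differentiableAt
  have ha : ∀ i j, DifferentiableAt ℂ (fun s => a l s i j) t := fun i j =>
    (h.analyticAt l i j t ht).differentiableAt
  have idempotent : (fun s => A s * A s) =ᶠ[𝓝 t] A := by
    filter_upwards [hidem, h.isOpen.mem_nhds ht] with s hs hsU
    exact (h.table s hsU).isIdempotentElem_opMatrix hs
  have deriv_idempotent : matrixDeriv k A t * A t + A t * matrixDeriv k A t = matrixDeriv k A t :=
    (matrixDeriv_mul hA hA k).symm.trans (matrixDeriv_congr idempotent k)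
  have commute : Commute (A t) (a l t) := by
    simpa only [opMatrix_single] using (h.table t ht).opMatrix_commute (v t) (Pi.single l 1)
  rw [fderiv_euclidean_apply (h.differentiableAt_traceForm ht hv)]
  refine (fderiv_trace (fun i j => (h.analyticAt_opMatrix_mul ht hv l i j).differentiableAt)
    k).trans ?_
  rw [matrixDeriv_mul hA ha, trace_add,
    trace_mul_eq_zero_of_idempotent idempotent.self_of_nhds deriv_idempotent commute, zero_add]

-- Commutators with `aₗ` are trace-orthogonal to the operators of the algebra.
theorem isClosedAt_traceForm (h : IsAlgebraFamily U a e) (hpot : ∀ t ∈ U, IsPotentialAt a t)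
    (ht : t ∈ U) (hv : AnalyticAt ℂ v t)
    (hidem : ∀ᶠ s in 𝓝 t, opMatrix (fun i => a i s) (v s) *ᵥ v s = v s) :
    IsClosedAt (traceForm a v) t := by
  set A := opMatrix (fun i => a i t) (v t)
  obtain ⟨Γ, hΓ⟩ := hpot t ht
  have covariant : ∀ k l, (A * matrixDeriv k (a l) t).trace =
      (A * (matrixDeriv k (a l) t + Γ k * a l t - a l t * Γ k)).trace := by
    intro k l
    have commute : Commute A (a l t) := by
      simpa only [opMatrix_single] using (h.table t ht).opMatrix_commute (v t) (Pi.single l 1)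
    have orthogonal : (A * (Γ k * a l t)).trace = (A * (a l t * Γ k)).trace := by
      rw [← mul_assoc, trace_mul_comm, ← mul_assoc, ← mul_assoc, commute]
    rw [mul_sub, mul_add, trace_sub, trace_add, orthogonal, add_sub_cancel_right]
  intro k l
  rw [h.fderiv_traceForm ht hv hidem, h.fderiv_traceForm ht hv hidem, covariant, covariant, hΓ]

end IsAlgebraFamily

end TraceForm

section PoissonVanishing

variable {n : ℕ} {f g : CotCoord n → ℂ} {t₁ : EuclideanSpace ℂ (Fin n)}

theorem fderiv_single_prodMk_apply {q : CotCoord n} (i : Fin n) (w : EuclideanSpace ℂ (Fin n)) :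
    fderiv ℂ f q (EuclideanSpace.single i 1, w) = dt i f q + ∑ l, w l * dy l f q := by
  have hw : ((EuclideanSpace.single i 1, w) : CotCoord n) = (EuclideanSpace.single i 1, 0) +
      ∑ l, w l • ((0, EuclideanSpace.single l 1) : CotCoord n) := by
    ext j
    · simp [Prod.fst_sum]
    · simp [Prod.snd_sum, Pi.single_apply]
  rw [hw, map_add, map_sum]
  simp only [map_smul, smul_eq_mul, dt, dy]

variable {Y : EuclideanSpace ℂ (Fin n) → EuclideanSpace ℂ (Fin n)}

theorem dt_eq_of_eventually_graph_eq_zero (hf : DifferentiableAt ℂ f (t₁, Y t₁))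
    (hY : DifferentiableAt ℂ Y t₁) (hf₀ : ∀ᶠ t in 𝓝 t₁, f (t, Y t) = 0) (k : Fin n) :
    dt k f (t₁, Y t₁) =
      -∑ l, fderiv ℂ Y t₁ (EuclideanSpace.single k 1) l * dy l f (t₁, Y t₁) := by
  have chain : HasFDerivAt (fun t => f (t, Y t)) _ t₁ :=
    HasFDerivAt.comp (f := fun t => (t, Y t)) t₁ hf.hasFDerivAt
      ((hasFDerivAt_id t₁).prodMk hY.hasFDerivAt)
  have zero : HasFDerivAt (fun t => f (t, Y t)) (0 : EuclideanSpace ℂ (Fin n) →L[ℂ] ℂ) t₁ :=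
    (hasFDerivAt_const (0 : ℂ) t₁).congr_of_eventuallyEq hf₀
  have hk := DFunLike.congr_fun (chain.unique zero) (EuclideanSpace.single k (1 : ℂ))
  simp only [ContinuousLinearMap.comp_apply, ContinuousLinearMap.prod_apply,
    ContinuousLinearMap.id_apply, _root_.zero_apply, fderiv_single_prodMk_apply] at hk
  exact eq_neg_of_add_eq_zero_left hk

theorem poissonFun_eq_zero_of_graph (hf : DifferentiableAt ℂ f (t₁, Y t₁))
    (hg : DifferentiableAt ℂ g (t₁, Y t₁)) (hY : DifferentiableAt ℂ Y t₁)
    (hclosed : IsClosedAt Y t₁) (hf₀ : ∀ᶠ t in 𝓝 t₁, f (t, Y t) = 0)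
    (hg₀ : ∀ᶠ t in 𝓝 t₁, g (t, Y t) = 0) : poissonFun f g (t₁, Y t₁) = 0 := by
  simp only [poissonFun, dt_eq_of_eventually_graph_eq_zero hf hY hf₀,
    dt_eq_of_eventually_graph_eq_zero hg hY hg₀, neg_mul, mul_neg, sub_neg_eq_add,
    Finset.sum_add_distrib, Finset.sum_mul, Finset.mul_sum, Finset.sum_neg_distrib]
  rw [neg_add_eq_zero, Finset.sum_comm]
  refine Finset.sum_congr rfl fun k _ => Finset.sum_congr rfl fun l _ => ?_
  rw [hclosed]
  ring

namespace IsAlgebraFamily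

variable {U : Set (EuclideanSpace ℂ (Fin n))}
  {a : Fin n → EuclideanSpace ℂ (Fin n) → Matrix (Fin n) (Fin n) ℂ}
  {e : EuclideanSpace ℂ (Fin n) → Fin n → ℂ} {V : Set (CotCoord n)}

theorem eventually_inv_smul_traceForm (h : IsAlgebraFamily U a e) (ht₁ : t₁ ∈ U)
    {v : EuclideanSpace ℂ (Fin n) → Fin n → ℂ} {m : ℕ} (hv : IsSeparatingFamily a e V v m t₁) :
    ∀ᶠ t in 𝓝 t₁, (t, (m : ℂ)⁻¹ • traceForm a v t) ∈ V ∩ charSet U a e ∧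
      ((m : ℂ)⁻¹ • traceForm a v t).ofLp ⬝ᵥ v t = 1 ∧
      ∀ z, IsChar (fun i => a i t) (e t) z → z ⬝ᵥ v t = 1 →
        z = ((m : ℂ)⁻¹ • traceForm a v t).ofLp := by
  filter_upwards [hv.idempotent, hv.trace_eq, hv.exists_unique, h.isOpen.mem_nhds ht₁]
    with t hidem htrace ⟨y, hyV, hy, hyv, huniq⟩ htU
  have heq : (m : ℂ)⁻¹ • traceForm a v t = WithLp.toLp 2 y := by
    ext l
    change (m : ℂ)⁻¹ * (opMatrix (fun i => a i t) (v t) * a l t).trace = y l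
    rw [(h.table t htU).trace_opMatrix_mul hidem huniq, htrace,
      inv_mul_cancel_left₀ (Nat.cast_ne_zero.2 hv.trace_ne_zero)]
  rw [heq]
  exact ⟨⟨hyV, htU, hy⟩, hyv, huniq⟩

theorem exists_graph (h : IsAlgebraFamily U a e) {q : CotCoord n} (hq : q ∈ charSet U a e)
    (hV : IsOpen V) (hqV : q ∈ V) :
    ∃ (t₁ : EuclideanSpace ℂ (Fin n)) (Y : EuclideanSpace ℂ (Fin n) → EuclideanSpace ℂ (Fin n)),
      DifferentiableAt ℂ Y t₁ ∧ (∀ᶠ t in 𝓝 t₁, (t, Y t) ∈ V ∩ charSet U a e) ∧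
      (∀ᶠ x in 𝓝 (t₁, Y t₁), x ∈ charSet U a e → x.2 = Y x.1) ∧
      ((∀ t ∈ U, IsPotentialAt a t) → IsClosedAt Y t₁) := by
  obtain ⟨t₁, ht₁, v, m, hv⟩ := h.exists_isSeparatingFamily hq hV hqV
  have hY := h.eventually_inv_smul_traceForm ht₁ hv
  have hdiff := h.differentiableAt_traceForm ht₁ hv.analyticAt
  refine ⟨t₁, fun t => (m : ℂ)⁻¹ • traceForm a v t, hdiff.fun_const_smul _,
    hY.mono fun t ht => ht.1, ?_, fun hpot k l => ?_⟩
  · set Y := fun t => (m : ℂ)⁻¹ • traceForm a v t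
    have pairing : ContinuousAt (fun x : CotCoord n => x.2.ofLp ⬝ᵥ v x.1) (t₁, Y t₁) :=
      tendsto_finsetSum _ fun k _ => ContinuousAt.mul (by fun_prop)
        (((continuous_apply k).continuousAt.comp hv.analyticAt.continuousAt).comp_of_eq
          continuousAt_fst rfl)
    have pairing_ne : ∀ᶠ x in 𝓝 (t₁, Y t₁), x.2.ofLp ⬝ᵥ v x.1 ≠ 0 :=
      pairing.eventually_ne (hY.self_of_nhds.2.1.trans_ne one_ne_zero)
    filter_upwards [pairing_ne, continuousAt_fst.eventually hv.idempotent,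
      continuousAt_fst.eventually hY] with x hne hidem hx hxchar
    exact WithLp.ofLp_injective 2
      (hx.2.2 _ hxchar.2 ((hxchar.2.dotProduct_eq_zero_or_one hidem).resolve_left hne))
  · rw [fderiv_fun_const_smul hdiff]
    exact congrArg ((m : ℂ)⁻¹ * ·)
      (h.isClosedAt_traceForm hpot ht₁ hv.analyticAt hv.idempotent k l)

-- The points at which the spectrum is the graph of a holomorphic map are dense in it.
theorem poissonFun_eq_zero (h : IsAlgebraFamily U a e) (hpot : ∀ t ∈ U, IsPotentialAt a t)
    {q : CotCoord n} (hq : q ∈ charSet U a e) (hf : AnalyticAt ℂ f q) (hg : AnalyticAt ℂ g q)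
    (hf₀ : ∀ᶠ x in 𝓝 q, x ∈ charSet U a e → f x = 0)
    (hg₀ : ∀ᶠ x in 𝓝 q, x ∈ charSet U a e → g x = 0) : poissonFun f g q = 0 := by
  by_contra hne
  have nearby : ∀ᶠ x in 𝓝 q, (DifferentiableAt ℂ f x ∧ DifferentiableAt ℂ g x) ∧
      poissonFun f g x ≠ 0 ∧ (x ∈ charSet U a e → f x = 0) ∧ (x ∈ charSet U a e → g x = 0) :=
    (hf.eventually_analyticAt.mono fun _ hx => hx.differentiableAt).and
      (hg.eventually_analyticAt.mono fun _ hx => hx.differentiableAt) |>.and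
      (((analyticAt_poissonFun hf hg).continuousAt.eventually_ne hne).and (hf₀.and hg₀))
  obtain ⟨V, hVsub, hV, hqV⟩ := eventually_nhds_iff.1 nearby
  obtain ⟨t₁, Y, hYdiff, hY, -, hclosed⟩ := h.exists_graph hq hV hqV
  obtain ⟨⟨hfdiff, hgdiff⟩, hne₁, -⟩ := hVsub _ hY.self_of_nhds.1
  refine hne₁ (poissonFun_eq_zero_of_graph hfdiff hgdiff hYdiff (hclosed hpot) ?_ ?_)
  · exact hY.mono fun t ht => (hVsub _ ht.1).2.2.1 ht.2
  · exact hY.mono fun t ht => (hVsub _ ht.1).2.2.2 ht.2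

end IsAlgebraFamily

end PoissonVanishing

section ParametricIntegral

section Superposition

variable {𝕜 : Type*} [NontriviallyNormedField 𝕜]
  {V : Type*} [NormedAddCommGroup V] [NormedSpace 𝕜 V]
  {E : Type*} [NormedAddCommGroup E] [NormedSpace 𝕜 E]
  {K : Type*} [TopologicalSpace K] [CompactSpace K]

/-- The embedding of `V` into the continuous `V`-valued functions as the constant functions. -/
noncomputable def constCLM (𝕜 K V : Type*) [NontriviallyNormedField 𝕜] [TopologicalSpace K]
    [CompactSpace K] [NormedAddCommGroup V] [NormedSpace 𝕜 V] : V →L[𝕜] C(K, V) where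
  toFun := ContinuousMap.const K
  map_add' _ _ := rfl
  map_smul' _ _ := rfl
  cont := ContinuousMap.continuous_const'

@[simp]
theorem constCLM_apply (v : V) (s : K) : constCLM 𝕜 K V v s = v := rfl

/-- The multilinear map `(β₁, …, βₘ) ↦ p(β₁(·), …, βₘ(·))` on continuous functions. -/
noncomputable def pointwiseMultilinear (K : Type*) [TopologicalSpace K] [CompactSpace K]
    {m : ℕ} (p : V [×m]→L[𝕜] E) : C(K, V) [×m]→L[𝕜] C(K, E) :=
  MultilinearMap.mkContinuous
    { toFun := fun β => ⟨fun s => p fun i => β i s, by fun_prop⟩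
      map_update_add' := fun β i x y => ContinuousMap.ext fun s =>
        (p.compContinuousLinearMap fun _ => ContinuousMap.evalCLM 𝕜 s).map_update_add β i x y
      map_update_smul' := fun β i c x => ContinuousMap.ext fun s =>
        (p.compContinuousLinearMap fun _ => ContinuousMap.evalCLM 𝕜 s).map_update_smul β i c x }
    ‖p‖ fun β => by
      refine (ContinuousMap.norm_le _ (by positivity)).2 fun s => (p.le_opNorm _).trans ?_
      gcongr with i
      exact (β i).norm_coe_le_norm s

theorem norm_pointwiseMultilinear_le {m : ℕ} (p : V [×m]→L[𝕜] E) :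
    ‖pointwiseMultilinear K p‖ ≤ ‖p‖ :=
  MultilinearMap.mkContinuous_norm_le _ (norm_nonneg _) _

theorem exists_analyticAt_superposition [CompleteSpace E] {f : V → E} {v₀ : V}
    (hf : AnalyticAt 𝕜 f v₀) :
    ∃ r > 0, ∀ (K : Type*) [TopologicalSpace K] [CompactSpace K],
      ∃ Φ : C(K, V) → C(K, E), ∀ β ∈ Metric.ball (ContinuousMap.const K v₀) r,
        AnalyticAt 𝕜 Φ β ∧ ∀ s, Φ β s = f (β s) := by
  obtain ⟨p, R, hp⟩ := hf
  obtain ⟨r, hr, hrR⟩ := ENNReal.lt_iff_exists_nnreal_btwn.1 hp.r_pos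
  refine ⟨r, by exact_mod_cast hr, fun K _ _ => ?_⟩
  let P : FormalMultilinearSeries 𝕜 C(K, V) C(K, E) := fun m => pointwiseMultilinear K (p m)
  have hP : (r : ENNReal) ≤ P.radius := by
    obtain ⟨C, -, hC⟩ := p.norm_mul_pow_le_of_lt_radius (hrR.trans_le hp.r_le)
    refine P.le_radius_of_bound C fun m => le_trans ?_ (hC m)
    gcongr
    exact norm_pointwiseMultilinear_le (p m)
  have hPsum := (P.hasFPowerSeriesOnBall (hr.trans_le hP)).mono hr hP
  have sub_mem_eball : ∀ β ∈ Metric.ball (ContinuousMap.const K v₀) r,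
      β - ContinuousMap.const K v₀ ∈ Metric.eball (0 : C(K, V)) r := fun β hβ => by
    rwa [Metric.eball_coe, mem_ball_zero_iff, ← dist_eq_norm]
  refine ⟨fun β => P.sum (β - ContinuousMap.const K v₀), fun β hβ =>
    ⟨(hPsum.analyticAt_of_mem (sub_mem_eball β hβ)).comp_of_eq
      (analyticAt_id.sub analyticAt_const) rfl, fun s => ?_⟩⟩
  have hs : β s - v₀ ∈ Metric.eball (0 : V) R := by
    refine Metric.eball_subset_eball hrR.le ?_
    rw [Metric.eball_coe, mem_ball_zero_iff]
    exact ((β - ContinuousMap.const K v₀).norm_coe_le_norm s).trans_lt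
      (mem_ball_iff_norm.1 hβ)
  have hsum_at : HasSum (fun m => p m fun _ => β s - v₀)
      (P.sum (β - ContinuousMap.const K v₀) s) := by
    have := (hPsum.hasSum (sub_mem_eball β hβ)).mapL (ContinuousMap.evalCLM 𝕜 s)
    rwa [zero_add] at this
  have hsum := hp.hasSum hs
  rw [add_sub_cancel] at hsum
  exact hsum_at.unique hsum

end Superposition

section IntervalIntegral

variable {𝕜 : Type*} [RCLike 𝕜] {W : Type*} [NormedAddCommGroup W] [NormedSpace 𝕜 W]
  {X : Type*} [NormedAddCommGroup X] [NormedSpace 𝕜 X]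
  {E : Type*} [NormedAddCommGroup E] [NormedSpace 𝕜 E] [NormedSpace ℝ E] [SMulCommClass ℝ 𝕜 E]
  {γ : ℝ → W} {g : W × X → E} {x₀ : X}

/-- Integration over `[a, b]` as a functional on the continuous functions on `[a, b]`. -/
noncomputable def integralIccCLM (𝕜 E : Type*) [RCLike 𝕜] [NormedAddCommGroup E]
    [NormedSpace 𝕜 E] [NormedSpace ℝ E] [SMulCommClass ℝ 𝕜 E] {a b : ℝ} (hab : a ≤ b) :
    C(Set.Icc a b, E) →L[𝕜] E :=
  LinearMap.mkContinuous
    { toFun := fun φ => ∫ θ in a..b, Set.IccExtend hab φ θ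
      map_add' := fun φ ψ => intervalIntegral.integral_add
        (φ.continuous.Icc_extend'.intervalIntegrable _ _)
        (ψ.continuous.Icc_extend'.intervalIntegrable _ _)
      map_smul' := fun c _ => intervalIntegral.integral_smul c _ }
    |b - a| fun _ => (intervalIntegral.norm_integral_le_of_norm_le_const fun _ _ =>
      ContinuousMap.norm_coe_le_norm _ _).trans_eq (mul_comm _ _)

theorem integralIccCLM_eq_intervalIntegral {a b : ℝ} (hab : a ≤ b) {φ : C(Set.Icc a b, E)}
    {f : ℝ → E} (hf : ∀ θ, φ θ = f θ) : integralIccCLM 𝕜 E hab φ = ∫ θ in a..b, f θ :=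
  intervalIntegral.integral_congr fun θ hθ => by
    rw [Set.uIcc_of_le hab] at hθ
    exact (Set.IccExtend_of_mem hab φ hθ).trans (hf ⟨θ, hθ⟩)

variable [CompleteSpace E]

theorem exists_mem_nhds_analyticAt_intervalIntegral (hγ : Continuous γ) {θ₀ : ℝ}
    (hg : AnalyticAt 𝕜 g (γ θ₀, x₀)) :
    ∃ T ∈ 𝓝 θ₀, ∀ a b, a ≤ b → Set.Icc a b ⊆ T →
      AnalyticAt 𝕜 (fun x => ∫ θ in a..b, g (γ θ, x)) x₀ := by
  obtain ⟨r, hr, hr'⟩ := exists_analyticAt_superposition hg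
  refine ⟨γ ⁻¹' Metric.ball (γ θ₀) r, hγ.continuousAt (Metric.ball_mem_nhds _ hr),
    fun a b hab hT => ?_⟩
  obtain ⟨Φ, hΦ⟩ := hr' (Set.Icc a b)
  let β : X → C(Set.Icc a b, W × X) := fun x =>
    ⟨fun θ => (γ θ, 0), by fun_prop⟩ + constCLM 𝕜 (Set.Icc a b) (W × X) (0, x)
  have hβ : ∀ x θ, β x θ = (γ θ, x) := fun x θ => by simp [β]
  have hβan : AnalyticAt 𝕜 β x₀ := analyticAt_const.add
    (((constCLM 𝕜 (Set.Icc a b) (W × X)).comp (.inr 𝕜 W X)).analyticAt x₀)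
  have hβball : β x₀ ∈ Metric.ball (ContinuousMap.const _ (γ θ₀, x₀)) r := by
    rw [Metric.mem_ball, ContinuousMap.dist_lt_iff hr]
    intro θ
    simpa [hβ, Prod.dist_eq] using hT θ.2
  have hΦβ : AnalyticAt 𝕜 (fun x => integralIccCLM 𝕜 E hab (Φ (β x))) x₀ :=
    ((integralIccCLM 𝕜 E hab).analyticAt _).comp ((hΦ _ hβball).1.comp hβan)
  refine hΦβ.congr ?_
  filter_upwards [hβan.continuousAt.eventually_mem (Metric.isOpen_ball.mem_nhds hβball)]
    with x hx
  exact integralIccCLM_eq_intervalIntegral hab fun θ => by rw [(hΦ _ hx).2, hβ]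

-- A fine subdivision reduces to short intervals, on which `γ` is close to a constant.
theorem analyticAt_intervalIntegral (hγ : Continuous γ) {a b : ℝ} (hab : a ≤ b)
    (hg : ∀ θ ∈ Set.Icc a b, AnalyticAt 𝕜 g (γ θ, x₀)) :
    AnalyticAt 𝕜 (fun x => ∫ θ in a..b, g (γ θ, x)) x₀ := by
  choose! T hT hint using fun θ hθ => exists_mem_nhds_analyticAt_intervalIntegral hγ (hg θ hθ)
  obtain ⟨τ, hτa, hτ, ⟨m, hm⟩, hτT⟩ := exists_monotone_Icc_subset_open_cover_Icc hab
    (c := fun θ : Set.Icc a b => Subtype.val ⁻¹' interior (T θ))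
    (fun θ => isOpen_interior.preimage continuous_subtype_val)
    (fun θ _ => Set.mem_iUnion.2 ⟨θ, mem_interior_iff_mem_nhds.2 (hT θ θ.2)⟩)
  have piece : ∀ k ∈ Finset.range m,
      AnalyticAt 𝕜 (fun x => ∫ θ in (τ k : ℝ)..τ (k + 1), g (γ θ, x)) x₀ := fun k _ => by
    obtain ⟨θ, hθ⟩ := hτT k
    refine hint θ θ.2 _ _ (hτ k.le_succ) fun s hs => ?_
    exact interior_subset (@hθ ⟨s, (τ k).2.1.trans hs.1, hs.2.trans (τ (k + 1)).2.2⟩ hs)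
  have eventually_continuous : ∀ᶠ x in 𝓝 x₀, ∀ θ ∈ Set.Icc a b,
      ContinuousAt g (γ θ, x) := by
    refine isCompact_Icc.eventually_forall_of_forall_eventually fun θ hθ => ?_
    have hpath : ContinuousAt (fun p : X × ℝ => (γ p.2, p.1)) (x₀, θ) := by fun_prop
    exact hpath.eventually ((hg θ hθ).eventually_analyticAt.mono fun _ h => h.continuousAt)
  refine (Finset.analyticAt_fun_sum _ piece).congr ?_
  filter_upwards [eventually_continuous] with x hx
  rw [intervalIntegral.sum_integral_adjacent_intervals (a := fun k => (τ k : ℝ)) fun k _ => ?_,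
    hτa, hm m le_rfl]
  refine ContinuousOn.intervalIntegrable_of_Icc (hτ k.le_succ) fun θ hθ => ?_
  refine ContinuousAt.continuousWithinAt ?_
  refine ContinuousAt.comp (f := fun θ => (γ θ, x))
    (hx θ ⟨(τ k).2.1.trans hθ.1, hθ.2.trans (τ (k + 1)).2.2⟩) ?_
  fun_prop

end IntervalIntegral

theorem analyticAt_circleIntegral {X : Type*} [NormedAddCommGroup X] [NormedSpace ℂ X]
    {E : Type*} [NormedAddCommGroup E] [NormedSpace ℂ E] [CompleteSpace E]
    {f : ℂ × X → E} {c : ℂ} {ρ : ℝ} (hρ : 0 ≤ ρ) {x₀ : X}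
    (hf : ∀ w ∈ Metric.sphere c ρ, AnalyticAt ℂ f (w, x₀)) :
    AnalyticAt ℂ (fun x => ∮ w in C(c, ρ), f (w, x)) x₀ := by
  have hderiv : ∀ θ, deriv (circleMap c ρ) θ = (circleMap c ρ θ - c) * Complex.I := fun θ => by
    rw [deriv_circleMap, circleMap_sub_center]
  simp only [circleIntegral, hderiv]
  refine analyticAt_intervalIntegral
    (g := fun p : ℂ × X => ((p.1 - c) * Complex.I) • f p) (continuous_circleMap c ρ)
    Real.two_pi_pos.le fun θ _ => ?_
  exact ((analyticAt_fst.sub analyticAt_const).mul analyticAt_const).smul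
    (hf _ (circleMap_mem_sphere c hρ θ))

end ParametricIntegral

section Division

section CauchyMatrix

variable {𝕜 : Type*} [NontriviallyNormedField 𝕜] {X : Type*} [NormedAddCommGroup X]
  [NormedSpace 𝕜 X] {ι : Type*} [Fintype ι] [DecidableEq ι] {x₀ : X}

theorem analyticAt_det {A : X → Matrix ι ι 𝕜} (hA : ∀ i j, AnalyticAt 𝕜 (fun x => A x i j) x₀) :
    AnalyticAt 𝕜 (fun x => (A x).det) x₀ := by
  simp only [det_apply']
  exact Finset.analyticAt_fun_sum _ fun σ _ =>
    analyticAt_const.mul (Finset.analyticAt_fun_prod _ fun i _ => hA _ _)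

theorem analyticAt_adjugate {A : X → Matrix ι ι 𝕜}
    (hA : ∀ i j, AnalyticAt 𝕜 (fun x => A x i j) x₀) (k l : ι) :
    AnalyticAt 𝕜 (fun x => (A x).adjugate k l) x₀ := by
  simp only [adjugate_apply]
  refine analyticAt_det fun i j => ?_
  rcases eq_or_ne i l with rfl | hi
  · simpa only [updateRow_self] using analyticAt_const
  · simpa only [updateRow_ne hi] using hA i j

theorem analyticAt_matrix_inv {A : X → Matrix ι ι 𝕜}
    (hA : ∀ i j, AnalyticAt 𝕜 (fun x => A x i j) x₀) (h0 : (A x₀).det ≠ 0) (k l : ι) :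
    AnalyticAt 𝕜 (fun x => (A x)⁻¹ k l) x₀ := by
  simp only [inv_def, Ring.inverse_eq_inv', Matrix.smul_apply]
  exact ((analyticAt_det hA).inv h0).smul (analyticAt_adjugate hA k l)

theorem smul_one_sub_mul_inv {A : Matrix ι ι 𝕜} {w : 𝕜} (hw : (w • 1 - A).det ≠ 0) (y : 𝕜) :
    (y • 1 - A) * (w • 1 - A)⁻¹ = 1 - (w - y) • (w • 1 - A)⁻¹ := by
  have hsplit : y • (1 : Matrix ι ι 𝕜) - A = (w • 1 - A) - (w - y) • 1 := by module
  rw [hsplit, sub_mul, mul_nonsing_inv _ hw.isUnit, smul_mul_assoc, one_mul]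

variable {A : Matrix ι ι ℂ} {g : ℂ → ℂ} {c : ℂ} {ρ : ℝ}

theorem exists_radius_det_ne_zero (A : Matrix ι ι ℂ) (c : ℂ) {r : ℝ} (hr : 0 < r) :
    ∃ ρ, 0 < ρ ∧ ρ < r ∧ ∀ w ∈ Metric.sphere c ρ, (w • 1 - A).det ≠ 0 := by
  obtain ⟨ρ, ⟨hρ, hρr⟩, hroots⟩ := (Set.Ioo_infinite hr).exists_notMem_finite
    ((Multiset.finite_toSet A.charpoly.roots).image (dist · c))
  refine ⟨ρ, hρ, hρr, fun w hw hdet => hroots ⟨w, ?_, hw⟩⟩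
  rw [Set.mem_ofPred_eq, Polynomial.mem_roots A.charpoly_monic.ne_zero, Polynomial.IsRoot,
    eval_charpoly, scalar_apply, ← smul_one_eq_diagonal, hdet]

/-- The matrix `(2πi)⁻¹ ∮ g(w) (w - A)⁻¹ dw`, that is, the holomorphic functional calculus for the
part of the spectrum of `A` inside the circle. -/
noncomputable def cauchyMatrix (c : ℂ) (ρ : ℝ) (g : ℂ → ℂ) (A : Matrix ι ι ℂ) : Matrix ι ι ℂ :=
  of fun k l => (2 * Real.pi * Complex.I)⁻¹ * ∮ w in C(c, ρ), g w * (w • 1 - A)⁻¹ k l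

theorem analyticAt_cauchyMatrix {X : Type*} [NormedAddCommGroup X] [NormedSpace ℂ X] {x₀ : X}
    {g : ℂ × X → ℂ} {A : X → Matrix ι ι ℂ} (hρ : 0 ≤ ρ)
    (hg : ∀ w ∈ Metric.sphere c ρ, AnalyticAt ℂ g (w, x₀))
    (hA : ∀ k l, AnalyticAt ℂ (fun x => A x k l) x₀)
    (hdet : ∀ w ∈ Metric.sphere c ρ, (w • 1 - A x₀).det ≠ 0) (k l : ι) :
    AnalyticAt ℂ (fun x => cauchyMatrix c ρ (fun w => g (w, x)) (A x) k l) x₀ := by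
  refine analyticAt_const.mul (analyticAt_circleIntegral
    (f := fun p : ℂ × X => g p * (p.1 • 1 - A p.2)⁻¹ k l) hρ fun w hw => (hg w hw).mul ?_)
  refine analyticAt_matrix_inv (A := fun p : ℂ × X => p.1 • 1 - A p.2) (fun i j => ?_)
    (hdet w hw) k l
  exact (analyticAt_fst.smul analyticAt_const).sub ((hA i j).comp_of_eq analyticAt_snd rfl)

-- Integrate `(y - A) (w - A)⁻¹ = 1 - (w - y) (w - A)⁻¹` against `g(w) / (w - y)`.
theorem smul_one_eq_cauchyMatrix_add_mul (hg : DiffContOnCl ℂ g (Metric.ball c ρ))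
    (hdet : ∀ w ∈ Metric.sphere c ρ, (w • 1 - A).det ≠ 0) {y : ℂ} (hy : y ∈ Metric.ball c ρ) :
    g y • (1 : Matrix ι ι ℂ) = cauchyMatrix c ρ g A +
      (y • 1 - A) * cauchyMatrix c ρ (fun w => (w - y)⁻¹ * g w) A := by
  ext k l
  have hρ : 0 ≤ ρ := (dist_nonneg.trans_lt hy).le
  have sub_ne_zero_of_mem : ∀ w ∈ Metric.sphere c ρ, w - y ≠ 0 := fun w hw =>
    sub_ne_zero.2 fun hwy => (hwy ▸ hy : dist w c < ρ).ne hw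
  have g_continuousOn : ContinuousOn g (Metric.sphere c ρ) :=
    hg.continuousOn_ball.mono Metric.sphere_subset_closedBall
  have inv_continuousOn : ∀ m, ContinuousOn (fun w : ℂ => (w • 1 - A)⁻¹ m l)
      (Metric.sphere c ρ) := fun m w hw =>
    (analyticAt_matrix_inv (A := fun w : ℂ => w • 1 - A)
      (fun i j => (analyticAt_id.smul analyticAt_const).sub analyticAt_const)
      (hdet w hw) m l).continuousAt.continuousWithinAt
  have int_remainder : CircleIntegrable (fun w => g w * (w • 1 - A)⁻¹ k l) c ρ :=
    (g_continuousOn.mul (inv_continuousOn k)).circleIntegrable hρ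
  have int_quotient : ∀ m, CircleIntegrable
      (fun w => (y • 1 - A) k m * ((w - y)⁻¹ * g w * (w • 1 - A)⁻¹ m l)) c ρ := fun m =>
    (continuousOn_const.mul (((ContinuousOn.inv₀ (by fun_prop) sub_ne_zero_of_mem).mul
      g_continuousOn).mul (inv_continuousOn m))).circleIntegrable hρ
  have integrand : ∀ w ∈ Metric.sphere c ρ,
      g w * (w • 1 - A)⁻¹ k l + ∑ m, (y • 1 - A) k m * ((w - y)⁻¹ * g w * (w • 1 - A)⁻¹ m l) =
        (1 : Matrix ι ι ℂ) k l * ((w - y)⁻¹ • g w) := fun w hw => by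
    have hres := congrFun₂ (smul_one_sub_mul_inv (hdet w hw) y) k l
    rw [mul_apply, Matrix.sub_apply, Matrix.smul_apply, smul_eq_mul] at hres
    simp only [mul_left_comm _ ((w - y)⁻¹ * g w), ← Finset.mul_sum, hres, smul_eq_mul]
    field_simp [sub_ne_zero_of_mem w hw]
    ring
  have integral := circleIntegral.integral_congr hρ integrand
  rw [circleIntegral.integral_add int_remainder (.fun_sum _ fun m _ => int_quotient m),
    circleIntegral.integral_fun_sum fun m _ => int_quotient m] at integral
  simp only [circleIntegral.integral_const_mul] at integral
  simp only [Matrix.add_apply, mul_apply, cauchyMatrix, of_apply, Matrix.smul_apply, smul_eq_mul,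
    mul_left_comm _ (2 * Real.pi * Complex.I : ℂ)⁻¹, ← Finset.mul_sum, ← mul_add, integral]
  rw [← hg.two_pi_i_inv_smul_circleIntegral_sub_inv_smul hy, smul_eq_mul]
  simp only [smul_eq_mul]
  ring

end CauchyMatrix

section SetY

variable {n : ℕ} {ι : Type*} [Fintype ι] [DecidableEq ι]

/-- The point with the same coordinates as `x`, except that `yᵢ = w`. -/
noncomputable def setY (i : Fin n) (w : ℂ) (x : CotCoord n) : CotCoord n :=
  x + (w - x.2 i) • (0, EuclideanSpace.single i 1)

theorem setY_snd (i : Fin n) (w : ℂ) (x : CotCoord n) (j : Fin n) :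
    (setY i w x).2 j = if j = i then w else x.2 j := by
  rcases eq_or_ne j i with rfl | hj
  · simp [setY]
  · simp [setY, hj]

theorem setY_fst (i : Fin n) (w : ℂ) (x : CotCoord n) : (setY i w x).1 = x.1 := by simp [setY]

theorem setY_self (i : Fin n) (x : CotCoord n) : setY i (x.2 i) x = x := by simp [setY]

theorem analyticAt_snd_apply (i : Fin n) (q : CotCoord n) :
    AnalyticAt ℂ (fun x : CotCoord n => x.2 i) q :=
  ((EuclideanSpace.proj i : EuclideanSpace ℂ (Fin n) →L[ℂ] ℂ).comp
    (ContinuousLinearMap.snd ℂ _ _)).analyticAt q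

theorem analyticAt_setY (i : Fin n) (w : ℂ) (q : CotCoord n) :
    AnalyticAt ℂ (fun p : ℂ × CotCoord n => setY i p.1 p.2) (w, q) :=
  analyticAt_snd.add ((analyticAt_fst.sub
    ((analyticAt_snd_apply i q).comp_of_eq analyticAt_snd rfl)).smul analyticAt_const)

theorem exists_forall_analyticAt_setY {q : CotCoord n} (i : Fin n) {f : CotCoord n → ℂ}
    (hf : AnalyticAt ℂ f q) :
    ∃ r > 0, ∀ w ∈ Metric.ball (q.2 i) r, ∀ x ∈ Metric.ball q r,
      AnalyticAt ℂ (fun p : ℂ × CotCoord n => f (setY i p.1 p.2)) (w, x) := by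
  have f_setY : AnalyticAt ℂ (fun p : ℂ × CotCoord n => f (setY i p.1 p.2)) (q.2 i, q) :=
    hf.comp_of_eq (analyticAt_setY i (q.2 i) q) (setY_self i q)
  obtain ⟨r, hr, hball⟩ := Metric.eventually_nhds_iff_ball.1 f_setY.eventually_analyticAt
  rw [← ball_prod_same] at hball
  exact ⟨r, hr, fun w hw x hx => hball (w, x) ⟨hw, hx⟩⟩

theorem eventually_forall_sphere_det_ne_zero {X : Type*} [NormedAddCommGroup X] [NormedSpace ℂ X]
    {x₀ : X} {A : X → Matrix ι ι ℂ} (hA : ∀ k l, AnalyticAt ℂ (fun x => A x k l) x₀) {c : ℂ}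
    {ρ : ℝ} (hdet : ∀ w ∈ Metric.sphere c ρ, (w • 1 - A x₀).det ≠ 0) :
    ∀ᶠ x in 𝓝 x₀, ∀ w ∈ Metric.sphere c ρ, (w • 1 - A x).det ≠ 0 := by
  refine (isCompact_sphere _ _).eventually_forall_of_forall_eventually fun w hw => ?_
  refine (analyticAt_det (A := fun p : X × ℂ => p.2 • 1 - A p.1) (x₀ := (x₀, w))
    fun k l => ?_).continuousAt.eventually_ne (hdet w hw)
  exact (analyticAt_snd.smul analyticAt_const).sub ((hA k l).comp_of_eq analyticAt_fst rfl)

-- The remainder `N` does not depend on `yᵢ`, and inherits from `f` the independence of any `yⱼ`.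
theorem exists_division {q : CotCoord n} (i : Fin n) {A : EuclideanSpace ℂ (Fin n) → Matrix ι ι ℂ}
    (hA : ∀ k l, AnalyticAt ℂ (fun t => A t k l) q.1) {f : CotCoord n → ℂ}
    (hf : AnalyticAt ℂ f q) :
    ∃ N G : CotCoord n → Matrix ι ι ℂ, (∀ k l, AnalyticAt ℂ (fun x => N x k l) q) ∧
      (∀ k l, AnalyticAt ℂ (fun x => G x k l) q) ∧
      (∀ x x', x.1 = x'.1 → (∀ w, f (setY i w x) = f (setY i w x')) → N x = N x') ∧
      ∀ᶠ x in 𝓝 q, f x • (1 : Matrix ι ι ℂ) = N x + (x.2 i • 1 - A x.1) * G x := by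
  obtain ⟨r, hr, f_setY⟩ := exists_forall_analyticAt_setY i hf
  obtain ⟨ρ, hρ, hρr, hdet⟩ := exists_radius_det_ne_zero (A q.1) (q.2 i) hr
  have sphere_subset : ∀ w ∈ Metric.sphere (q.2 i) ρ, w ∈ Metric.ball (q.2 i) r := fun w hw =>
    Metric.closedBall_subset_ball hρr (Metric.sphere_subset_closedBall hw)
  have hq : q ∈ Metric.ball q r := Metric.mem_ball_self hr
  have hAq : ∀ k l, AnalyticAt ℂ (fun x : CotCoord n => A x.1 k l) q := fun k l =>
    (hA k l).comp_of_eq analyticAt_fst rfl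
  refine ⟨fun x => cauchyMatrix (q.2 i) ρ (fun w => f (setY i w x)) (A x.1),
    fun x => cauchyMatrix (q.2 i) ρ (fun w => (w - x.2 i)⁻¹ * f (setY i w x)) (A x.1),
    fun k l => ?_, fun k l => ?_, fun x x' hfst hsnd => by simp only [hfst, hsnd], ?_⟩
  · exact analyticAt_cauchyMatrix (g := fun p : ℂ × CotCoord n => f (setY i p.1 p.2)) hρ.le
      (fun w hw => f_setY w (sphere_subset w hw) q hq) hAq hdet k l
  · refine analyticAt_cauchyMatrix
      (g := fun p : ℂ × CotCoord n => (p.1 - p.2.2 i)⁻¹ * f (setY i p.1 p.2))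
      hρ.le (fun w hw => ?_) hAq hdet k l
    have hsub : AnalyticAt ℂ (fun p : ℂ × CotCoord n => p.1 - p.2.2 i) (w, q) :=
      analyticAt_fst.sub ((analyticAt_snd_apply i q).comp_of_eq analyticAt_snd rfl)
    exact (hsub.inv (sub_ne_zero.2 (Metric.ne_of_mem_sphere hw hρ.ne'))).mul
      (f_setY w (sphere_subset w hw) q hq)
  · filter_upwards [eventually_forall_sphere_det_ne_zero hAq hdet, Metric.ball_mem_nhds q hr,
      (analyticAt_snd_apply i q).continuousAt.eventually_mem (Metric.ball_mem_nhds _ hρ)]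
      with x hx hxr hy
    have hslice : DiffContOnCl ℂ (fun w => f (setY i w x)) (Metric.ball (q.2 i) ρ) := by
      refine DifferentiableOn.diffContOnCl fun w hw => ?_
      rw [closure_ball _ hρ.ne'] at hw
      exact ((f_setY w (Metric.closedBall_subset_ball hρr hw) x hxr).comp_of_eq
        (analyticAt_id.prod analyticAt_const) rfl).differentiableAt.differentiableWithinAt
    have := smul_one_eq_cauchyMatrix_add_mul hslice hx hy
    rwa [setY_self] at this

end SetY

end Division

section AnalyticGerms

variable {V : Type*} [NormedAddCommGroup V] [NormedSpace ℂ V]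

/-- The ring of functions which are holomorphic near `q`. -/
def analyticSubring (q : V) : Subring (V → ℂ) where
  carrier := {f | AnalyticAt ℂ f q}
  mul_mem' := fun hf hg => AnalyticAt.mul hf hg
  one_mem' := analyticAt_const
  add_mem' := fun hf hg => AnalyticAt.add hf hg
  zero_mem' := analyticAt_const
  neg_mem' := fun hf => AnalyticAt.neg hf

/-- The value at `v` of a function which is holomorphic near `q`. -/
def evalHom (q v : V) : analyticSubring q →+* ℂ :=
  (Pi.evalRingHom _ v).comp (analyticSubring q).subtype

/-- The germ of a function which is holomorphic near `q`. -/
def germHom (q : V) : analyticSubring q →+* holGerm q where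
  toFun f := ⟨(f.1 : Germ (𝓝 q) ℂ), f.1, f.2, rfl⟩
  map_one' := rfl
  map_mul' _ _ := rfl
  map_zero' := rfl
  map_add' _ _ := rfl

/-- The germs of holomorphic functions which vanish on a set. -/
def vanishingIdeal (L : Set V) (q : V) : Ideal (holGerm q) where
  carrier := {h | ∃ f : V → ℂ, (f : Germ (𝓝 q) ℂ) = h.1 ∧ ∀ᶠ x in 𝓝 q, x ∈ L → f x = 0}
  add_mem' := by
    rintro ⟨_, _⟩ ⟨_, _⟩ ⟨f, rfl, hf⟩ ⟨g, rfl, hg⟩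
    refine ⟨f + g, rfl, ?_⟩
    filter_upwards [hf, hg] with x hfx hgx hx
    simp [hfx hx, hgx hx]
  zero_mem' := ⟨0, rfl, Eventually.of_forall fun _ _ => rfl⟩
  smul_mem' := by
    rintro ⟨_, g, hg, rfl⟩ ⟨_, _⟩ ⟨f, rfl, hf⟩
    refine ⟨g * f, rfl, ?_⟩
    filter_upwards [hf] with x hfx hx
    simp [hfx hx]

theorem mem_vanishingIdeal_iff {L : Set V} {q : V} {h : holGerm q} {f : V → ℂ}
    (hf : (f : Germ (𝓝 q) ℂ) = h.1) :
    h ∈ vanishingIdeal L q ↔ ∀ᶠ x in 𝓝 q, x ∈ L → f x = 0 := by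
  refine ⟨?_, fun hf₀ => ⟨f, hf, hf₀⟩⟩
  rintro ⟨g, hg, hg₀⟩
  filter_upwards [hg₀, Germ.coe_eq.1 (hf.trans hg.symm)] with x hgx hfg hx
  rw [hfg, hgx hx]

theorem vanishingIdeal_isRadical (L : Set V) (q : V) : (vanishingIdeal L q).IsRadical := by
  rintro ⟨_, f, hf, rfl⟩ ⟨m, hm⟩
  refine (mem_vanishingIdeal_iff rfl).2 ?_
  filter_upwards [(mem_vanishingIdeal_iff (f := f ^ m) rfl).1 hm] with x hfx hx
  exact eq_zero_of_pow_eq_zero (hfx hx)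

end AnalyticGerms

section Nullstellensatz

variable {n : ℕ} {U : Set (EuclideanSpace ℂ (Fin n))}
  {a : Fin n → EuclideanSpace ℂ (Fin n) → Matrix (Fin n) (Fin n) ℂ}
  {e : EuclideanSpace ℂ (Fin n) → Fin n → ℂ} {q : CotCoord n}

/-- The stalk at `q` of the ideal sheaf of the analytic spectrum of a family of algebras. -/
noncomputable def charIdeal (a : Fin n → EuclideanSpace ℂ (Fin n) → Matrix (Fin n) (Fin n) ℂ)
    (e : EuclideanSpace ℂ (Fin n) → Fin n → ℂ) (q : CotCoord n) : Ideal (holGerm q) :=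
  Ideal.span
    ({h | h.1 = ((fun x : CotCoord n => ∑ k, e x.1 k * x.2 k - 1 : CotCoord n → ℂ) :
      Germ (𝓝 q) ℂ)} ∪
    {h | ∃ i j, h.1 = ((fun x : CotCoord n => x.2 i * x.2 j - ∑ k, a i x.1 k j * x.2 k :
      CotCoord n → ℂ) : Germ (𝓝 q) ℂ)})

theorem charIdeal_le_vanishingIdeal (U : Set (EuclideanSpace ℂ (Fin n))) (q : CotCoord n) :
    charIdeal a e q ≤ vanishingIdeal (charSet U a e) q := by
  refine Ideal.span_le.2 ?_
  rintro h (hh | ⟨i, j, hh⟩) <;>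
    refine (mem_vanishingIdeal_iff hh.symm).2 (Eventually.of_forall fun x hx => ?_)
  · exact sub_eq_zero.2 hx.2.1
  · exact sub_eq_zero.2 (hx.2.2 i j)

/-- The local ring of the analytic spectrum at `q`. -/
def SpectrumRing (a : Fin n → EuclideanSpace ℂ (Fin n) → Matrix (Fin n) (Fin n) ℂ)
    (e : EuclideanSpace ℂ (Fin n) → Fin n → ℂ) (q : CotCoord n) : Type :=
  holGerm q ⧸ charIdeal a e q

noncomputable instance : CommRing (SpectrumRing a e q) :=
  inferInstanceAs (CommRing (holGerm q ⧸ charIdeal a e q))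

/-- The class of a holomorphic function in the local ring of the analytic spectrum. -/
noncomputable def spectrumClass
    (a : Fin n → EuclideanSpace ℂ (Fin n) → Matrix (Fin n) (Fin n) ℂ)
    (e : EuclideanSpace ℂ (Fin n) → Fin n → ℂ) (q : CotCoord n) :
    analyticSubring q →+* SpectrumRing a e q :=
  (Ideal.Quotient.mk (charIdeal a e q)).comp (germHom q)

theorem spectrumClass_eq_zero_iff {f : analyticSubring q} :
    spectrumClass a e q f = 0 ↔ germHom q f ∈ charIdeal a e q :=
  Ideal.Quotient.eq_zero_iff_mem

/-- The pull-back of a function of `t` to the cotangent bundle. -/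
def pullbackHom (q : CotCoord n) : analyticSubring q.1 →+* analyticSubring q where
  toFun c := ⟨fun x => c.1 x.1, AnalyticAt.comp_of_eq c.2 analyticAt_fst rfl⟩
  map_one' := rfl
  map_mul' _ _ := rfl
  map_zero' := rfl
  map_add' _ _ := rfl

/-- The ring homomorphism which makes the local ring of the analytic spectrum an algebra over the
holomorphic functions on the base. -/
noncomputable def baseClass (a : Fin n → EuclideanSpace ℂ (Fin n) → Matrix (Fin n) (Fin n) ℂ)
    (e : EuclideanSpace ℂ (Fin n) → Fin n → ℂ) (q : CotCoord n) :
    analyticSubring q.1 →+* SpectrumRing a e q :=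
  (spectrumClass a e q).comp (pullbackHom q)

/-- The coordinate function `yₖ`. -/
def coordFun (q : CotCoord n) (k : Fin n) : analyticSubring q :=
  ⟨fun x => x.2 k, analyticAt_snd_apply k q⟩

/-- The vector of the classes of `y₁, …, yₙ`: the generic character of a family of algebras. -/
noncomputable def genericChar (a : Fin n → EuclideanSpace ℂ (Fin n) → Matrix (Fin n) (Fin n) ℂ)
    (e : EuclideanSpace ℂ (Fin n) → Fin n → ℂ) (q : CotCoord n) :
    Fin n → SpectrumRing a e q :=
  spectrumClass a e q ∘ coordFun q

theorem mapMatrix_smul_one {ι R S : Type*} [Fintype ι] [DecidableEq ι] [CommRing R] [CommRing S]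
    (φ : R →+* S) (r : R) :
    φ.mapMatrix (r • (1 : Matrix ι ι R)) = φ r • (1 : Matrix ι ι S) := by
  ext i j
  simp [Matrix.one_apply, apply_ite φ]

theorem spectrumClass_congr {f g : analyticSubring q} (hfg : f.1 =ᶠ[𝓝 q] g.1) :
    spectrumClass a e q f = spectrumClass a e q g :=
  congrArg (Ideal.Quotient.mk (charIdeal a e q)) (Subtype.ext (Germ.coe_eq.2 hfg))

theorem baseClass_congr {c d : analyticSubring q.1} (hcd : c.1 =ᶠ[𝓝 q.1] d.1) :
    baseClass a e q c = baseClass a e q d :=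
  spectrumClass_congr (continuousAt_fst.eventually hcd)

theorem mapMatrix_spectrumClass_congr {M N : Matrix (Fin n) (Fin n) (analyticSubring q)}
    (hMN : ∀ᶠ x in 𝓝 q, (evalHom q x).mapMatrix M = (evalHom q x).mapMatrix N) :
    (spectrumClass a e q).mapMatrix M = (spectrumClass a e q).mapMatrix N := by
  ext k l
  refine spectrumClass_congr ?_
  filter_upwards [hMN] with x hx
  exact congrFun (congrFun hx k) l

theorem isUnit_spectrumClass {f : analyticSubring q} (hf : f.1 q ≠ 0) :
    IsUnit (spectrumClass a e q f) := by
  refine IsUnit.of_mul_eq_one (spectrumClass a e q ⟨f.1⁻¹, AnalyticAt.inv f.2 hf⟩) ?_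
  rw [← map_mul, ← map_one (spectrumClass a e q)]
  refine spectrumClass_congr ?_
  filter_upwards [(f.2 : AnalyticAt ℂ f.1 q).continuousAt.eventually_ne hf] with x hx
  exact mul_inv_cancel₀ hx

theorem eval_eq_zero [Nontrivial (SpectrumRing a e q)] {f : analyticSubring q}
    (hf : spectrumClass a e q f = 0) : f.1 q = 0 := by
  by_contra hfq
  exact not_isUnit_zero (hf ▸ isUnit_spectrumClass hfq)

theorem dotProduct_genericChar (c : Fin n → analyticSubring q.1) :
    genericChar a e q ⬝ᵥ (baseClass a e q ∘ c) =
      spectrumClass a e q (∑ k, coordFun q k * pullbackHom q (c k)) := by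
  simp [genericChar, baseClass, dotProduct]

theorem eval_sum_coordFun_mul (c : Fin n → analyticSubring q.1) (x : CotCoord n) :
    (∑ k, coordFun q k * pullbackHom q (c k)).1 x = x.2.ofLp ⬝ᵥ (evalHom q.1 x.1 ∘ c) := by
  simp [coordFun, pullbackHom, dotProduct, evalHom]

theorem eventually_dotProduct_eq_zero {f : analyticSubring q} {c : Fin n → analyticSubring q.1}
    (hfc : spectrumClass a e q f = genericChar a e q ⬝ᵥ (baseClass a e q ∘ c))
    (hf : ∀ᶠ x in 𝓝 q, x ∈ charSet U a e → f.1 x = 0) :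
    ∀ᶠ x in 𝓝 q, x ∈ charSet U a e → x.2.ofLp ⬝ᵥ (evalHom q.1 x.1 ∘ c) = 0 := by
  rw [dotProduct_genericChar, ← sub_eq_zero, ← map_sub, spectrumClass_eq_zero_iff] at hfc
  filter_upwards [hf, (mem_vanishingIdeal_iff rfl).1 (charIdeal_le_vanishingIdeal U q hfc)]
    with x hfx hfcx hx
  have hx_eq : f.1 x - (∑ k, coordFun q k * pullbackHom q (c k)).1 x = 0 := hfcx hx
  rwa [hfx hx, zero_sub, neg_eq_zero, eval_sum_coordFun_mul] at hx_eq

theorem continuousAt_evalHom_comp (v : Fin n → analyticSubring q.1) :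
    ContinuousAt (fun t => evalHom q.1 t ∘ v) q.1 :=
  continuousAt_pi.2 fun k => AnalyticAt.continuousAt (v k).2

/-- The function `f` does not depend on the coordinates `yⱼ` with `j ∈ S`. -/
def IndepOf (S : Finset (Fin n)) (f : CotCoord n → ℂ) : Prop :=
  ∀ x x' : CotCoord n, x.1 = x'.1 → (∀ j ∉ S, x.2 j = x'.2 j) → f x = f x'

theorem IndepOf.sum {κ : Type*} [Fintype κ] {S : Finset (Fin n)} {f : κ → CotCoord n → ℂ}
    (hf : ∀ k, IndepOf S (f k)) : IndepOf S (∑ k, f k) := fun x x' hfst hsnd => by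
  simp only [Finset.sum_apply]
  exact Finset.sum_congr rfl fun k _ => hf k x x' hfst hsnd

theorem IndepOf.setY_eq {S : Finset (Fin n)} {i : Fin n} {f : CotCoord n → ℂ} (hf : IndepOf S f)
    {x x' : CotCoord n} (hfst : x.1 = x'.1) (hsnd : ∀ j ∉ insert i S, x.2 j = x'.2 j) (w : ℂ) :
    f (setY i w x) = f (setY i w x') := by
  refine hf _ _ (by rw [setY_fst, setY_fst, hfst]) fun j hj => ?_
  rw [setY_snd, setY_snd]
  split_ifs with hji
  · rfl
  · exact hsnd j (by simp [hji, hj])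

namespace IsAlgebraFamily

/-- The multiplication table of a family of algebras, over the ring of holomorphic functions. -/
def analyticTable (h : IsAlgebraFamily U a e) {t : EuclideanSpace ℂ (Fin n)} (ht : t ∈ U)
    (i : Fin n) : Matrix (Fin n) (Fin n) (analyticSubring t) :=
  Matrix.of fun k j => ⟨fun s => a i s k j, h.analyticAt i k j t ht⟩

/-- The unit of a family of algebras, over the ring of holomorphic functions. -/
def analyticUnit (h : IsAlgebraFamily U a e) {t : EuclideanSpace ℂ (Fin n)} (ht : t ∈ U)
    (k : Fin n) : analyticSubring t :=
  ⟨fun s => e s k, h.analyticAt_unit k t ht⟩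

theorem isChar_genericChar (h : IsAlgebraFamily U a e) (hq : q.1 ∈ U) :
    IsChar (fun i => (h.analyticTable hq i).map (baseClass a e q))
      (baseClass a e q ∘ h.analyticUnit hq) (genericChar a e q) := by
  constructor
  · have unit_mem : germHom q (∑ k, pullbackHom q (h.analyticUnit hq k) * coordFun q k - 1) ∈
        charIdeal a e q := by
      refine Ideal.subset_span (Or.inl (congrArg Germ.ofFun (funext fun x => ?_)))
      simp [analyticUnit, pullbackHom, coordFun]
    simpa [baseClass, genericChar, dotProduct, sub_eq_zero] using
      spectrumClass_eq_zero_iff.2 unit_mem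
  · intro i j
    have mul_mem : germHom q (coordFun q i * coordFun q j -
        ∑ k, pullbackHom q (h.analyticTable hq i k j) * coordFun q k) ∈ charIdeal a e q := by
      refine Ideal.subset_span (Or.inr ⟨i, j, congrArg Germ.ofFun (funext fun x => ?_)⟩)
      simp [analyticTable, pullbackHom, coordFun]
    simpa [baseClass, genericChar, sub_eq_zero] using spectrumClass_eq_zero_iff.2 mul_mem

theorem mem_charSet [Nontrivial (SpectrumRing a e q)] (h : IsAlgebraFamily U a e)
    (hq : q.1 ∈ U) : q ∈ charSet U a e := by
  obtain ⟨hunit, hmul⟩ := h.isChar_genericChar hq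
  refine ⟨hq, ?_, fun i j => ?_⟩
  · have := eval_eq_zero (a := a) (e := e)
      (f := ∑ k, pullbackHom q (h.analyticUnit hq k) * coordFun q k - 1) (by
        simpa [baseClass, genericChar, dotProduct, sub_eq_zero] using hunit)
    simpa [analyticUnit, pullbackHom, coordFun, dotProduct, sub_eq_zero] using this
  · have := eval_eq_zero (a := a) (e := e) (f := coordFun q i * coordFun q j -
      ∑ k, pullbackHom q (h.analyticTable hq i k j) * coordFun q k) (by
        simpa [baseClass, genericChar, sub_eq_zero] using hmul i j)
    simpa [analyticTable, pullbackHom, coordFun, sub_eq_zero] using this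

theorem exists_smul_genericChar_eq (h : IsAlgebraFamily U a e) (hq : q.1 ∈ U) {S : Finset (Fin n)}
    (i : Fin n) {f : analyticSubring q} (hf : IndepOf S f.1) :
    ∃ N : Matrix (Fin n) (Fin n) (analyticSubring q),
      (∀ k l, IndepOf (insert i S) (N k l).1) ∧
      spectrumClass a e q f • genericChar a e q =
        genericChar a e q ᵥ* N.map (spectrumClass a e q) := by
  obtain ⟨N, G, hN, hG, hNindep, hdiv⟩ :=
    exists_division i (fun k l => h.analyticAt i k l q.1 hq) f.2
  let N' : Matrix (Fin n) (Fin n) (analyticSubring q) := of fun k l => ⟨fun x => N x k l, hN k l⟩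
  let G' : Matrix (Fin n) (Fin n) (analyticSubring q) := of fun k l => ⟨fun x => G x k l, hG k l⟩
  let A := (h.analyticTable hq i).map (pullbackHom q)
  refine ⟨N', fun k l x x' hfst hsnd => ?_, ?_⟩
  · exact congrFun (congrFun (hNindep x x' hfst (hf.setY_eq hfst hsnd)) k) l
  have division : (spectrumClass a e q).mapMatrix (f • 1) =
      (spectrumClass a e q).mapMatrix (N' + (coordFun q i • 1 - A) * G') := by
    refine mapMatrix_spectrumClass_congr ?_
    filter_upwards [hdiv] with x hx
    rw [map_add, map_mul, map_sub, mapMatrix_smul_one, mapMatrix_smul_one]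
    exact hx
  have annihilates : genericChar a e q ᵥ*
      (spectrumClass a e q).mapMatrix (coordFun q i • 1 - A) = 0 := by
    have h_vecMul := (h.isChar_genericChar hq).vecMul (Pi.single i 1)
    rw [opMatrix_single, dotProduct_single_one] at h_vecMul
    rw [map_sub, vecMul_sub, mapMatrix_smul_one, vecMul_smul, vecMul_one, sub_eq_zero]
    exact h_vecMul.symm
  have vecMul_division := congrArg (genericChar a e q ᵥ* ·) division
  rw [← RingHom.mapMatrix_apply]
  simpa only [mapMatrix_smul_one, map_add, map_mul, vecMul_add, ← vecMul_vecMul, annihilates,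
    vecMul_smul, vecMul_one, zero_vecMul, add_zero] using vecMul_division

-- Dividing successively by the characteristic matrices of the multiplications by the coordinate
-- vector fields removes the variables `yⱼ` with `j ∈ S`.
theorem exists_smul_genericChar_eq_vecMul (h : IsAlgebraFamily U a e) (hq : q.1 ∈ U)
    (S : Finset (Fin n)) (f : analyticSubring q) :
    ∃ N : Matrix (Fin n) (Fin n) (analyticSubring q), (∀ k l, IndepOf S (N k l).1) ∧
      spectrumClass a e q f • genericChar a e q =
        genericChar a e q ᵥ* N.map (spectrumClass a e q) := by
  induction S using Finset.induction_on with
  | empty =>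
    refine ⟨f • 1, fun k l x x' hfst hsnd => ?_, ?_⟩
    · rw [show x = x' from Prod.ext hfst (by ext j; exact hsnd j (Finset.notMem_empty j))]
    · ext l
      simp [Matrix.vecMul, dotProduct, Matrix.one_apply, mul_comm, apply_ite]
  | insert i S _ ih =>
    obtain ⟨N, hN, hfN⟩ := ih
    choose N' hN' hNN' using fun k l => h.exists_smul_genericChar_eq hq i (hN k l)
    refine ⟨of fun m l => ∑ k, N' k l m k, fun m l => ?_, ?_⟩
    · simpa using IndepOf.sum fun k => hN' k l m k
    · ext l
      have step : ∀ k, genericChar a e q k * spectrumClass a e q (N k l) =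
        ∑ m, genericChar a e q m * spectrumClass a e q (N' k l m k) := fun k => by
        rw [mul_comm]
        exact congrFun (hNN' k l) k
      rw [hfN]
      simp only [vecMul, dotProduct, map_apply, of_apply, map_sum, Finset.mul_sum, step]
      exact Finset.sum_comm

theorem exists_spectrumClass_eq_dotProduct (h : IsAlgebraFamily U a e) (hq : q.1 ∈ U)
    (f : analyticSubring q) :
    ∃ c : Fin n → analyticSubring q.1,
      spectrumClass a e q f = genericChar a e q ⬝ᵥ (baseClass a e q ∘ c) := by
  obtain ⟨N, hN, hfN⟩ := h.exists_smul_genericChar_eq_vecMul hq Finset.univ f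
  have hslice : ∀ k l, AnalyticAt ℂ (fun t => (N k l).1 (t, q.2)) q.1 := fun k l =>
    AnalyticAt.comp_of_eq (g := (N k l).1) (N k l).2 (analyticAt_id.prod analyticAt_const) rfl
  let N₀ : Matrix (Fin n) (Fin n) (analyticSubring q.1) := of fun k l => ⟨_, hslice k l⟩
  have map_N : N.map (spectrumClass a e q) = N₀.map (baseClass a e q) := by
    ext k l
    exact congrArg (spectrumClass a e q)
      (Subtype.ext (funext fun x => hN k l x (x.1, q.2) rfl (by simp)))
  refine ⟨N₀ *ᵥ h.analyticUnit hq, ?_⟩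
  have unit_dotProduct := (h.isChar_genericChar hq).1
  calc spectrumClass a e q f
      = (spectrumClass a e q f • genericChar a e q) ⬝ᵥ (baseClass a e q ∘ h.analyticUnit hq) := by
        rw [smul_dotProduct, dotProduct_comm, unit_dotProduct, smul_eq_mul, mul_one]
    _ = genericChar a e q ⬝ᵥ (baseClass a e q ∘ (N₀ *ᵥ h.analyticUnit hq)) := by
        rw [hfN, map_N, ← Matrix.dotProduct_mulVec]
        congr 1
        ext k
        exact ((baseClass a e q).map_mulVec _ _ k).symm

theorem dotProduct_genericChar_pow_eq_zero (h : IsAlgebraFamily U a e) (hq : q.1 ∈ U)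
    {d : Fin n → analyticSubring q.1}
    (hd : ∀ᶠ t in 𝓝 q.1, ∀ y, IsChar (fun i => a i t) (e t) y →
      y ⬝ᵥ (evalHom q.1 t ∘ d) = 0) :
    (genericChar a e q ⬝ᵥ (baseClass a e q ∘ d)) ^ n = 0 := by
  refine (h.isChar_genericChar hq).dotProduct_pow_eq_zero ?_
  rw [← map_opMatrix, ← RingHom.mapMatrix_apply, ← map_pow]
  ext k l
  refine (baseClass_congr (d := 0) ?_).trans (map_zero _)
  filter_upwards [hd, h.isOpen.mem_nhds hq] with t htd htU
  have nilpotent : (evalHom q.1 t).mapMatrix (opMatrix (h.analyticTable hq) d ^ n) = 0 := by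
    rw [map_pow, RingHom.mapMatrix_apply, map_opMatrix]
    exact (congrArg _ (Fintype.card_fin n).symm).trans
      ((h.table t htU).opMatrix_pow_card_eq_zero htd)
  exact congrFun (congrFun nilpotent k) l

theorem dotProduct_genericChar_eq_one (h : IsAlgebraFamily U a e) (hq : q.1 ∈ U)
    {v : Fin n → analyticSubring q.1} (hvq : q.2.ofLp ⬝ᵥ (evalHom q.1 q.1 ∘ v) = 1)
    (hv : ∀ᶠ t in 𝓝 q.1, opMatrix (fun i => a i t) (evalHom q.1 t ∘ v) *ᵥ (evalHom q.1 t ∘ v) =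
      evalHom q.1 t ∘ v) :
    genericChar a e q ⬝ᵥ (baseClass a e q ∘ v) = 1 := by
  have isUnit : IsUnit (genericChar a e q ⬝ᵥ (baseClass a e q ∘ v)) := by
    rw [dotProduct_genericChar]
    exact isUnit_spectrumClass (by rw [eval_sum_coordFun_mul, hvq]; exact one_ne_zero)
  refine (IsIdempotentElem.iff_eq_one_of_isUnit isUnit).1 ?_
  rw [IsIdempotentElem, ← (h.isChar_genericChar hq).dotProduct_mulVec, ← map_opMatrix_mulVec]
  congr 1
  ext k
  refine baseClass_congr ?_
  filter_upwards [hv] with t ht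
  exact congrFun ((map_opMatrix_mulVec (evalHom q.1 t) (h.analyticTable hq) v v).trans ht) k

theorem exists_analytic_idempotent (h : IsAlgebraFamily U a e) (hq : q ∈ charSet U a e) :
    ∃ v : Fin n → analyticSubring q.1, q.2.ofLp ⬝ᵥ (evalHom q.1 q.1 ∘ v) = 1 ∧
      (∀ y, IsChar (fun i => a i q.1) (e q.1) y → y ≠ q.2.ofLp →
        y ⬝ᵥ (evalHom q.1 q.1 ∘ v) = 0) ∧
      ∀ᶠ t in 𝓝 q.1, opMatrix (fun i => a i t) (evalHom q.1 t ∘ v) *ᵥ (evalHom q.1 t ∘ v) =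
        evalHom q.1 t ∘ v := by
  obtain ⟨v₀, hv₀, hv₀_one, hv₀_zero⟩ := (h.table q.1 hq.1).exists_primitive_idempotent hq.2
  obtain ⟨v, hv, rfl, hv_idem⟩ := h.exists_idempotent_extension hq.1 hv₀
  exact ⟨fun k => ⟨fun t => v t k, analyticAt_pi_iff.1 hv k⟩, hv₀_one, hv₀_zero, hv_idem⟩

theorem eventually_forall_dotProduct_mulVec_eq_zero (h : IsAlgebraFamily U a e) (hq : q.1 ∈ U)
    {c v : EuclideanSpace ℂ (Fin n) → Fin n → ℂ} (hv : ContinuousAt v q.1)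
    (hc : ∀ᶠ x in 𝓝 q, x ∈ charSet U a e → x.2.ofLp ⬝ᵥ c x.1 = 0)
    (hvq : ∀ y, IsChar (fun i => a i q.1) (e q.1) y → y ≠ q.2.ofLp → y ⬝ᵥ v q.1 = 0)
    (hv_idem : ∀ᶠ t in 𝓝 q.1, opMatrix (fun i => a i t) (v t) *ᵥ v t = v t) :
    ∀ᶠ t in 𝓝 q.1, ∀ y, IsChar (fun i => a i t) (e t) y →
      y ⬝ᵥ (opMatrix (fun i => a i t) (c t) *ᵥ v t) = 0 := by
  have near_q := h.eventually_forall_isChar hq hv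
    (p := fun t y => (t, WithLp.toLp 2 y) ∈ charSet U a e → y ⬝ᵥ c t = 0) fun y hy hy_one => by
      obtain rfl : y = q.2.ofLp := by
        by_contra hne
        exact one_ne_zero (hy_one.symm.trans (hvq y hy hne))
      have hcont : Continuous fun z : EuclideanSpace ℂ (Fin n) × (Fin n → ℂ) =>
        ((z.1, WithLp.toLp 2 z.2) : CotCoord n) := by fun_prop
      exact hcont.continuousAt.eventually
        (p := fun x => x ∈ charSet U a e → x.2.ofLp ⬝ᵥ c x.1 = 0) hc
  filter_upwards [near_q, hv_idem, h.isOpen.mem_nhds hq] with t ht ht_idem htU y hy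
  rw [hy.dotProduct_mulVec]
  rcases hy.dotProduct_eq_zero_or_one ht_idem with hy_zero | hy_one
  · rw [hy_zero, mul_zero]
  · rw [ht y hy hy_one ⟨htU, hy⟩, zero_mul]

-- The Nullstellensatz. Multiplying by the idempotent of `q`, which is `1` in the local ring, makes
-- the linear representative of `f` vanish at all characters near `q.1`, not just at those near
-- `q`; it then acts nilpotently on each fibre.
theorem spectrumClass_pow_eq_zero [Nontrivial (SpectrumRing a e q)] (h : IsAlgebraFamily U a e)
    (hq : q.1 ∈ U) {f : analyticSubring q} (hf : ∀ᶠ x in 𝓝 q, x ∈ charSet U a e → f.1 x = 0) :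
    spectrumClass a e q f ^ n = 0 := by
  obtain ⟨c, hfc⟩ := h.exists_spectrumClass_eq_dotProduct hq f
  obtain ⟨v, hvq_one, hvq_zero, hv_idem⟩ := h.exists_analytic_idempotent (h.mem_charSet hq)
  have hcv := h.eventually_forall_dotProduct_mulVec_eq_zero hq
    (c := fun t => evalHom q.1 t ∘ c) (v := fun t => evalHom q.1 t ∘ v)
    (continuousAt_evalHom_comp v) (eventually_dotProduct_eq_zero hfc hf) hvq_zero hv_idem
  have hcv_pow := h.dotProduct_genericChar_pow_eq_zero hq
    (d := opMatrix (h.analyticTable hq) c *ᵥ v) (hcv.mono fun t ht => by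
      rw [map_opMatrix_mulVec]
      exact ht)
  rwa [map_opMatrix_mulVec, (h.isChar_genericChar hq).dotProduct_mulVec,
    h.dotProduct_genericChar_eq_one hq hvq_one hv_idem, mul_one, ← hfc] at hcv_pow

theorem mem_radical (h : IsAlgebraFamily U a e) (hq : q.1 ∈ U) {f : analyticSubring q}
    (hf : ∀ᶠ x in 𝓝 q, x ∈ charSet U a e → f.1 x = 0) :
    germHom q f ∈ (charIdeal a e q).radical := by
  suffices ∃ m : ℕ, spectrumClass a e q f ^ m = 0 by
    obtain ⟨m, hm⟩ := this
    exact ⟨m, by rwa [← map_pow, spectrumClass_eq_zero_iff, map_pow] at hm⟩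
  rcases subsingleton_or_nontrivial (SpectrumRing a e q) with _ | _
  · exact ⟨0, Subsingleton.elim _ _⟩
  · exact ⟨n, h.spectrumClass_pow_eq_zero hq hf⟩

theorem poisson_mem_radical (h : IsAlgebraFamily U a e) (hpot : ∀ t ∈ U, IsPotentialAt a t)
    (hq : q.1 ∈ U) {f g : holGerm q} (hf : f ∈ (charIdeal a e q).radical)
    (hg : g ∈ (charIdeal a e q).radical) : poisson f g ∈ (charIdeal a e q).radical := by
  have radical_le : (charIdeal a e q).radical ≤ vanishingIdeal (charSet U a e) q :=
    (vanishingIdeal_isRadical _ _).radical_le_iff.2 (charIdeal_le_vanishingIdeal U q)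
  replace hf := radical_le hf
  replace hg := radical_le hg
  obtain ⟨_, f, hfa, rfl⟩ := f
  obtain ⟨_, g, hga, rfl⟩ := g
  have hf₀ := (mem_vanishingIdeal_iff (f := f) rfl).1 hf
  have hg₀ := (mem_vanishingIdeal_iff (f := g) rfl).1 hg
  refine h.mem_radical hq (f := ⟨poissonFun f g, analyticAt_poissonFun hfa hga⟩) ?_
  filter_upwards [hf₀.eventually_nhds, hg₀.eventually_nhds, hfa.eventually_analyticAt,
    hga.eventually_analyticAt] with x hfx hgx hfax hgax hx
  exact h.poissonFun_eq_zero hpot hx hfax hgax hfx hgx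

end IsAlgebraFamily

end Nullstellensatz

section Lagrangian

variable {n : ℕ}

theorem fderiv_apply_eq_sum (f : CotCoord n → ℂ) (q v : CotCoord n) :
    fderiv ℂ f q v = ∑ k, (v.1 k * dt k f q + v.2 k * dy k f q) := by
  have hv : v = ∑ k, (v.1 k • ((EuclideanSpace.single k 1, 0) : CotCoord n) +
      v.2 k • ((0, EuclideanSpace.single k 1) : CotCoord n)) := by
    ext j
    · simp [Prod.fst_sum, Pi.single_apply]
    · simp [Prod.snd_sum, Pi.single_apply]
  conv_lhs => rw [hv]
  simp only [map_sum, map_add, map_smul, smul_eq_mul, dt, dy]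

-- If the differential of `g` at `q` is `ω(v, ·)`, then `v` is the negative of the Hamiltonian
-- vector of `g`.
theorem poissonFun_eq_neg_fderiv_apply {f g : CotCoord n → ℂ} {q v : CotCoord n}
    (hg : ∀ w, fderiv ℂ g q w = symplecticForm v w) :
    poissonFun f g q = -fderiv ℂ f q v := by
  have hdt : ∀ k, dt k g q = v.2 k := fun k => by simp [dt, hg, symplecticForm]
  have hdy : ∀ k, dy k g q = -v.1 k := fun k => by simp [dy, hg, symplecticForm]
  rw [fderiv_apply_eq_sum, poissonFun, ← Finset.sum_neg_distrib]
  refine Finset.sum_congr rfl fun k _ => ?_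
  rw [hdt, hdy]
  ring

/-- The symplectic form as a bilinear map. -/
noncomputable def symplecticBilin (n : ℕ) : CotCoord n →ₗ[ℂ] CotCoord n →ₗ[ℂ] ℂ :=
  LinearMap.mk₂ ℂ symplecticForm
    (fun v v' w => by
      simp only [symplecticForm, ← Finset.sum_add_distrib]
      exact Finset.sum_congr rfl fun k _ => by simp; ring)
    (fun c v w => by
      simp only [symplecticForm, smul_eq_mul, Finset.mul_sum]
      exact Finset.sum_congr rfl fun k _ => by simp; ring)
    (fun v w w' => by
      simp only [symplecticForm, ← Finset.sum_add_distrib]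
      exact Finset.sum_congr rfl fun k _ => by simp; ring)
    (fun c v w => by
      simp only [symplecticForm, smul_eq_mul, Finset.mul_sum]
      exact Finset.sum_congr rfl fun k _ => by simp; ring)

-- The orthogonal complement of `T` has dimension at least `2n - dim T ≥ n ≥ dim T`.
theorem isLagrangian_of_finrank_le {T : Submodule ℂ (CotCoord n)}
    (hT : ∀ v, (∀ w ∈ T, symplecticForm v w = 0) → v ∈ T) (hdim : Module.finrank ℂ T ≤ n) :
    IsLagrangian T := by
  let R : CotCoord n →ₗ[ℂ] Module.Dual ℂ T := T.subtype.dualMap ∘ₗ symplecticBilin n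
  have mem_ker : ∀ v, v ∈ LinearMap.ker R ↔ ∀ w ∈ T, symplecticForm v w = 0 := fun v => by
    rw [LinearMap.mem_ker, LinearMap.ext_iff]
    exact ⟨fun h w hw => h ⟨w, hw⟩, fun h w => h w.1 w.2⟩
  have rank_nullity := LinearMap.finrank_range_add_finrank_ker R
  have range_le : Module.finrank ℂ (LinearMap.range R) ≤ Module.finrank ℂ T :=
    (Submodule.finrank_le _).trans_eq Subspace.dual_finrank_eq
  have finrank_cotCoord : Module.finrank ℂ (CotCoord n) = n + n := by
    rw [Module.finrank_prod, finrank_euclideanSpace_fin]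
  have ker_eq : LinearMap.ker R = T :=
    Submodule.eq_of_le_of_finrank_le (fun v hv => hT v ((mem_ker v).1 hv)) (by omega)
  intro v
  rw [← mem_ker, ker_eq]

section SmoothChart

variable {V : Type*} [NormedAddCommGroup V] [NormedSpace ℂ V] {Φ : OpenPartialHomeomorph V V}
  {q : V}

theorem fderiv_symm_apply_fderiv (hq : q ∈ Φ.source) (hΦ : AnalyticOnNhd ℂ Φ Φ.source)
    (hΦs : AnalyticOnNhd ℂ Φ.symm Φ.target) (v : V) :
    fderiv ℂ Φ.symm (Φ q) (fderiv ℂ Φ q v) = v := by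
  have fderiv_comp := (hΦs _ (Φ.map_source hq)).differentiableAt.hasFDerivAt.comp q
    (hΦ q hq).differentiableAt.hasFDerivAt
  have fderiv_id : HasFDerivAt (Φ.symm ∘ Φ) (ContinuousLinearMap.id ℂ V) q := by
    refine (hasFDerivAt_id q).congr_of_eventuallyEq ?_
    filter_upwards [Φ.open_source.mem_nhds hq] with x hx using Φ.left_inv hx
  exact DFunLike.congr_fun (fderiv_comp.unique fderiv_id) v

theorem fderiv_apply_fderiv_symm (hq : q ∈ Φ.source) (hΦ : AnalyticOnNhd ℂ Φ Φ.source)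
    (hΦs : AnalyticOnNhd ℂ Φ.symm Φ.target) (v : V) :
    fderiv ℂ Φ q (fderiv ℂ Φ.symm (Φ q) v) = v := by
  have h_symm := fderiv_symm_apply_fderiv (Φ := Φ.symm) (Φ.map_source hq) hΦs hΦ v
  rwa [Φ.symm_symm, Φ.left_inv hq] at h_symm

theorem finrank_comap_fderiv_le [FiniteDimensional ℂ V] (hq : q ∈ Φ.source)
    (hΦ : AnalyticOnNhd ℂ Φ Φ.source) (hΦs : AnalyticOnNhd ℂ Φ.symm Φ.target)
    (W : Submodule ℂ V) :
    Module.finrank ℂ (W.comap (fderiv ℂ Φ q : V →ₗ[ℂ] V)) ≤ Module.finrank ℂ W := by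
  have comap_le : W.comap (fderiv ℂ Φ q : V →ₗ[ℂ] V) ≤
      W.map (fderiv ℂ Φ.symm (Φ q) : V →ₗ[ℂ] V) := fun v hv =>
    ⟨fderiv ℂ Φ q v, hv, fderiv_symm_apply_fderiv hq hΦ hΦs v⟩
  exact (Submodule.finrank_mono comap_le).trans (Submodule.finrank_map_le _ _)

end SmoothChart

theorem finrank_le_of_eventually_mem_graph {V E F : Type*} [NormedAddCommGroup V]
    [NormedSpace ℂ V] [NormedAddCommGroup E] [NormedSpace ℂ E] [FiniteDimensional ℂ E]
    [NormedAddCommGroup F] [NormedSpace ℂ F] {ψ : V → E × F} {ψ' : V →L[ℂ] E × F} {w : V}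
    {Y : E → F} (hψ : HasFDerivAt ψ ψ' w) (hinj : Function.Injective ψ')
    (hY : DifferentiableAt ℂ Y (ψ w).1) (hgraph : ∀ᶠ u in 𝓝 w, (ψ u).2 = Y (ψ u).1) :
    Module.finrank ℂ V ≤ Module.finrank ℂ E := by
  have snd_eq := (hψ.snd.congr_of_eventuallyEq (hgraph.mono fun u hu => hu.symm)).unique
    (hY.hasFDerivAt.comp w hψ.fst)
  refine LinearMap.finrank_le_finrank_of_injective
    (f := ((ContinuousLinearMap.fst ℂ E F).comp ψ' : V →ₗ[ℂ] E)) ?_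
  refine (injective_iff_map_eq_zero _).2 fun u hu => (injective_iff_map_eq_zero ψ').1 hinj u ?_
  have fst_zero : (ψ' u).1 = 0 := hu
  have snd_zero : (ψ' u).2 = fderiv ℂ Y (ψ w).1 (ψ' u).1 := DFunLike.congr_fun snd_eq u
  rw [fst_zero, map_zero] at snd_zero
  exact Prod.ext fst_zero snd_zero

variable {U : Set (EuclideanSpace ℂ (Fin n))}
  {a : Fin n → EuclideanSpace ℂ (Fin n) → Matrix (Fin n) (Fin n) ℂ}
  {e : EuclideanSpace ℂ (Fin n) → Fin n → ℂ} {q : CotCoord n}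
  {Φ : OpenPartialHomeomorph (CotCoord n) (CotCoord n)} {W : Submodule ℂ (CotCoord n)}

namespace IsAlgebraFamily

theorem poissonFun_comp_eq_zero (h : IsAlgebraFamily U a e) (hpot : ∀ t ∈ U, IsPotentialAt a t)
    (hq : q ∈ charSet U a e) (hqΦ : q ∈ Φ.source) (hΦ : AnalyticAt ℂ Φ q)
    (hL : ∀ x ∈ Φ.source, x ∈ charSet U a e ↔ Φ x ∈ W) {ℓ m : CotCoord n →L[ℂ] ℂ}
    (hℓ : ∀ w ∈ W, ℓ w = 0) (hm : ∀ w ∈ W, m w = 0) :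
    poissonFun (fun x => ℓ (Φ x)) (fun x => m (Φ x)) q = 0 := by
  have vanishes {k : CotCoord n →L[ℂ] ℂ} (hk : ∀ w ∈ W, k w = 0) :
      ∀ᶠ x in 𝓝 q, x ∈ charSet U a e → k (Φ x) = 0 := by
    filter_upwards [Φ.open_source.mem_nhds hqΦ] with x hx hxL using hk _ ((hL x hx).1 hxL)
  exact h.poissonFun_eq_zero hpot hq ((ℓ.analyticAt _).comp hΦ) ((m.analyticAt _).comp hΦ)
    (vanishes hℓ) (vanishes hm)

theorem fderiv_mem_of_forall_symplecticForm_eq_zero (h : IsAlgebraFamily U a e)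
    (hpot : ∀ t ∈ U, IsPotentialAt a t) (hq : q ∈ charSet U a e) (hqΦ : q ∈ Φ.source)
    (hΦ : AnalyticOnNhd ℂ Φ Φ.source) (hΦs : AnalyticOnNhd ℂ Φ.symm Φ.target)
    (hL : ∀ x ∈ Φ.source, x ∈ charSet U a e ↔ Φ x ∈ W) {v : CotCoord n}
    (hv : ∀ w, fderiv ℂ Φ q w ∈ W → symplecticForm v w = 0) : fderiv ℂ Φ q v ∈ W := by
  by_contra hvW
  obtain ⟨ℓ, hℓv, hℓ⟩ := Submodule.exists_le_ker_of_notMem hvW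
  let ℓ' := LinearMap.toContinuousLinearMap ℓ
  let m : CotCoord n →L[ℂ] ℂ :=
    (LinearMap.toContinuousLinearMap (symplecticBilin n v)).comp (fderiv ℂ Φ.symm (Φ q))
  have hm : ∀ w ∈ W, m w = 0 := fun w hw =>
    hv _ ((fderiv_apply_fderiv_symm hqΦ hΦ hΦs w).symm ▸ hw)
  have hΦq := (hΦ q hqΦ).differentiableAt.hasFDerivAt
  have fderiv_m : ∀ w, fderiv ℂ (fun x => m (Φ x)) q w = symplecticForm v w := fun w => by
    refine (DFunLike.congr_fun (m.hasFDerivAt.comp q hΦq).fderiv w).trans ?_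
    exact congrArg (symplecticForm v) (fderiv_symm_apply_fderiv hqΦ hΦ hΦs w)
  have fderiv_ℓ : fderiv ℂ (fun x => ℓ' (Φ x)) q v = ℓ (fderiv ℂ Φ q v) :=
    DFunLike.congr_fun (ℓ'.hasFDerivAt.comp q hΦq).fderiv v
  have poisson_zero := h.poissonFun_comp_eq_zero hpot hq hqΦ (hΦ q hqΦ) hL (ℓ := ℓ')
    (fun w hw => hℓ hw) hm
  rw [poissonFun_eq_neg_fderiv_apply fderiv_m, fderiv_ℓ, neg_eq_zero] at poisson_zero
  exact hℓv poisson_zero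

theorem finrank_le_of_chart (h : IsAlgebraFamily U a e) (hq : q ∈ charSet U a e)
    (hqΦ : q ∈ Φ.source) (hΦ : AnalyticOnNhd ℂ Φ Φ.source)
    (hΦs : AnalyticOnNhd ℂ Φ.symm Φ.target)
    (hL : ∀ x ∈ Φ.source, x ∈ charSet U a e ↔ Φ x ∈ W) : Module.finrank ℂ W ≤ n := by
  obtain ⟨t₁, Y, hY, hYL, hgraph, -⟩ := h.exists_graph hq Φ.open_source hqΦ
  obtain ⟨hpΦ, hpL⟩ := hYL.self_of_nhds
  set p : CotCoord n := (t₁, Y t₁)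
  let w₀ : W := ⟨Φ p, (hL p hpΦ).1 hpL⟩
  have symm_w₀ : Φ.symm w₀ = p := Φ.left_inv hpΦ
  have hψ : HasFDerivAt (fun w : W => Φ.symm w) ((fderiv ℂ Φ.symm (Φ p)).comp W.subtypeL) w₀ :=
    HasFDerivAt.comp (g := Φ.symm) w₀
      (hΦs (Φ p) (Φ.map_source hpΦ)).differentiableAt.hasFDerivAt W.subtypeL.hasFDerivAt
  have injective : Function.Injective ((fderiv ℂ Φ.symm (Φ p)).comp W.subtypeL) :=
    (Function.LeftInverse.injective (fderiv_apply_fderiv_symm hpΦ hΦ hΦs)).comp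
      Subtype.val_injective
  refine (finrank_le_of_eventually_mem_graph (Y := Y) hψ injective ?_ ?_).trans_eq
    finrank_euclideanSpace_fin
  · rwa [symm_w₀]
  · have mem_target : ∀ᶠ w : W in 𝓝 w₀, (w : CotCoord n) ∈ Φ.target :=
      continuous_subtype_val.continuousAt.eventually_mem
        (Φ.open_target.mem_nhds (Φ.map_source hpΦ))
    have tendsto_p : Tendsto (fun w : W => Φ.symm w) (𝓝 w₀) (𝓝 p) := by
      simpa only [ContinuousAt, symm_w₀] using hψ.continuousAt
    filter_upwards [mem_target, tendsto_p.eventually hgraph] with w hw hwY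
    refine hwY ((hL _ (Φ.map_target hw)).2 ?_)
    rw [Φ.right_inv hw]
    exact w.2

theorem isLagrangian (h : IsAlgebraFamily U a e) (hpot : ∀ t ∈ U, IsPotentialAt a t)
    {T : Submodule ℂ (CotCoord n)} (hT : IsSmoothPoint (charSet U a e) q T) :
    IsLagrangian T := by
  obtain ⟨hq, Φ, W, hqΦ, hΦ, hΦs, hL, rfl⟩ := hT
  exact isLagrangian_of_finrank_le
    (fun v hv => h.fderiv_mem_of_forall_symplecticForm_eq_zero hpot hq hqΦ hΦ hΦs hL hv)
    ((finrank_comap_fderiv_le hqΦ hΦ hΦs W).trans (h.finrank_le_of_chart hq hqΦ hΦ hΦs hL))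

end IsAlgebraFamily

end Lagrangian

section Chart

variable {n : ℕ} {M : Type*} [TopologicalSpace M] [ChartedSpace (EuclideanSpace ℂ (Fin n)) M]
  {φ : OpenPartialHomeomorph M (EuclideanSpace ℂ (Fin n))}

/-- The constant vector field `v` on `ℂⁿ`. -/
def constField (v : EuclideanSpace ℂ (Fin n)) (t : EuclideanSpace ℂ (Fin n)) :
    TangentSpace 𝓘(ℂ, EuclideanSpace ℂ (Fin n)) t := v

/-- The coordinate vector field `∂ᵢ` of a chart, as a vector field on the manifold. -/
noncomputable def chartField (φ : OpenPartialHomeomorph M (EuclideanSpace ℂ (Fin n))) (i : Fin n) :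
    ∀ x : M, TangentSpace 𝓘(ℂ, EuclideanSpace ℂ (Fin n)) x :=
  VectorField.mpullback 𝓘(ℂ, EuclideanSpace ℂ (Fin n)) 𝓘(ℂ, EuclideanSpace ℂ (Fin n)) φ
    (constField (EuclideanSpace.single i 1))

theorem contMDiffAt_chart
    (hφ : φ ∈ IsManifold.maximalAtlas 𝓘(ℂ, EuclideanSpace ℂ (Fin n)) ω M) {x : M}
    (hx : x ∈ φ.source) :
    ContMDiffAt 𝓘(ℂ, EuclideanSpace ℂ (Fin n)) 𝓘(ℂ, EuclideanSpace ℂ (Fin n)) ω φ x :=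
  (contMDiffOn_of_mem_maximalAtlas hφ).contMDiffAt (φ.open_source.mem_nhds hx)

theorem contMDiffAt_chart_symm
    (hφ : φ ∈ IsManifold.maximalAtlas 𝓘(ℂ, EuclideanSpace ℂ (Fin n)) ω M)
    {t : EuclideanSpace ℂ (Fin n)} (ht : t ∈ φ.target) :
    ContMDiffAt 𝓘(ℂ, EuclideanSpace ℂ (Fin n)) 𝓘(ℂ, EuclideanSpace ℂ (Fin n)) ω φ.symm t :=
  (contMDiffOn_symm_of_mem_maximalAtlas hφ).contMDiffAt (φ.open_target.mem_nhds ht)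

theorem mdifferentiable_chart
    (hφ : φ ∈ IsManifold.maximalAtlas 𝓘(ℂ, EuclideanSpace ℂ (Fin n)) ω M) :
    φ.MDifferentiable 𝓘(ℂ, EuclideanSpace ℂ (Fin n)) 𝓘(ℂ, EuclideanSpace ℂ (Fin n)) :=
  ⟨(contMDiffOn_of_mem_maximalAtlas hφ).mdifferentiableOn (by simp),
    (contMDiffOn_symm_of_mem_maximalAtlas hφ).mdifferentiableOn (by simp)⟩

theorem isInvertible_mfderiv_chart
    (hφ : φ ∈ IsManifold.maximalAtlas 𝓘(ℂ, EuclideanSpace ℂ (Fin n)) ω M) {x : M}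
    (hx : x ∈ φ.source) : (mfderiv 𝓘(ℂ, EuclideanSpace ℂ (Fin n))
      𝓘(ℂ, EuclideanSpace ℂ (Fin n)) φ x).IsInvertible :=
  ⟨(mdifferentiable_chart hφ).mfderiv hx, rfl⟩

theorem mfderiv_chartField
    (hφ : φ ∈ IsManifold.maximalAtlas 𝓘(ℂ, EuclideanSpace ℂ (Fin n)) ω M) {x : M}
    (hx : x ∈ φ.source) (i : Fin n) :
    mfderiv 𝓘(ℂ, EuclideanSpace ℂ (Fin n)) 𝓘(ℂ, EuclideanSpace ℂ (Fin n)) φ x (chartField φ i x) =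
      constField (EuclideanSpace.single i 1) (φ x) := by
  obtain ⟨e, he⟩ := isInvertible_mfderiv_chart hφ hx
  rw [chartField, VectorField.mpullback_apply, ← he, ContinuousLinearMap.inverse_equiv]
  exact e.apply_symm_apply _

theorem component_eq (φ : OpenPartialHomeomorph M (EuclideanSpace ℂ (Fin n))) (k : Fin n) {x : M}
    (X : TangentSpace 𝓘(ℂ, EuclideanSpace ℂ (Fin n)) x) :
    component φ k X = NormedSpace.fromTangentSpace (𝕜 := ℂ) (φ x)
      (mfderiv 𝓘(ℂ, EuclideanSpace ℂ (Fin n)) 𝓘(ℂ, EuclideanSpace ℂ (Fin n)) φ x X) k := rfl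

theorem eq_sum_component
    (hφ : φ ∈ IsManifold.maximalAtlas 𝓘(ℂ, EuclideanSpace ℂ (Fin n)) ω M) {x : M}
    (hx : x ∈ φ.source) (X : TangentSpace 𝓘(ℂ, EuclideanSpace ℂ (Fin n)) x) :
    X = ∑ k, component φ k X • chartField φ k x := by
  obtain ⟨e, he⟩ := isInvertible_mfderiv_chart hφ hx
  refine (e.trans (NormedSpace.fromTangentSpace (𝕜 := ℂ) (φ x))).injective ?_
  have map_chartField : ∀ k, NormedSpace.fromTangentSpace (𝕜 := ℂ) (φ x) (e (chartField φ k x)) =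
      (EuclideanSpace.single k 1 : EuclideanSpace ℂ (Fin n)) := fun k => by
    have mfderiv_eq := mfderiv_chartField hφ hx k
    rw [← he] at mfderiv_eq
    exact congrArg (NormedSpace.fromTangentSpace (𝕜 := ℂ) (φ x)) mfderiv_eq
  have component_eq_map : ∀ k, component φ k X =
      NormedSpace.fromTangentSpace (𝕜 := ℂ) (φ x) (e X) k := fun k => by
    rw [component_eq, ← he]
    rfl
  rw [map_sum]
  simp only [map_smul, ContinuousLinearEquiv.trans_apply, map_chartField, component_eq_map]
  ext j
  simp [Pi.single_apply]

theorem coordField_eq_chartField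
    (hφ : φ ∈ IsManifold.maximalAtlas 𝓘(ℂ, EuclideanSpace ℂ (Fin n)) ω M)
    {t : EuclideanSpace ℂ (Fin n)} (ht : t ∈ φ.target) (i : Fin n) :
    coordField φ i t = chartField φ i (φ.symm t) := by
  obtain ⟨e, he⟩ := isInvertible_mfderiv_chart hφ (φ.map_target ht)
  refine e.injective ?_
  have mfderiv_chartField_eq := mfderiv_chartField hφ (φ.map_target ht) i
  have mfderiv_coordField_eq : mfderiv 𝓘(ℂ, EuclideanSpace ℂ (Fin n))
      𝓘(ℂ, EuclideanSpace ℂ (Fin n)) φ (φ.symm t) (coordField φ i t) =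
        constField (EuclideanSpace.single i 1) (φ (φ.symm t)) :=
    DFunLike.congr_fun ((mdifferentiable_chart hφ).comp_symm_deriv ht)
      (constField (EuclideanSpace.single i 1) t)
  rw [← he] at mfderiv_chartField_eq mfderiv_coordField_eq
  exact mfderiv_coordField_eq.trans mfderiv_chartField_eq.symm

theorem contMDiffAt_constField (v t : EuclideanSpace ℂ (Fin n)) :
    HolVectorFieldAt n (constField v) t :=
  contMDiffAt_vectorSpace_iff_contDiffAt.2 (contDiffAt_const (c := v))

theorem analyticAt_comp_chart_symm {G : Type*} [NormedAddCommGroup G] [NormedSpace ℂ G]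
    [CompleteSpace G]
    (hφ : φ ∈ IsManifold.maximalAtlas 𝓘(ℂ, EuclideanSpace ℂ (Fin n)) ω M)
    {t : EuclideanSpace ℂ (Fin n)} (ht : t ∈ φ.target) {f : M → G}
    (hf : ContMDiffAt 𝓘(ℂ, EuclideanSpace ℂ (Fin n)) 𝓘(ℂ, G) ω f (φ.symm t)) :
    AnalyticAt ℂ (f ∘ φ.symm) t :=
  ContDiffAt.analyticAt (contMDiffAt_iff_contDiffAt.1
    (ContMDiffAt.comp t hf (contMDiffAt_chart_symm hφ ht)))

theorem analyticAt_of_comp_chart {G : Type*} [NormedAddCommGroup G] [NormedSpace ℂ G]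
    [CompleteSpace G]
    (hφ : φ ∈ IsManifold.maximalAtlas 𝓘(ℂ, EuclideanSpace ℂ (Fin n)) ω M) {x : M}
    (hx : x ∈ φ.source) {f : EuclideanSpace ℂ (Fin n) → G}
    (hf : ContMDiffAt 𝓘(ℂ, EuclideanSpace ℂ (Fin n)) 𝓘(ℂ, G) ω (fun y => f (φ y)) x) :
    AnalyticAt ℂ f (φ x) := by
  rw [← φ.left_inv hx] at hf
  refine (analyticAt_comp_chart_symm hφ (φ.map_source hx) hf).congr ?_
  filter_upwards [φ.open_target.mem_nhds (φ.map_source hx)] with t ht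
  exact congrArg f (φ.right_inv ht)

theorem mvfderiv_chartField
    (hφ : φ ∈ IsManifold.maximalAtlas 𝓘(ℂ, EuclideanSpace ℂ (Fin n)) ω M) {x : M}
    (hx : x ∈ φ.source) {f : M → ℂ}
    (hf : MDifferentiableAt 𝓘(ℂ, EuclideanSpace ℂ (Fin n)) 𝓘(ℂ, ℂ) f x) (i : Fin n) :
    mvfderiv 𝓘(ℂ, EuclideanSpace ℂ (Fin n)) f x (chartField φ i x) =
      fderiv ℂ (f ∘ φ.symm) (φ x) (EuclideanSpace.single i 1) := by
  have comp_eq : (f ∘ φ.symm) ∘ φ =ᶠ[𝓝 x] f := by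
    filter_upwards [φ.open_source.mem_nhds hx] with y hy
    simp [φ.left_inv hy]
  have mdifferentiableAt_comp :
      MDifferentiableAt 𝓘(ℂ, EuclideanSpace ℂ (Fin n)) 𝓘(ℂ, ℂ) (f ∘ φ.symm) (φ x) := by
    refine MDifferentiableAt.comp (φ x) ?_
      ((contMDiffAt_chart_symm hφ (φ.map_source hx)).mdifferentiableAt (by simp))
    rwa [φ.left_inv hx]
  calc mvfderiv 𝓘(ℂ, EuclideanSpace ℂ (Fin n)) f x (chartField φ i x)
      = mvfderiv 𝓘(ℂ, EuclideanSpace ℂ (Fin n)) ((f ∘ φ.symm) ∘ φ) x (chartField φ i x) :=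
        DFunLike.congr_fun (comp_eq.symm.mfderiv_eq (I := 𝓘(ℂ, EuclideanSpace ℂ (Fin n)))
          (I' := 𝓘(ℂ, ℂ))) (chartField φ i x)
    _ = mvfderiv 𝓘(ℂ, EuclideanSpace ℂ (Fin n)) (f ∘ φ.symm) (φ x)
          (constField (EuclideanSpace.single i 1) (φ x)) := by
        rw [mvfderiv_comp_apply x mdifferentiableAt_comp
          ((contMDiffAt_chart hφ hx).mdifferentiableAt (by simp)), mfderiv_chartField hφ hx]
    _ = fderiv ℂ (f ∘ φ.symm) (φ x) (EuclideanSpace.single i 1) :=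
        DFunLike.congr_fun (mfderiv_eq_fderiv (𝕜 := ℂ)) (EuclideanSpace.single i 1)

theorem mvfderiv_comp_chart
    (hφ : φ ∈ IsManifold.maximalAtlas 𝓘(ℂ, EuclideanSpace ℂ (Fin n)) ω M) {x : M}
    (hx : x ∈ φ.source) {f : EuclideanSpace ℂ (Fin n) → ℂ} (hf : DifferentiableAt ℂ f (φ x))
    (i : Fin n) :
    mvfderiv 𝓘(ℂ, EuclideanSpace ℂ (Fin n)) (fun y => f (φ y)) x (chartField φ i x) =
      fderiv ℂ f (φ x) (EuclideanSpace.single i 1) := by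
  have comp_eq : (fun y => f (φ y)) ∘ φ.symm =ᶠ[𝓝 (φ x)] f := by
    filter_upwards [φ.open_target.mem_nhds (φ.map_source hx)] with t ht
    exact congrArg f (φ.right_inv ht)
  rw [mvfderiv_chartField (f := fun y => f (φ y)) hφ hx (hf.comp_mdifferentiableAt
    ((contMDiffAt_chart hφ hx).mdifferentiableAt (by simp))), comp_eq.fderiv_eq]

variable [IsManifold 𝓘(ℂ, EuclideanSpace ℂ (Fin n)) ω M]

theorem holVectorFieldAt_chartField
    (hφ : φ ∈ IsManifold.maximalAtlas 𝓘(ℂ, EuclideanSpace ℂ (Fin n)) ω M) {x : M}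
    (hx : x ∈ φ.source) (i : Fin n) : HolVectorFieldAt n (chartField φ i) x :=
  ContMDiffAt.mpullback_vectorField_preimage (n := ω) (contMDiffAt_constField _ _)
    (contMDiffAt_chart hφ hx) (isInvertible_mfderiv_chart hφ hx) (by simp)

theorem mlieBracket_constField (v w t : EuclideanSpace ℂ (Fin n)) :
    VectorField.mlieBracket 𝓘(ℂ, EuclideanSpace ℂ (Fin n)) (constField v) (constField w) t =
      0 := by
  rw [← VectorField.mlieBracketWithin_univ, VectorField.mlieBracketWithin_eq_lieBracketWithin]
  change VectorField.lieBracketWithin ℂ (fun _ : EuclideanSpace ℂ (Fin n) => v)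
    (fun _ : EuclideanSpace ℂ (Fin n) => w) Set.univ t = 0
  simp [VectorField.lieBracketWithin]

theorem mlieBracket_chartField
    (hφ : φ ∈ IsManifold.maximalAtlas 𝓘(ℂ, EuclideanSpace ℂ (Fin n)) ω M) {x : M}
    (hx : x ∈ φ.source) (i j : Fin n) :
    VectorField.mlieBracket 𝓘(ℂ, EuclideanSpace ℂ (Fin n)) (chartField φ i) (chartField φ j) x =
      0 := by
  have mdifferentiableAt_constField : ∀ k, MDifferentiableAt 𝓘(ℂ, EuclideanSpace ℂ (Fin n))
      (𝓘(ℂ, EuclideanSpace ℂ (Fin n)).prod 𝓘(ℂ, EuclideanSpace ℂ (Fin n)))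
      (fun t => TotalSpace.mk' (EuclideanSpace ℂ (Fin n)) t
        (constField (EuclideanSpace.single k 1) t)) (φ x) := fun k =>
    (contMDiffAt_constField _ _).mdifferentiableAt (by simp)
  have : IsManifold 𝓘(ℂ, EuclideanSpace ℂ (Fin n)) (minSmoothness ℂ 3) M :=
    IsManifold.of_le (n := ω) (by simp)
  rw [chartField, chartField, ← VectorField.mpullback_mlieBracket (n := ω)
    (mdifferentiableAt_constField i) (mdifferentiableAt_constField j)
    (contMDiffAt_chart hφ hx) (by simp), VectorField.mpullback_apply, mlieBracket_constField,
    map_zero]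

end Chart

section Frame

variable {n : ℕ} {EB HB B : Type*} [NormedAddCommGroup EB] [NormedSpace ℂ EB] [TopologicalSpace HB]
  {IB : ModelWithCorners ℂ EB HB} [TopologicalSpace B] [ChartedSpace HB B]
  {F : Type*} [NormedAddCommGroup F] [NormedSpace ℂ F]
  {V : B → Type*} [TopologicalSpace (TotalSpace F V)]
  [∀ x, TopologicalSpace (V x)] [FiberBundle F V]

/-- The linear combinations of a tuple of sections in a local trivialization. -/
noncomputable def frameMap (x₀ : B) (s : Fin n → ∀ x, V x) (x : B) : (Fin n → ℂ) →L[ℂ] F :=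
  LinearMap.toContinuousLinearMap
    (Fintype.linearCombination ℂ fun j => (trivializationAt F V x₀ ⟨x, s j x⟩).2)

theorem contMDiffAt_frameMap [FiniteDimensional ℂ F] {x₀ : B} {s : Fin n → ∀ x, V x}
    (hs : ∀ j, ContMDiffAt IB (IB.prod 𝓘(ℂ, F)) ω (fun x => TotalSpace.mk' F x (s j x)) x₀) :
    ContMDiffAt IB 𝓘(ℂ, (Fin n → ℂ) →L[ℂ] F) ω (frameMap (F := F) x₀ s) x₀ := by
  have holomorphic_frame : ContMDiffAt IB 𝓘(ℂ, Fin n → F) ω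
      (fun x j => (trivializationAt F V x₀ ⟨x, s j x⟩).2) x₀ :=
    contMDiffAt_pi_space.2 fun j => (contMDiffAt_section x₀).1 (hs j)
  let Λ : (Fin n → F) →ₗ[ℂ] ((Fin n → ℂ) →L[ℂ] F) :=
    { toFun := fun w => LinearMap.toContinuousLinearMap (Fintype.linearCombination ℂ w)
      map_add' := fun w w' => by
        ext c
        simp [Fintype.linearCombination_apply, smul_add, Finset.sum_add_distrib]
      map_smul' := fun r w => by
        ext c
        simp [Fintype.linearCombination_apply, Finset.smul_sum, smul_comm r] }
  exact ContMDiffAt.comp x₀ (g := LinearMap.toContinuousLinearMap Λ)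
    (LinearMap.toContinuousLinearMap Λ).contDiff.contMDiff.contMDiffAt holomorphic_frame

variable [∀ x, AddCommGroup (V x)] [∀ x, Module ℂ (V x)]

/-- The operator `Δ` on sections is a derivation at `p` over the derivation `δ` on functions. -/
structure IsDerivationAt (IB : ModelWithCorners ℂ EB HB) (F : Type*) [NormedAddCommGroup F]
    [NormedSpace ℂ F] [TopologicalSpace (TotalSpace F V)] [FiberBundle F V] {p : B}
    (Δ : (∀ x, V x) → V p) (δ : (B → ℂ) → ℂ) : Prop where
  add : ∀ σ σ' : ∀ x, V x,
    MDifferentiableAt IB (IB.prod 𝓘(ℂ, F)) (fun x => TotalSpace.mk' F x (σ x)) p →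
    MDifferentiableAt IB (IB.prod 𝓘(ℂ, F)) (fun x => TotalSpace.mk' F x (σ' x)) p →
    Δ (σ + σ') = Δ σ + Δ σ'
  leibniz : ∀ (g : B → ℂ) (σ : ∀ x, V x), MDifferentiableAt IB 𝓘(ℂ, ℂ) g p →
    MDifferentiableAt IB (IB.prod 𝓘(ℂ, F)) (fun x => TotalSpace.mk' F x (σ x)) p →
    Δ (g • σ) = δ g • σ p + g p • Δ σ
  eq_zero : ∀ g : B → ℂ, (∀ᶠ x in 𝓝 p, g x = 1) → δ g = 0

theorem IsDerivationAt.congr {p : B} {Δ : (∀ x, V x) → V p} {δ : (B → ℂ) → ℂ}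
    (h : IsDerivationAt IB F Δ δ) {σ σ' : ∀ x, V x}
    (hσ : MDifferentiableAt IB (IB.prod 𝓘(ℂ, F)) (fun x => TotalSpace.mk' F x (σ x)) p)
    (hσ' : MDifferentiableAt IB (IB.prod 𝓘(ℂ, F)) (fun x => TotalSpace.mk' F x (σ' x)) p)
    (heq : ∀ᶠ x in 𝓝 p, σ x = σ' x) : Δ σ = Δ σ' := by
  classical
  let ψ : B → ℂ := fun x => if σ x = σ' x then 1 else 0
  have hψ : ∀ᶠ x in 𝓝 p, ψ x = 1 := heq.mono fun x hx => if_pos hx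
  have hψd : MDifferentiableAt IB 𝓘(ℂ, ℂ) ψ p :=
    (mdifferentiableAt_const (c := (1 : ℂ))).congr_of_eventuallyEq hψ
  have smul_eq : ψ • σ = ψ • σ' := by
    funext x
    by_cases hx : σ x = σ' x
    · simp [hx]
    · simp [ψ, hx]
  have apply_smul : ∀ τ : ∀ x, V x,
      MDifferentiableAt IB (IB.prod 𝓘(ℂ, F)) (fun x => TotalSpace.mk' F x (τ x)) p →
        Δ (ψ • τ) = Δ τ := fun τ hτ => by
    rw [h.leibniz ψ τ hψd hτ, h.eq_zero ψ hψ, hψ.self_of_nhds, zero_smul, zero_add, one_smul]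
  rw [← apply_smul σ hσ, smul_eq, apply_smul σ' hσ']

variable [VectorBundle ℂ F V]

theorem frameMap_apply {x₀ x : B} (hx : x ∈ (trivializationAt F V x₀).baseSet)
    (s : Fin n → ∀ x, V x) (c : Fin n → ℂ) : frameMap (F := F) x₀ s x c =
      (trivializationAt F V x₀).continuousLinearEquivAt ℂ x hx
        (Fintype.linearCombination ℂ (fun j => s j x) c) := by
  simp only [frameMap, LinearMap.coe_toContinuousLinearMap', Fintype.linearCombination_apply,
    map_sum, map_smul]
  rfl

theorem bijective_frameMap_iff {x₀ x : B} (hx : x ∈ (trivializationAt F V x₀).baseSet)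
    (s : Fin n → ∀ x, V x) : Function.Bijective (frameMap (F := F) x₀ s x) ↔
      Function.Bijective (Fintype.linearCombination ℂ fun j => s j x) := by
  have frameMap_eq : (frameMap (F := F) x₀ s x : (Fin n → ℂ) → F) =
      (trivializationAt F V x₀).continuousLinearEquivAt ℂ x hx ∘
        Fintype.linearCombination ℂ fun j => s j x :=
    funext (frameMap_apply hx s)
  rw [frameMap_eq]
  exact ((trivializationAt F V x₀).continuousLinearEquivAt ℂ x hx).bijective.of_comp_iff' _

theorem exists_equiv_of_bijective {Λ : (Fin n → ℂ) →L[ℂ] F} (h : Function.Bijective Λ) :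
    ∃ e : (Fin n → ℂ) ≃L[ℂ] F, (e : (Fin n → ℂ) →L[ℂ] F) = Λ :=
  ⟨(LinearEquiv.ofBijective (Λ : (Fin n → ℂ) →ₗ[ℂ] F) h).toContinuousLinearEquiv, by ext; rfl⟩

theorem eventually_bijective_linearCombination [FiniteDimensional ℂ F] {x₀ : B}
    {s : Fin n → ∀ x, V x}
    (hs : ∀ j, ContMDiffAt IB (IB.prod 𝓘(ℂ, F)) ω (fun x => TotalSpace.mk' F x (s j x)) x₀)
    (hb : Function.Bijective (Fintype.linearCombination ℂ fun j => s j x₀)) :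
    ∀ᶠ x in 𝓝 x₀, Function.Bijective (Fintype.linearCombination ℂ fun j => s j x) := by
  obtain ⟨e, he⟩ := exists_equiv_of_bijective ((bijective_frameMap_iff (F := F)
    (mem_baseSet_trivializationAt F V x₀) s).2 hb)
  filter_upwards [(contMDiffAt_frameMap hs).continuousAt.eventually_mem (he ▸ e.nhds),
    (trivializationAt F V x₀).open_baseSet.mem_nhds (mem_baseSet_trivializationAt F V x₀)]
    with x ⟨e', he'⟩ hx
  refine (bijective_frameMap_iff hx s).1 ?_
  rw [← he']
  exact e'.bijective

theorem contMDiffAt_of_linearCombination_eq [FiniteDimensional ℂ F] {x₀ : B} {s : Fin n → ∀ x, V x}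
    (hs : ∀ j, ContMDiffAt IB (IB.prod 𝓘(ℂ, F)) ω (fun x => TotalSpace.mk' F x (s j x)) x₀)
    (hb : Function.Bijective (Fintype.linearCombination ℂ fun j => s j x₀)) {u : ∀ x, V x}
    (hu : ContMDiffAt IB (IB.prod 𝓘(ℂ, F)) ω (fun x => TotalSpace.mk' F x (u x)) x₀)
    {c : B → Fin n → ℂ}
    (hc : ∀ᶠ x in 𝓝 x₀, Fintype.linearCombination ℂ (fun j => s j x) (c x) = u x) :
    ContMDiffAt IB 𝓘(ℂ, Fin n → ℂ) ω c x₀ := by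
  obtain ⟨e, he⟩ := exists_equiv_of_bijective ((bijective_frameMap_iff (F := F)
    (mem_baseSet_trivializationAt F V x₀) s).2 hb)
  have hframe := contMDiffAt_frameMap hs
  have hinverse : ContMDiffAt IB 𝓘(ℂ, F →L[ℂ] (Fin n → ℂ)) ω
      (fun x => ContinuousLinearMap.inverse (frameMap (F := F) x₀ s x)) x₀ := by
    refine ContMDiffAt.comp x₀ (g := ContinuousLinearMap.inverse) ?_ hframe
    rw [← he]
    exact (contDiffAt_map_inverse e).contMDiffAt
  refine (hinverse.clm_apply ((contMDiffAt_section x₀).1 hu)).congr_of_eventuallyEq ?_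
  filter_upwards [hframe.continuousAt.eventually_mem (he ▸ e.nhds), hc,
    (trivializationAt F V x₀).open_baseSet.mem_nhds (mem_baseSet_trivializationAt F V x₀)]
    with x ⟨e', he'⟩ hcx hx
  have frameMap_eq := frameMap_apply hx s (c x)
  rw [hcx, ← he'] at frameMap_eq
  rw [← he', ContinuousLinearMap.inverse_equiv]
  exact (e'.symm_apply_eq.2 frameMap_eq.symm).symm

theorem exists_linearCombination_eq [FiniteDimensional ℂ F] {x₀ : B} {s : Fin n → ∀ x, V x}
    (hs : ∀ j, ContMDiffAt IB (IB.prod 𝓘(ℂ, F)) ω (fun x => TotalSpace.mk' F x (s j x)) x₀)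
    (hb : Function.Bijective (Fintype.linearCombination ℂ fun j => s j x₀)) {u : ∀ x, V x}
    (hu : ContMDiffAt IB (IB.prod 𝓘(ℂ, F)) ω (fun x => TotalSpace.mk' F x (u x)) x₀) :
    ∃ c : B → Fin n → ℂ, ContMDiffAt IB 𝓘(ℂ, Fin n → ℂ) ω c x₀ ∧
      ∀ᶠ x in 𝓝 x₀, Fintype.linearCombination ℂ (fun j => s j x) (c x) = u x := by
  have hinv : ∀ᶠ x in 𝓝 x₀, Fintype.linearCombination ℂ (fun j => s j x)
      (Function.invFun (Fintype.linearCombination ℂ fun j => s j x) (u x)) = u x := by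
    filter_upwards [eventually_bijective_linearCombination hs hb] with x hx
    exact Function.invFun_eq (hx.2 (u x))
  exact ⟨_, contMDiffAt_of_linearCombination_eq hs hb hu hinv, hinv⟩

theorem mdifferentiableAt_sum_smul {p : B} {s : Fin n → ∀ x, V x} {f : B → Fin n → ℂ}
    (hf : ∀ j, MDifferentiableAt IB 𝓘(ℂ, ℂ) (fun x => f x j) p)
    (hs : ∀ j, MDifferentiableAt IB (IB.prod 𝓘(ℂ, F)) (fun x => TotalSpace.mk' F x (s j x)) p)
    (S : Finset (Fin n)) : MDifferentiableAt IB (IB.prod 𝓘(ℂ, F))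
      (fun x => TotalSpace.mk' F x (∑ j ∈ S, f x j • s j x)) p :=
  MDifferentiableAt.sum_section fun j _ => (hf j).smul_section (hs j)

theorem IsDerivationAt.apply_sum_smul {p : B} {Δ : (∀ x, V x) → V p} {δ : (B → ℂ) → ℂ}
    (h : IsDerivationAt IB F Δ δ) {s : Fin n → ∀ x, V x} {f : B → Fin n → ℂ}
    (hf : ∀ j, MDifferentiableAt IB 𝓘(ℂ, ℂ) (fun x => f x j) p)
    (hs : ∀ j, MDifferentiableAt IB (IB.prod 𝓘(ℂ, F)) (fun x => TotalSpace.mk' F x (s j x)) p)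
    (S : Finset (Fin n)) :
    Δ (fun x => ∑ j ∈ S, f x j • s j x) =
      ∑ j ∈ S, (δ (fun x => f x j) • s j p + f p j • Δ (s j)) := by
  induction S using Finset.induction_on with
  | empty =>
    have add_zero_zero :=
      h.add 0 0 (mdifferentiableAt_zeroSection ..) (mdifferentiableAt_zeroSection ..)
    rw [add_zero, left_eq_add] at add_zero_zero
    simp only [Finset.sum_empty]
    exact add_zero_zero
  | insert i S hi ih =>
    simp only [Finset.sum_insert hi]
    rw [← ih, ← h.leibniz (fun x => f x i) (s i) (hf i) (hs i)]
    exact h.add (fun x => f x i • s i x) (fun x => ∑ j ∈ S, f x j • s j x)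
      ((hf i).smul_section (hs i)) (mdifferentiableAt_sum_smul hf hs S)

theorem IsDerivationAt.apply_eq_sum {p : B} {Δ : (∀ x, V x) → V p} {δ : (B → ℂ) → ℂ}
    (h : IsDerivationAt IB F Δ δ) {s : Fin n → ∀ x, V x} {f : B → Fin n → ℂ}
    (hf : ∀ j, MDifferentiableAt IB 𝓘(ℂ, ℂ) (fun x => f x j) p)
    (hs : ∀ j, MDifferentiableAt IB (IB.prod 𝓘(ℂ, F)) (fun x => TotalSpace.mk' F x (s j x)) p)
    {u : ∀ x, V x}
    (hu : MDifferentiableAt IB (IB.prod 𝓘(ℂ, F)) (fun x => TotalSpace.mk' F x (u x)) p)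
    (heq : ∀ᶠ x in 𝓝 p, Fintype.linearCombination ℂ (fun j => s j x) (f x) = u x) :
    Δ u = ∑ j, (δ (fun x => f x j) • s j p + f p j • Δ (s j)) := by
  rw [← h.apply_sum_smul hf hs]
  refine h.congr hu (mdifferentiableAt_sum_smul hf hs _) (heq.mono fun x hx => ?_)
  rw [← hx, Fintype.linearCombination_apply]

end Frame

section CyclicVector

variable {ι R W : Type*} [Fintype ι] [CommRing R] [AddCommGroup W] [Module R W]

theorem linearCombination_mulVec (w : ι → W) (A : Matrix ι ι R) (c : ι → R) :
    Fintype.linearCombination R w (A *ᵥ c) =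
      ∑ j, c j • Fintype.linearCombination R w (fun k => A k j) := by
  simp only [Fintype.linearCombination_apply, mulVec, dotProduct, Finset.sum_smul,
    Finset.smul_sum, smul_smul]
  rw [Finset.sum_comm]
  exact Finset.sum_congr rfl fun j _ => Finset.sum_congr rfl fun k _ => by rw [mul_comm]

theorem map_linearCombination_eq_mulVec {w : ι → W} {L : W →ₗ[R] W} {A : Matrix ι ι R}
    (hL : ∀ j, Fintype.linearCombination R w (fun k => A k j) = L (w j)) (c : ι → R) :
    L (Fintype.linearCombination R w c) = Fintype.linearCombination R w (A *ᵥ c) := by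
  simp only [linearCombination_mulVec, hL, Fintype.linearCombination_apply R w c, map_sum,
    map_smul]

theorem sum_add_smul_linearCombination (w : ι → W) (b c : ι → R) (Γ : Matrix ι ι R) :
    ∑ j, (b j • w j + c j • Fintype.linearCombination R w (fun m => Γ m j)) =
      Fintype.linearCombination R w (b + Γ *ᵥ c) := by
  rw [map_add, linearCombination_mulVec, Fintype.linearCombination_apply, Finset.sum_add_distrib]

variable [DecidableEq ι]

theorem ext_of_linearCombination_mulVec {w : ι → W}
    (hw : Function.Injective (Fintype.linearCombination R w)) {A B : Matrix ι ι R}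
    (h : ∀ j, Fintype.linearCombination R w (A *ᵥ Pi.single j 1) =
      Fintype.linearCombination R w (B *ᵥ Pi.single j 1)) : A = B :=
  Matrix.ext_of_mulVec_single fun j => hw (h j)

-- If commuting operators `A i` have a cyclic vector `z`, then `A i z ↦ A i` identifies the module
-- with a commutative algebra of operators, in which `z` is the unit.
theorem isAlgebraTable_of_cyclic {A : ι → W →ₗ[R] W} (hA : ∀ i j, A i ∘ₗ A j = A j ∘ₗ A i) {z : W}
    (hinj : Function.Injective (Fintype.linearCombination R fun j => A j z))
    {a : ι → Matrix ι ι R} {e : ι → R}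
    (ha : ∀ i j, Fintype.linearCombination R (fun k => A k z) (fun k => a i k j) = A i (A j z))
    (he : Fintype.linearCombination R (fun k => A k z) e = z) : IsAlgebraTable a e := by
  set γ := Fintype.linearCombination R fun k => A k z with γ_def
  have hcomm : ∀ i j w, A i (A j w) = A j (A i w) := fun i j w => LinearMap.congr_fun (hA i j) w
  have map_γ : ∀ i c, A i (γ c) = γ (a i *ᵥ c) := fun i =>
    map_linearCombination_eq_mulVec (ha i)
  have γ_single : ∀ j, γ (Pi.single j 1) = A j z := fun j => by
    rw [γ_def, Fintype.linearCombination_apply_single, one_smul]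
  have γ_sum_mulVec : ∀ (c : ι → R) l, γ ((∑ k, c k • a k) *ᵥ Pi.single l 1) = A l (γ c) :=
    fun c l => by
      rw [sum_mulVec, map_sum, γ_def, Fintype.linearCombination_apply R _ c, map_sum]
      refine Finset.sum_congr rfl fun k _ => ?_
      rw [smul_mulVec, map_smul, map_smul, ← γ_def, ← map_γ, γ_single, hcomm]
  refine ⟨fun i j => ext_of_linearCombination_mulVec hinj fun l => ?_,
    ext_of_linearCombination_mulVec hinj fun l => ?_, fun i j k => ?_⟩
  · rw [← γ_def, γ_sum_mulVec, ha, ← mulVec_mulVec, ← map_γ, ← map_γ, γ_single, hcomm l i,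
      hcomm l j]
  · rw [← γ_def, γ_sum_mulVec, he, one_mulVec, γ_single]
  · have column_eq : (fun k => a i k j) = fun k => a j k i := hinj (by rw [ha, ha, hcomm])
    exact congrFun column_eq k

end CyclicVector

section SpectralCover

variable {n : ℕ} {M : Type*} [TopologicalSpace M] [ChartedSpace (EuclideanSpace ℂ (Fin n)) M]
  {φ : OpenPartialHomeomorph M (EuclideanSpace ℂ (Fin n))}

/-- The matrix of the multiplication with `∂ᵢ` in a chart. -/
noncomputable def chartMul (mul : ∀ x : M, TangentSpace 𝓘(ℂ, EuclideanSpace ℂ (Fin n)) x →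
      TangentSpace 𝓘(ℂ, EuclideanSpace ℂ (Fin n)) x →
      TangentSpace 𝓘(ℂ, EuclideanSpace ℂ (Fin n)) x)
    (φ : OpenPartialHomeomorph M (EuclideanSpace ℂ (Fin n))) (i : Fin n)
    (t : EuclideanSpace ℂ (Fin n)) : Matrix (Fin n) (Fin n) ℂ :=
  Matrix.of fun k j => component φ k (mul (φ.symm t) (coordField φ i t) (coordField φ j t))

/-- The components of the unit field in a chart. -/
noncomputable def chartUnit (e : ∀ x : M, TangentSpace 𝓘(ℂ, EuclideanSpace ℂ (Fin n)) x)
    (φ : OpenPartialHomeomorph M (EuclideanSpace ℂ (Fin n))) (t : EuclideanSpace ℂ (Fin n)) :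
    Fin n → ℂ :=
  fun k => component φ k (e (φ.symm t))

theorem spectrumSet_eq_charSet (mul : ∀ x : M, TangentSpace 𝓘(ℂ, EuclideanSpace ℂ (Fin n)) x →
      TangentSpace 𝓘(ℂ, EuclideanSpace ℂ (Fin n)) x →
      TangentSpace 𝓘(ℂ, EuclideanSpace ℂ (Fin n)) x)
    (e : ∀ x : M, TangentSpace 𝓘(ℂ, EuclideanSpace ℂ (Fin n)) x) :
    spectrumSet mul e φ = charSet φ.target (chartMul mul φ) (chartUnit e φ) := by
  ext q
  exact and_congr_right fun _ => and_congr sub_eq_zero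
    (forall_congr' fun i => forall_congr' fun j => sub_eq_zero)

theorem radicalPoissonClosed_and_lagrangian
    {mul : ∀ x : M, TangentSpace 𝓘(ℂ, EuclideanSpace ℂ (Fin n)) x →
      TangentSpace 𝓘(ℂ, EuclideanSpace ℂ (Fin n)) x →
      TangentSpace 𝓘(ℂ, EuclideanSpace ℂ (Fin n)) x}
    {e : ∀ x : M, TangentSpace 𝓘(ℂ, EuclideanSpace ℂ (Fin n)) x}
    (h : ∀ φ ∈ IsManifold.maximalAtlas 𝓘(ℂ, EuclideanSpace ℂ (Fin n)) ω M,
      IsAlgebraFamily φ.target (chartMul mul φ) (chartUnit e φ) ∧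
      ∀ t ∈ φ.target, IsPotentialAt (chartMul mul φ) t) :
    RadicalPoissonClosed mul e ∧ ReducedSpectrumLagrangian mul e := by
  refine ⟨fun φ hφ q hq f hf g hg => ?_, fun φ hφ q T hT => ?_⟩
  · exact (h φ hφ).1.poisson_mem_radical (h φ hφ).2 hq hf hg
  · rw [spectrumSet_eq_charSet] at hT
    exact (h φ hφ).1.isLagrangian (h φ hφ).2 hT

variable {K : M → Type*} [∀ x, AddCommGroup (K x)] [∀ x, Module ℂ (K x)]
  {C : ∀ x : M, TangentSpace 𝓘(ℂ, EuclideanSpace ℂ (Fin n)) x →ₗ[ℂ] K x →ₗ[ℂ] K x} {ζ : ∀ x, K x}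

theorem higgs_inducedMul (hζ : IsPrimitive C ζ) (x : M)
    (X Y : TangentSpace 𝓘(ℂ, EuclideanSpace ℂ (Fin n)) x) :
    C x (inducedMul hζ x X Y) (ζ x) = C x X (C x Y (ζ x)) :=
  (LinearEquiv.ofBijective _ (hζ x)).apply_symm_apply _

theorem higgs_inducedUnit (hζ : IsPrimitive C ζ) (x : M) :
    C x (inducedUnit hζ x) (ζ x) = ζ x :=
  (LinearEquiv.ofBijective _ (hζ x)).apply_symm_apply _

theorem linearCombination_component
    (hφ : φ ∈ IsManifold.maximalAtlas 𝓘(ℂ, EuclideanSpace ℂ (Fin n)) ω M) {x : M}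
    (hx : x ∈ φ.source) (X : TangentSpace 𝓘(ℂ, EuclideanSpace ℂ (Fin n)) x) (w : K x) :
    Fintype.linearCombination ℂ (fun k => C x (chartField φ k x) w) (fun k => component φ k X) =
      C x X w := by
  conv_rhs => rw [eq_sum_component hφ hx X]
  rw [Fintype.linearCombination_apply, map_sum, LinearMap.sum_apply]
  exact Finset.sum_congr rfl fun k _ => by rw [map_smul, LinearMap.smul_apply]

theorem linearIndependent_chartField
    (hφ : φ ∈ IsManifold.maximalAtlas 𝓘(ℂ, EuclideanSpace ℂ (Fin n)) ω M) {x : M}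
    (hx : x ∈ φ.source) : LinearIndependent ℂ fun k => chartField φ k x := by
  refine LinearIndependent.of_comp (mvfderiv 𝓘(ℂ, EuclideanSpace ℂ (Fin n)) φ x).toLinearMap ?_
  have comp_eq : (mvfderiv 𝓘(ℂ, EuclideanSpace ℂ (Fin n)) φ x).toLinearMap ∘
      (fun k => chartField φ k x) = (EuclideanSpace.basisFun (Fin n) ℂ).toBasis := by
    funext k
    rw [OrthonormalBasis.coe_toBasis, EuclideanSpace.basisFun_apply]
    exact congrArg (NormedSpace.fromTangentSpace (𝕜 := ℂ) (φ x)) (mfderiv_chartField hφ hx k)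
  rw [comp_eq]
  exact Module.Basis.linearIndependent _

theorem bijective_linearCombination_higgs (hζ : IsPrimitive C ζ)
    (hφ : φ ∈ IsManifold.maximalAtlas 𝓘(ℂ, EuclideanSpace ℂ (Fin n)) ω M) {x : M}
    (hx : x ∈ φ.source) :
    Function.Bijective (Fintype.linearCombination ℂ fun k => C x (chartField φ k x) (ζ x)) := by
  refine ⟨?_, fun w => ?_⟩
  · refine linearIndependent_iff_injective_fintypeLinearCombination.1 ?_
    exact (linearIndependent_chartField hφ hx).map' ((C x).flip (ζ x))
      (LinearMap.ker_eq_bot.2 (hζ x).1)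
  · obtain ⟨X, rfl⟩ := (hζ x).2 w
    exact ⟨fun k => component φ k X, linearCombination_component hφ hx X (ζ x)⟩

theorem linearCombination_chartMul (hζ : IsPrimitive C ζ)
    (hφ : φ ∈ IsManifold.maximalAtlas 𝓘(ℂ, EuclideanSpace ℂ (Fin n)) ω M) {x : M}
    (hx : x ∈ φ.source) (i j : Fin n) :
    Fintype.linearCombination ℂ (fun k => C x (chartField φ k x) (ζ x))
      (fun k => chartMul (inducedMul hζ) φ i (φ x) k j) =
        C x (chartField φ i x) (C x (chartField φ j x) (ζ x)) := by
  have column_eq : (fun k => chartMul (inducedMul hζ) φ i (φ x) k j) =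
      fun k => component φ k (inducedMul hζ x (chartField φ i x) (chartField φ j x)) := by
    funext k
    rw [chartMul, Matrix.of_apply, coordField_eq_chartField hφ (φ.map_source hx),
      coordField_eq_chartField hφ (φ.map_source hx), φ.left_inv hx]
  rw [column_eq, linearCombination_component hφ hx, higgs_inducedMul]

theorem linearCombination_chartUnit (hζ : IsPrimitive C ζ)
    (hφ : φ ∈ IsManifold.maximalAtlas 𝓘(ℂ, EuclideanSpace ℂ (Fin n)) ω M) {x : M}
    (hx : x ∈ φ.source) :
    Fintype.linearCombination ℂ (fun k => C x (chartField φ k x) (ζ x))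
      (chartUnit (inducedUnit hζ) φ (φ x)) = ζ x := by
  have chartUnit_eq : chartUnit (inducedUnit hζ) φ (φ x) =
      fun k => component φ k (inducedUnit hζ x) := by
    funext k
    rw [chartUnit, φ.left_inv hx]
  rw [chartUnit_eq, linearCombination_component hφ hx, higgs_inducedUnit]

theorem higgs_linearCombination (hζ : IsPrimitive C ζ)
    (hφ : φ ∈ IsManifold.maximalAtlas 𝓘(ℂ, EuclideanSpace ℂ (Fin n)) ω M) {x : M}
    (hx : x ∈ φ.source) (i : Fin n) (c : Fin n → ℂ) :
    C x (chartField φ i x) (Fintype.linearCombination ℂ (fun k => C x (chartField φ k x) (ζ x)) c) =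
      Fintype.linearCombination ℂ (fun k => C x (chartField φ k x) (ζ x))
        (chartMul (inducedMul hζ) φ i (φ x) *ᵥ c) :=
  map_linearCombination_eq_mulVec (linearCombination_chartMul hζ hφ hx i) c

theorem isAlgebraTable_chart (hζ : IsPrimitive C ζ)
    (hφ : φ ∈ IsManifold.maximalAtlas 𝓘(ℂ, EuclideanSpace ℂ (Fin n)) ω M) {x : M}
    (hx : x ∈ φ.source) (hC : ∀ i j, C x (chartField φ i x) ∘ₗ C x (chartField φ j x) =
      C x (chartField φ j x) ∘ₗ C x (chartField φ i x)) :
    IsAlgebraTable (fun i => chartMul (inducedMul hζ) φ i (φ x))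
      (chartUnit (inducedUnit hζ) φ (φ x)) :=
  isAlgebraTable_of_cyclic hC (bijective_linearCombination_higgs hζ hφ hx).1
    (linearCombination_chartMul hζ hφ hx) (linearCombination_chartUnit hζ hφ hx)

end SpectralCover

section GoodConnection

theorem isDerivationAt_covariantDerivative {EB HB B : Type*} [NormedAddCommGroup EB]
    [NormedSpace ℂ EB] [TopologicalSpace HB] {IB : ModelWithCorners ℂ EB HB} [TopologicalSpace B]
    [ChartedSpace HB B] {F : Type*} [NormedAddCommGroup F] [NormedSpace ℂ F] {V : B → Type*}
    [TopologicalSpace (TotalSpace F V)] [∀ x, AddCommGroup (V x)] [∀ x, Module ℂ (V x)]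
    [∀ x, TopologicalSpace (V x)] [FiberBundle F V] [∀ x, IsTopologicalAddGroup (V x)]
    [∀ x, ContinuousSMul ℂ (V x)] (D : CovariantDerivative IB F V) (x : B)
    (X : TangentSpace IB x) :
    IsDerivationAt IB F (fun σ => D σ x X) (fun g => mvfderiv IB g x X) where
  add σ σ' hσ hσ' := by
    rw [D.isCovariantDerivativeOnUniv.add hσ hσ']
    rfl
  leibniz g σ hg hσ := by
    rw [D.isCovariantDerivativeOnUniv.leibniz hσ hg, add_comm]
    rfl
  eq_zero g hg := by
    have hasMFDerivAt_zero : HasMFDerivAt IB 𝓘(ℂ, ℂ) g x 0 :=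
      (hasMFDerivAt_const (1 : ℂ) x).congr_of_eventuallyEq hg
    simp [mvfderiv, hasMFDerivAt_zero.mfderiv]

variable {n : ℕ} {M : Type*} [TopologicalSpace M] [ChartedSpace (EuclideanSpace ℂ (Fin n)) M]
  {φ : OpenPartialHomeomorph M (EuclideanSpace ℂ (Fin n))}
  {F : Type*} [NormedAddCommGroup F] [NormedSpace ℂ F]
  {K : M → Type*} [TopologicalSpace (TotalSpace F K)]
  [∀ x, AddCommGroup (K x)] [∀ x, Module ℂ (K x)] [∀ x, TopologicalSpace (K x)] [FiberBundle F K]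
  [IsManifold 𝓘(ℂ, EuclideanSpace ℂ (Fin n)) ω M]
  {C : ∀ x : M, TangentSpace 𝓘(ℂ, EuclideanSpace ℂ (Fin n)) x →ₗ[ℂ] K x →ₗ[ℂ] K x}
  {ζ : ∀ x, K x}

theorem IsHiggsField.holSectionAt_frame (hC : IsHiggsField F C)
    (hζh : ∀ x, HolSectionAt n F ζ x)
    (hφ : φ ∈ IsManifold.maximalAtlas 𝓘(ℂ, EuclideanSpace ℂ (Fin n)) ω M) {x : M}
    (hx : x ∈ φ.source) (j : Fin n) :
    HolSectionAt n F (fun y => C y (chartField φ j y) (ζ y)) x :=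
  hC.holomorphic _ _ x (holVectorFieldAt_chartField hφ hx j) (hζh x)

variable [VectorBundle ℂ F K] [FiniteDimensional ℂ F]

theorem IsHiggsField.isAlgebraFamily (hC : IsHiggsField F C) (hζh : ∀ x, HolSectionAt n F ζ x)
    (hζ : IsPrimitive C ζ)
    (hφ : φ ∈ IsManifold.maximalAtlas 𝓘(ℂ, EuclideanSpace ℂ (Fin n)) ω M) :
    IsAlgebraFamily φ.target (chartMul (inducedMul hζ) φ) (chartUnit (inducedUnit hζ) φ) := by
  have analyticAt_coefficients : ∀ t ∈ φ.target, ∀ (u : ∀ x, K x) (c : _ → Fin n → ℂ),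
      HolSectionAt n F u (φ.symm t) →
      (∀ x ∈ φ.source, Fintype.linearCombination ℂ (fun k => C x (chartField φ k x) (ζ x))
        (c (φ x)) = u x) → ∀ k, AnalyticAt ℂ (fun s => c s k) t := by
    intro t ht u c hu hcu
    have hx := φ.map_target ht
    have holomorphic_coefficients := contMDiffAt_of_linearCombination_eq
      (hC.holSectionAt_frame hζh hφ hx) (bijective_linearCombination_higgs hζ hφ hx) hu
      (c := fun y => c (φ y)) (by
        filter_upwards [φ.open_source.mem_nhds hx] with y hy
        exact hcu y hy)
    refine analyticAt_pi_iff.1 ?_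
    rw [← φ.right_inv ht]
    exact analyticAt_of_comp_chart hφ hx holomorphic_coefficients
  refine ⟨φ.open_target, fun i k j t ht => ?_, fun k t ht => ?_, fun t ht => ?_⟩
  · have hx := φ.map_target ht
    exact analyticAt_coefficients t ht _
      (fun s k => chartMul (inducedMul hζ) φ i s k j)
      (hC.holomorphic _ _ _ (holVectorFieldAt_chartField hφ hx i)
        (hC.holSectionAt_frame hζh hφ hx j))
      (fun x hx => linearCombination_chartMul hζ hφ hx i j) k
  · exact analyticAt_coefficients t ht ζ _ (hζh _)
      (fun x hx => linearCombination_chartUnit hζ hφ hx) k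
  · have table := isAlgebraTable_chart hζ hφ (φ.map_target ht) fun i j => hC.comm _ _ _
    rwa [φ.right_inv ht] at table

variable [∀ x, IsTopologicalAddGroup (K x)] [∀ x, ContinuousSMul ℂ (K x)]

theorem IsHiggsField.covariantDerivative_higgs (hC : IsHiggsField F C)
    (D : CovariantDerivative 𝓘(ℂ, EuclideanSpace ℂ (Fin n)) F K)
    (hζh : ∀ x, HolSectionAt n F ζ x) (hζ : IsPrimitive C ζ)
    (hφ : φ ∈ IsManifold.maximalAtlas 𝓘(ℂ, EuclideanSpace ℂ (Fin n)) ω M) {x : M}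
    (hx : x ∈ φ.source) {k : Fin n} {Γ : Matrix (Fin n) (Fin n) ℂ}
    (hΓ : ∀ j, Fintype.linearCombination ℂ (fun m => C x (chartField φ m x) (ζ x))
      (fun m => Γ m j) = D (fun y => C y (chartField φ j y) (ζ y)) x (chartField φ k x))
    (l j : Fin n) :
    D (fun y => C y (chartField φ l y) (C y (chartField φ j y) (ζ y))) x (chartField φ k x) =
      Fintype.linearCombination ℂ (fun m => C x (chartField φ m x) (ζ x))
        ((matrixDeriv k (chartMul (inducedMul hζ) φ l) (φ x) +
          Γ * chartMul (inducedMul hζ) φ l (φ x)) *ᵥ Pi.single j 1) := by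
  have frame := hC.holSectionAt_frame hζh hφ hx
  have hdiff : ∀ m, DifferentiableAt ℂ (fun t => chartMul (inducedMul hζ) φ l t m j) (φ x) :=
    fun m => ((hC.isAlgebraFamily hζh hζ hφ).analyticAt l m j _
      (φ.map_source hx)).differentiableAt
  rw [(isDerivationAt_covariantDerivative D x (chartField φ k x)).apply_eq_sum
    (f := fun y m => chartMul (inducedMul hζ) φ l (φ y) m j)
    (fun m => (hdiff m).comp_mdifferentiableAt
      ((contMDiffAt_chart hφ hx).mdifferentiableAt (by simp)))
    (fun m => (frame m).mdifferentiableAt (by simp))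
    ((hC.holomorphic _ _ x (holVectorFieldAt_chartField hφ hx l) (frame j)).mdifferentiableAt
      (by simp))
    (by
      filter_upwards [φ.open_source.mem_nhds hx] with y hy
      exact linearCombination_chartMul hζ hφ hy l j)]
  simp only [← hΓ, mvfderiv_comp_chart hφ hx (hdiff _)]
  rw [sum_add_smul_linearCombination, add_mulVec, ← mulVec_mulVec, mulVec_single_one,
    mulVec_single_one]
  rfl

theorem IsHiggsField.isPotentialAt (hC : IsHiggsField F C)
    {D : CovariantDerivative 𝓘(ℂ, EuclideanSpace ℂ (Fin n)) F K} (hD : IsPotential F C D)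
    (hζh : ∀ x, HolSectionAt n F ζ x) (hζ : IsPrimitive C ζ)
    (hφ : φ ∈ IsManifold.maximalAtlas 𝓘(ℂ, EuclideanSpace ℂ (Fin n)) ω M)
    {t : EuclideanSpace ℂ (Fin n)} (ht : t ∈ φ.target) :
    IsPotentialAt (chartMul (inducedMul hζ) φ) t := by
  obtain ⟨x, hx, rfl⟩ : ∃ x ∈ φ.source, φ x = t := ⟨_, φ.map_target ht, φ.right_inv ht⟩
  have frame_bijective := bijective_linearCombination_higgs hζ hφ hx
  obtain ⟨Γ, hΓ⟩ : ∃ Γ : Fin n → Matrix (Fin n) (Fin n) ℂ, ∀ k j,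
      Fintype.linearCombination ℂ (fun m => C x (chartField φ m x) (ζ x)) (fun m => Γ k m j) =
        D (fun y => C y (chartField φ j y) (ζ y)) x (chartField φ k x) := by
    choose Γ hΓ using fun k j => frame_bijective.2
      (D (fun y => C y (chartField φ j y) (ζ y)) x (chartField φ k x))
    exact ⟨fun k => Matrix.of fun m j => Γ k j m, hΓ⟩
  refine ⟨Γ, fun k l => ext_of_linearCombination_mulVec frame_bijective.1 fun j => ?_⟩
  have higgs_covariantDerivative : ∀ k l,
      C x (chartField φ l x) (D (fun y => C y (chartField φ j y) (ζ y)) x (chartField φ k x)) =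
        Fintype.linearCombination ℂ (fun m => C x (chartField φ m x) (ζ x))
          ((chartMul (inducedMul hζ) φ l (φ x) * Γ k) *ᵥ Pi.single j 1) := fun k l => by
    rw [← hΓ, higgs_linearCombination hζ hφ hx, ← mulVec_mulVec, mulVec_single_one]
    rfl
  have potential := hD (chartField φ k) (chartField φ l)
    (fun y => C y (chartField φ j y) (ζ y)) x (holVectorFieldAt_chartField hφ hx k)
    (holVectorFieldAt_chartField hφ hx l) (hC.holSectionAt_frame hζh hφ hx j)
  rw [mlieBracket_chartField hφ hx, map_zero, LinearMap.zero_apply, sub_eq_zero,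
    hC.covariantDerivative_higgs D hζh hζ hφ hx (hΓ k),
    hC.covariantDerivative_higgs D hζh hζ hφ hx (hΓ l), higgs_covariantDerivative,
    higgs_covariantDerivative] at potential
  simpa only [← map_sub, ← sub_mulVec] using potential

end GoodConnection

section RelativeFlatness

theorem analyticAt_fderiv_prodMk {E E' G : Type*} [NormedAddCommGroup E] [NormedSpace ℂ E]
    [NormedAddCommGroup E'] [NormedSpace ℂ E'] [NormedAddCommGroup G] [NormedSpace ℂ G]
    [CompleteSpace G] {f : E × E' → G} {z₀ : E} {t₀ : E'} (hf : AnalyticAt ℂ f (z₀, t₀)) (v : E') :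
    AnalyticAt ℂ (fun z => fderiv ℂ (fun t => f (z, t)) t₀ v) z₀ := by
  have hslice : AnalyticAt ℂ (fun z : E => (z, t₀)) z₀ := analyticAt_id.prod analyticAt_const
  have htotal : AnalyticAt ℂ (fun z => fderiv ℂ f (z, t₀) (0, v)) z₀ :=
    ((ContinuousLinearMap.apply ℂ G ((0, v) : E × E')).analyticAt _).comp
      (hf.fderiv.comp (f := fun z : E => (z, t₀)) hslice)
  refine htotal.congr ?_
  filter_upwards [hslice.continuousAt.eventually hf.eventually_analyticAt] with z hz
  have hpartial : HasFDerivAt (fun t => f (z, t)) _ t₀ :=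
    hz.differentiableAt.hasFDerivAt.comp t₀
      ((hasFDerivAt_const z t₀).prodMk (hasFDerivAt_id t₀))
  rw [hpartial.fderiv]
  rfl

theorem hasDerivAt_mul_apply {ι 𝕜 : Type*} [Fintype ι] [NontriviallyNormedField 𝕜]
    {A B : 𝕜 → Matrix ι ι 𝕜} {A' B' : Matrix ι ι 𝕜} {z : 𝕜}
    (hA : ∀ i j, HasDerivAt (fun z => A z i j) (A' i j) z)
    (hB : ∀ i j, HasDerivAt (fun z => B z i j) (B' i j) z) (i j : ι) :
    HasDerivAt (fun z => (A z * B z) i j) ((A' * B z + A z * B') i j) z := by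
  simp only [Matrix.add_apply, Matrix.mul_apply, ← Finset.sum_add_distrib]
  exact HasDerivAt.fun_sum fun m _ => (hA i m).mul (hB m j)

variable {n : ℕ} {b : Fin n → ℂ × EuclideanSpace ℂ (Fin n) → Matrix (Fin n) (Fin n) ℂ}
  {t₀ : EuclideanSpace ℂ (Fin n)}

/-- Flatness at `w = (z, t)` of the relative connection `∂ₖ + z⁻¹ bₖ`, multiplied by `z²` so that
it makes sense along `z = 0`. -/
def IsFlatAt (b : Fin n → ℂ × EuclideanSpace ℂ (Fin n) → Matrix (Fin n) (Fin n) ℂ)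
    (w : ℂ × EuclideanSpace ℂ (Fin n)) : Prop :=
  ∀ k l, w.1 • matrixDeriv k (fun t => b l (w.1, t)) w.2 + b k w * b l w =
    w.1 • matrixDeriv l (fun t => b k (w.1, t)) w.2 + b l w * b k w

theorem analyticAt_slice_apply (hb : ∀ k i j, AnalyticAt ℂ (fun w => b k w i j) (0, t₀))
    (k i j : Fin n) : AnalyticAt ℂ (fun z => b k (z, t₀) i j) 0 :=
  (hb k i j).comp (f := fun z : ℂ => (z, t₀)) (analyticAt_id.prod analyticAt_const)

theorem eventually_commutator_eq (hb : ∀ k i j, AnalyticAt ℂ (fun w => b k w i j) (0, t₀))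
    (hflat : ∀ᶠ w in 𝓝 (0, t₀), w.1 ≠ 0 → IsFlatAt b w) (k l i j : Fin n) :
    (fun z => (b k (z, t₀) * b l (z, t₀) - b l (z, t₀) * b k (z, t₀)) i j) =ᶠ[𝓝 0] fun z =>
      z * (matrixDeriv l (fun t => b k (z, t)) t₀ -
        matrixDeriv k (fun t => b l (z, t)) t₀) i j := by
  have hcommutator : ContinuousAt
      (fun z => (b k (z, t₀) * b l (z, t₀) - b l (z, t₀) * b k (z, t₀)) i j) 0 := by
    simp only [Matrix.sub_apply, Matrix.mul_apply]
    have hentry := analyticAt_slice_apply hb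
    exact ((Finset.analyticAt_fun_sum _ fun m _ => (hentry k i m).mul (hentry l m j)).sub
      (Finset.analyticAt_fun_sum _ fun m _ => (hentry l i m).mul (hentry k m j))).continuousAt
  have hcurl : ContinuousAt (fun z => z * (matrixDeriv l (fun t => b k (z, t)) t₀ -
      matrixDeriv k (fun t => b l (z, t)) t₀) i j) 0 :=
    (analyticAt_id.mul ((analyticAt_fderiv_prodMk (hb k i j) _).sub
      (analyticAt_fderiv_prodMk (hb l i j) _))).continuousAt
  refine (ContinuousAt.eventuallyEq_nhds_iff_eventuallyEq_nhdsNE hcommutator hcurl).1 ?_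
  have hslice : ContinuousAt (fun z : ℂ => (z, t₀)) 0 :=
    (Continuous.prodMk_left t₀).continuousAt
  filter_upwards [(hslice.eventually hflat).filter_mono nhdsWithin_le_nhds, self_mem_nhdsWithin]
    with z hz hz₀
  have hentry := congrFun (congrFun (hz hz₀ k l) i) j
  simp only [Matrix.add_apply, Matrix.sub_apply, Matrix.smul_apply, smul_eq_mul] at hentry ⊢
  linear_combination hentry

theorem comm_of_eventually_isFlatAt (hb : ∀ k i j, AnalyticAt ℂ (fun w => b k w i j) (0, t₀))
    (hflat : ∀ᶠ w in 𝓝 (0, t₀), w.1 ≠ 0 → IsFlatAt b w) (k l : Fin n) :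
    b k (0, t₀) * b l (0, t₀) = b l (0, t₀) * b k (0, t₀) := by
  ext i j
  exact sub_eq_zero.1
    ((eventually_commutator_eq hb hflat k l i j).self_of_nhds.trans (zero_mul _))

-- This is the first order term in `z` of the flatness condition, with `Γ = ∂b/∂z` at `z = 0`.
theorem isPotentialAt_of_eventually_isFlatAt
    (hb : ∀ k i j, AnalyticAt ℂ (fun w => b k w i j) (0, t₀))
    (hflat : ∀ᶠ w in 𝓝 (0, t₀), w.1 ≠ 0 → IsFlatAt b w) :
    IsPotentialAt (fun k t => b k (0, t)) t₀ := by
  let Γ : Fin n → Matrix (Fin n) (Fin n) ℂ := fun k =>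
    Matrix.of fun i j => deriv (fun z => b k (z, t₀) i j) 0
  have hasDerivAt_entry : ∀ k i j, HasDerivAt (fun z => b k (z, t₀) i j) (Γ k i j) 0 :=
    fun k i j => (analyticAt_slice_apply hb k i j).differentiableAt.hasDerivAt
  refine ⟨Γ, fun k l => ?_⟩
  ext i j
  have hcurl : DifferentiableAt ℂ (fun z => (matrixDeriv l (fun t => b k (z, t)) t₀ -
      matrixDeriv k (fun t => b l (z, t)) t₀) i j) 0 :=
    ((analyticAt_fderiv_prodMk (hb k i j) _).sub
      (analyticAt_fderiv_prodMk (hb l i j) _)).differentiableAt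
  have derivatives_eq :=
    ((hasDerivAt_mul_apply (hasDerivAt_entry k) (hasDerivAt_entry l) i j).sub
      (hasDerivAt_mul_apply (hasDerivAt_entry l) (hasDerivAt_entry k) i j)).unique
    (((hasDerivAt_id (0 : ℂ)).mul hcurl.hasDerivAt).congr_of_eventuallyEq
      (eventually_commutator_eq hb hflat k l i j))
  simp only [id_eq, one_mul, zero_mul, add_zero, Matrix.add_apply, Matrix.sub_apply]
    at derivatives_eq ⊢
  linear_combination derivatives_eq

end RelativeFlatness

section TStructure

theorem tendsto_prodMk_symm {X Y Z : Type*} [TopologicalSpace X] [TopologicalSpace Y]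
    [TopologicalSpace Z] {φ : OpenPartialHomeomorph X Y} {x : X} (hx : x ∈ φ.source) (z : Z) :
    Tendsto (fun w : Z × Y => (w.1, φ.symm w.2)) (𝓝 (z, φ x)) (𝓝 (z, x)) := by
  have hsymm := (φ.continuousAt_symm (φ.map_source hx)).tendsto
  rw [φ.left_inv hx] at hsymm
  rw [nhds_prod_eq, nhds_prod_eq]
  exact tendsto_id.prodMap hsymm

variable {n : ℕ} {M : Type*} [TopologicalSpace M] [ChartedSpace (EuclideanSpace ℂ (Fin n)) M]
  {φ : OpenPartialHomeomorph M (EuclideanSpace ℂ (Fin n))}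

theorem analyticAt_comp_prodMk_chart_symm {G : Type*} [NormedAddCommGroup G] [NormedSpace ℂ G]
    [CompleteSpace G] (hφ : φ ∈ IsManifold.maximalAtlas 𝓘(ℂ, EuclideanSpace ℂ (Fin n)) ω M)
    {z : ℂ} {x : M} (hx : x ∈ φ.source) {f : ℂ × M → G}
    (hf : ContMDiffAt (𝓘(ℂ, ℂ).prod 𝓘(ℂ, EuclideanSpace ℂ (Fin n))) 𝓘(ℂ, G) ω f (z, x)) :
    AnalyticAt ℂ (fun w : ℂ × EuclideanSpace ℂ (Fin n) => f (w.1, φ.symm w.2)) (z, φ x) := by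
  have hsymm : ContMDiffAt 𝓘(ℂ, ℂ × EuclideanSpace ℂ (Fin n))
      (𝓘(ℂ, ℂ).prod 𝓘(ℂ, EuclideanSpace ℂ (Fin n))) ω
      (fun w : ℂ × EuclideanSpace ℂ (Fin n) => (w.1, φ.symm w.2)) (z, φ x) :=
    ContMDiffAt.prodMk contDiffAt_fst.contMDiffAt
      (ContMDiffAt.comp (g := φ.symm) (f := Prod.snd) (z, φ x)
        (contMDiffAt_chart_symm hφ (φ.map_source hx)) contDiffAt_snd.contMDiffAt)
  refine ContDiffAt.analyticAt
    (contMDiffAt_iff_contDiffAt.1 (ContMDiffAt.comp (g := f) _ ?_ hsymm))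
  rwa [φ.left_inv hx]

theorem mvfderiv_prodMk_chartField
    (hφ : φ ∈ IsManifold.maximalAtlas 𝓘(ℂ, EuclideanSpace ℂ (Fin n)) ω M) {p : ℂ × M}
    (hp : p.2 ∈ φ.source) {g : ℂ × M → ℂ}
    (hg : MDifferentiableAt (𝓘(ℂ, ℂ).prod 𝓘(ℂ, EuclideanSpace ℂ (Fin n))) 𝓘(ℂ, ℂ) g p)
    (k : Fin n) :
    mvfderiv 𝓘(ℂ, EuclideanSpace ℂ (Fin n)) (fun x => g (p.1, x)) p.2 (chartField φ k p.2) =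
      fderiv ℂ (fun t => g (p.1, φ.symm t)) (φ p.2) (EuclideanSpace.single k 1) :=
  mvfderiv_chartField (f := fun x => g (p.1, x)) hφ hp
    (hg.comp (f := fun x => (p.1, x)) p.2
      (mdifferentiableAt_const.prodMk mdifferentiableAt_id)) k

variable {F : Type*} [NormedAddCommGroup F] [NormedSpace ℂ F]
  {H : ℂ × M → Type*} [TopologicalSpace (TotalSpace F H)]
  [∀ p, AddCommGroup (H p)] [∀ p, TopologicalSpace (H p)] [FiberBundle F H]

theorem HolSectionZeroAt.exists_extension {ζ : ∀ x : M, H (0, x)} {x₀ : M}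
    (hζ : HolSectionZeroAt n F ζ x₀) :
    ∃ σ : ∀ p, H p, HolSectionProdAt n F σ (0, x₀) ∧ ∀ᶠ x in 𝓝 x₀, σ (0, x) = ζ x := by
  let e := trivializationAt F H (0, x₀)
  have hx₀ : ((0, x₀) : ℂ × M) ∈ e.baseSet := mem_baseSet_trivializationAt F H (0, x₀)
  refine ⟨fun p => e.symm p (e ⟨(0, p.2), ζ p.2⟩).2, ?_, ?_⟩
  · have holomorphic_fiber : ContMDiffAt (𝓘(ℂ, ℂ).prod 𝓘(ℂ, EuclideanSpace ℂ (Fin n))) 𝓘(ℂ, F) ω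
        (fun p : ℂ × M => (e ⟨(0, p.2), ζ p.2⟩).2) (0, x₀) :=
      ContMDiffAt.comp (g := fun y => (e ⟨(0, y), ζ y⟩).2) (f := Prod.snd) (0, x₀)
        (contMDiffAt_totalSpace.1 hζ).2 contMDiffAt_snd
    refine (contMDiffAt_section _).2 (holomorphic_fiber.congr_of_eventuallyEq ?_)
    filter_upwards [e.open_baseSet.mem_nhds hx₀] with p hp
    exact (congrArg Prod.snd (e.apply_mk_symm hp (e ⟨(0, p.2), ζ p.2⟩).2) :)
  · filter_upwards [(Continuous.prodMk_right (0 : ℂ)).continuousAt.eventually_mem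
      (e.open_baseSet.mem_nhds hx₀)] with x hx
    exact e.symm_apply_apply_mk hx _

variable [∀ p, Module ℂ (H p)] [IsManifold 𝓘(ℂ, EuclideanSpace ℂ (Fin n)) ω M]
  [∀ p, IsTopologicalAddGroup (H p)] [∀ p, ContinuousSMul ℂ (H p)] {S : TStructure n F H}

theorem TStructure.isDerivationAt (S : TStructure n F H) (p : ℂ × M)
    (X : TangentSpace 𝓘(ℂ, EuclideanSpace ℂ (Fin n)) p.2) :
    IsDerivationAt (𝓘(ℂ, ℂ).prod 𝓘(ℂ, EuclideanSpace ℂ (Fin n))) F (fun σ => S.zNabla σ p X)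
      (fun g => p.1 * mvfderiv 𝓘(ℂ, EuclideanSpace ℂ (Fin n)) (fun x => g (p.1, x)) p.2 X) where
  add σ σ' hσ hσ' := by
    rw [S.add σ σ' p hσ hσ']
    rfl
  leibniz g σ hg hσ := S.leibniz g σ p X hg hσ
  eq_zero g hg := by
    have hasMFDerivAt_zero : HasMFDerivAt 𝓘(ℂ, EuclideanSpace ℂ (Fin n)) 𝓘(ℂ, ℂ)
        (fun x => g (p.1, x)) p.2 0 :=
      (hasMFDerivAt_const (1 : ℂ) p.2).congr_of_eventuallyEq
        ((Continuous.prodMk_right p.1).continuousAt.eventually hg)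
    simp [mvfderiv, hasMFDerivAt_zero.mfderiv]

theorem TStructure.zNabla_inv_smul [VectorBundle ℂ F H] (S : TStructure n F H) {p : ℂ × M}
    (hp : p.1 ≠ 0) {u : ∀ p, H p}
    (hu : MDifferentiableAt (𝓘(ℂ, ℂ).prod 𝓘(ℂ, EuclideanSpace ℂ (Fin n)))
      ((𝓘(ℂ, ℂ).prod 𝓘(ℂ, EuclideanSpace ℂ (Fin n))).prod 𝓘(ℂ, F))
      (fun q => TotalSpace.mk' F q (u q)) p)
    (X : TangentSpace 𝓘(ℂ, EuclideanSpace ℂ (Fin n)) p.2) :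
    S.zNabla (fun q => q.1⁻¹ • u q) p X = p.1⁻¹ • S.zNabla u p X := by
  have hinv : MDifferentiableAt (𝓘(ℂ, ℂ).prod 𝓘(ℂ, EuclideanSpace ℂ (Fin n))) 𝓘(ℂ, ℂ)
      (fun q : ℂ × M => q.1⁻¹) p :=
    DifferentiableAt.comp_mdifferentiableAt (g := fun z : ℂ => z⁻¹) (f := Prod.fst)
      (differentiableAt_inv hp) mdifferentiableAt_fst
  refine (S.leibniz (fun q => q.1⁻¹) u p X hinv hu).trans ?_
  simp [mvfderiv]

theorem TStructure.zNabla_comm [VectorBundle ℂ F H] (S : TStructure n F H) {p : ℂ × M}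
    (hp : p.1 ≠ 0) {X Y : ∀ x : M, TangentSpace 𝓘(ℂ, EuclideanSpace ℂ (Fin n)) x}
    (hX : HolVectorFieldAt n X p.2) (hY : HolVectorFieldAt n Y p.2)
    (hXY : VectorField.mlieBracket 𝓘(ℂ, EuclideanSpace ℂ (Fin n)) X Y p.2 = 0) {s : ∀ p, H p}
    (hs : HolSectionProdAt n F s p) :
    S.zNabla (fun q => S.zNabla s q (Y q.2)) p (X p.2) =
      S.zNabla (fun q => S.zNabla s q (X q.2)) p (Y p.2) := by
  have flat := S.flat X Y s p hp hX hY hs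
  rw [hXY, map_zero, smul_zero, sub_eq_zero,
    S.zNabla_inv_smul hp ((S.holomorphic Y s p hY hs).mdifferentiableAt (by simp)),
    S.zNabla_inv_smul hp ((S.holomorphic X s p hX hs).mdifferentiableAt (by simp))] at flat
  exact smul_right_injective _ (inv_ne_zero hp) (smul_right_injective _ (inv_ne_zero hp) flat)

theorem TStructure.higgs_apply [VectorBundle ℂ F H] [FiniteDimensional ℂ F]
    [ContMDiffVectorBundle ω F H (𝓘(ℂ, ℂ).prod 𝓘(ℂ, EuclideanSpace ℂ (Fin n)))]
    (S : TStructure n F H) (x : M) (X : TangentSpace 𝓘(ℂ, EuclideanSpace ℂ (Fin n)) x)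
    {σ : ∀ p, H p} (hσ : HolSectionProdAt n F σ (0, x)) :
    S.higgs x X (σ (0, x)) = S.zNabla σ (0, x) X :=
  DFunLike.congr_fun (TensorialAt.mkHom_apply (S.tensorialAt_zero x)
    (hσ.mdifferentiableAt (by simp))) X

/-- Near `p`, the sections `s` of `H` form a holomorphic frame in which the operators `z∇_{∂ₖ}` of
the chart `φ` have the holomorphic matrices `bₖ`. -/
structure TStructure.IsFrameAt (S : TStructure n F H)
    (φ : OpenPartialHomeomorph M (EuclideanSpace ℂ (Fin n))) (s : Fin n → ∀ p, H p)
    (b : Fin n → ℂ × M → Matrix (Fin n) (Fin n) ℂ) (p : ℂ × M) : Prop where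
  holomorphic : ∀ j, HolSectionProdAt n F (s j) p
  bijective : Function.Bijective (Fintype.linearCombination ℂ fun j => s j p)
  holomorphic_matrix : ∀ k m j, ContMDiffAt (𝓘(ℂ, ℂ).prod 𝓘(ℂ, EuclideanSpace ℂ (Fin n)))
    𝓘(ℂ, ℂ) ω (fun q => b k q m j) p
  zNabla_eq : ∀ᶠ q in 𝓝 p, ∀ k j,
    Fintype.linearCombination ℂ (fun m => s m q) (fun m => b k q m j) =
      S.zNabla (s j) q (chartField φ k q.2)

section IsFrameAt

variable [VectorBundle ℂ F H] {s : Fin n → ∀ p, H p}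
  {b : Fin n → ℂ × M → Matrix (Fin n) (Fin n) ℂ}

theorem TStructure.IsFrameAt.zNabla_zNabla {p : ℂ × M} (h : S.IsFrameAt φ s b p)
    (hφ : φ ∈ IsManifold.maximalAtlas 𝓘(ℂ, EuclideanSpace ℂ (Fin n)) ω M)
    (hp : p.2 ∈ φ.source) (k l j : Fin n) :
    S.zNabla (fun q => S.zNabla (s j) q (chartField φ l q.2)) p (chartField φ k p.2) =
      Fintype.linearCombination ℂ (fun m => s m p)
        ((p.1 • matrixDeriv k (fun t => b l (p.1, φ.symm t)) (φ p.2) + b k p * b l p) *ᵥ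
          Pi.single j 1) := by
  have hentry : ∀ m, MDifferentiableAt (𝓘(ℂ, ℂ).prod 𝓘(ℂ, EuclideanSpace ℂ (Fin n))) 𝓘(ℂ, ℂ)
      (fun q => b l q m j) p := fun m => (h.holomorphic_matrix l m j).mdifferentiableAt (by simp)
  rw [(S.isDerivationAt p (chartField φ k p.2)).apply_eq_sum (f := fun q m => b l q m j) hentry
    (fun m => (h.holomorphic m).mdifferentiableAt (by simp))
    ((S.holomorphic _ _ p (holVectorFieldAt_chartField hφ hp l)
      (h.holomorphic j)).mdifferentiableAt (by simp))
    (h.zNabla_eq.mono fun q hq => hq l j)]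
  simp only [mvfderiv_prodMk_chartField hφ hp (hentry _), ← h.zNabla_eq.self_of_nhds k]
  rw [sum_add_smul_linearCombination, add_mulVec, ← mulVec_mulVec, mulVec_single_one,
    mulVec_single_one]
  rfl

theorem TStructure.IsFrameAt.isFlatAt {z : ℂ} {x : M} (h : S.IsFrameAt φ s b (z, x))
    (hφ : φ ∈ IsManifold.maximalAtlas 𝓘(ℂ, EuclideanSpace ℂ (Fin n)) ω M) (hx : x ∈ φ.source)
    (hz : z ≠ 0) : IsFlatAt (fun k w => b k (w.1, φ.symm w.2)) (z, φ x) := by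
  intro k l
  simp only [φ.left_inv hx]
  refine ext_of_linearCombination_mulVec h.bijective.1 fun j => ?_
  rw [← h.zNabla_zNabla hφ hx k l j, ← h.zNabla_zNabla hφ hx l k j]
  exact S.zNabla_comm (p := (z, x)) (X := chartField φ k) (Y := chartField φ l) hz
    (holVectorFieldAt_chartField hφ hx k) (holVectorFieldAt_chartField hφ hx l)
    (mlieBracket_chartField hφ hx k l) (h.holomorphic j)

variable [FiniteDimensional ℂ F]

theorem TStructure.exists_isFrameAt (S : TStructure n F H) {p : ℂ × M}
    (hφ : φ ∈ IsManifold.maximalAtlas 𝓘(ℂ, EuclideanSpace ℂ (Fin n)) ω M) (hp : p.2 ∈ φ.source)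
    (hs : ∀ j, HolSectionProdAt n F (s j) p)
    (hbij : Function.Bijective (Fintype.linearCombination ℂ fun j => s j p)) :
    ∃ b : Fin n → ℂ × M → Matrix (Fin n) (Fin n) ℂ, S.IsFrameAt φ s b p := by
  choose c hc hcs using fun k j => exists_linearCombination_eq hs hbij
    (S.holomorphic _ _ _ (holVectorFieldAt_chartField hφ hp k) (hs j))
  exact ⟨fun k q => Matrix.of fun m j => c k j q m, hs, hbij,
    fun k m j => contMDiffAt_pi_space.1 (hc k j) m,
    eventually_all.2 fun k => eventually_all.2 fun j => hcs k j⟩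

variable [ContMDiffVectorBundle ω F H (𝓘(ℂ, ℂ).prod 𝓘(ℂ, EuclideanSpace ℂ (Fin n)))]

theorem TStructure.IsFrameAt.eventually {p : ℂ × M} (h : S.IsFrameAt φ s b p) :
    ∀ᶠ q in 𝓝 p, S.IsFrameAt φ s b q := by
  have holomorphic : ∀ᶠ q in 𝓝 p, ∀ j, HolSectionProdAt n F (s j) q :=
    eventually_all.2 fun j => (contMDiffAt_iff_contMDiffAt_nhds (by simp)).1 (h.holomorphic j)
  have holomorphic_matrix : ∀ᶠ q in 𝓝 p, ∀ k m j, ContMDiffAt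
      (𝓘(ℂ, ℂ).prod 𝓘(ℂ, EuclideanSpace ℂ (Fin n))) 𝓘(ℂ, ℂ) ω (fun q => b k q m j) q :=
    eventually_all.2 fun k => eventually_all.2 fun m => eventually_all.2 fun j =>
      (contMDiffAt_iff_contMDiffAt_nhds (by simp)).1 (h.holomorphic_matrix k m j)
  filter_upwards [holomorphic, eventually_bijective_linearCombination h.holomorphic h.bijective,
    holomorphic_matrix, h.zNabla_eq.eventually_nhds] with q hs hbij hb hzNabla
  exact ⟨hs, hbij, hb, hzNabla⟩

end IsFrameAt

variable [VectorBundle ℂ F H] [FiniteDimensional ℂ F]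
  [ContMDiffVectorBundle ω F H (𝓘(ℂ, ℂ).prod 𝓘(ℂ, EuclideanSpace ℂ (Fin n)))]
  {ζ : ∀ x : M, H (0, x)}

theorem TStructure.exists_frame (hζh : ∀ x, HolSectionZeroAt n F ζ x)
    (hζ : IsPrimitive S.higgs ζ)
    (hφ : φ ∈ IsManifold.maximalAtlas 𝓘(ℂ, EuclideanSpace ℂ (Fin n)) ω M) {x₀ : M}
    (hx₀ : x₀ ∈ φ.source) : ∃ (σ : ∀ p, H p) (s : Fin n → ∀ p, H p),
      HolSectionProdAt n F σ (0, x₀) ∧ (∀ j, HolSectionProdAt n F (s j) (0, x₀)) ∧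
      Function.Bijective (Fintype.linearCombination ℂ fun j => s j (0, x₀)) ∧
      ∀ᶠ x in 𝓝 x₀, σ (0, x) = ζ x ∧
        (fun j => s j (0, x)) = fun j => S.higgs x (chartField φ j x) (ζ x) := by
  obtain ⟨σ, hσ, hσζ⟩ := (hζh x₀).exists_extension
  have frame_eq : ∀ᶠ x in 𝓝 x₀, σ (0, x) = ζ x ∧
      (fun j => S.zNabla σ (0, x) (chartField φ j x)) =
        fun j => S.higgs x (chartField φ j x) (ζ x) := by
    filter_upwards [hσζ, (Continuous.prodMk_right (0 : ℂ)).continuousAt.eventually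
      ((contMDiffAt_iff_contMDiffAt_nhds (by simp)).1 hσ)] with x hx hσx
    exact ⟨hx, funext fun j => by rw [← hx, S.higgs_apply x _ hσx]⟩
  refine ⟨σ, fun j p => S.zNabla σ p (chartField φ j p.2), hσ, fun j =>
    S.holomorphic _ _ _ (holVectorFieldAt_chartField hφ hx₀ j) hσ, ?_, frame_eq⟩
  rw [frame_eq.self_of_nhds.2]
  exact bijective_linearCombination_higgs hζ hφ hx₀

theorem TStructure.analyticAt_chartUnit (hζh : ∀ x, HolSectionZeroAt n F ζ x)
    (hζ : IsPrimitive S.higgs ζ)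
    (hφ : φ ∈ IsManifold.maximalAtlas 𝓘(ℂ, EuclideanSpace ℂ (Fin n)) ω M) {x₀ : M}
    (hx₀ : x₀ ∈ φ.source) : AnalyticAt ℂ (chartUnit (inducedUnit hζ) φ) (φ x₀) := by
  obtain ⟨σ, s, hσ, hs, hbij, frame_eq⟩ := exists_frame hζh hζ hφ hx₀
  obtain ⟨c, hc, hcσ⟩ := exists_linearCombination_eq hs hbij hσ
  have holomorphic_slice : ContMDiffAt 𝓘(ℂ, EuclideanSpace ℂ (Fin n)) 𝓘(ℂ, Fin n → ℂ) ω
      (fun x => c (0, x)) x₀ :=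
    ContMDiffAt.comp (g := c) (f := fun x => ((0, x) : ℂ × M)) x₀ hc
      (contMDiffAt_const.prodMk contMDiffAt_id)
  refine analyticAt_of_comp_chart hφ hx₀ (holomorphic_slice.congr_of_eventuallyEq ?_)
  filter_upwards [frame_eq, (Continuous.prodMk_right (0 : ℂ)).continuousAt.eventually hcσ,
    φ.open_source.mem_nhds hx₀] with x ⟨hσx, hsx⟩ hcx hx
  refine (bijective_linearCombination_higgs hζ hφ hx).1 ?_
  rw [linearCombination_chartUnit hζ hφ hx, ← hsx]
  exact (hcx.trans hσx).symm

theorem TStructure.IsFrameAt.eventually_eq_chartMul {s : Fin n → ∀ p, H p}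
    {b : Fin n → ℂ × M → Matrix (Fin n) (Fin n) ℂ} {x₀ : M} (h : S.IsFrameAt φ s b (0, x₀))
    (hζ : IsPrimitive S.higgs ζ)
    (hφ : φ ∈ IsManifold.maximalAtlas 𝓘(ℂ, EuclideanSpace ℂ (Fin n)) ω M) (hx₀ : x₀ ∈ φ.source)
    (frame_eq : ∀ᶠ x in 𝓝 x₀, (fun j => s j (0, x)) =
      fun j => S.higgs x (chartField φ j x) (ζ x)) :
    ∀ᶠ t in 𝓝 (φ x₀), ∀ k, b k (0, φ.symm t) = chartMul (inducedMul hζ) φ k t := by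
  have eventually_source : ∀ᶠ x in 𝓝 x₀, ∀ k, b k (0, x) =
      chartMul (inducedMul hζ) φ k (φ x) := by
    filter_upwards [frame_eq, (Continuous.prodMk_right (0 : ℂ)).continuousAt.eventually
      h.eventually, φ.open_source.mem_nhds hx₀] with x hsx hframe hx k
    ext m j
    refine congrFun ((bijective_linearCombination_higgs hζ hφ hx).1 ?_ :
      (fun m => b k (0, x) m j) = fun m => chartMul (inducedMul hζ) φ k (φ x) m j) m
    rw [linearCombination_chartMul hζ hφ hx, ← congrFun hsx j,
      S.higgs_apply x _ (hframe.holomorphic j), ← hsx]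
    exact hframe.zNabla_eq.self_of_nhds k j
  have hsymm : Tendsto φ.symm (𝓝 (φ x₀)) (𝓝 x₀) := by
    simpa only [φ.left_inv hx₀] using (φ.continuousAt_symm (φ.map_source hx₀)).tendsto
  filter_upwards [hsymm.eventually eventually_source,
    φ.open_target.mem_nhds (φ.map_source hx₀)] with t hmul ht k
  rw [hmul k, φ.right_inv ht]

theorem TStructure.exists_flat_extension (hζh : ∀ x, HolSectionZeroAt n F ζ x)
    (hζ : IsPrimitive S.higgs ζ)
    (hφ : φ ∈ IsManifold.maximalAtlas 𝓘(ℂ, EuclideanSpace ℂ (Fin n)) ω M)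
    {t₀ : EuclideanSpace ℂ (Fin n)} (ht₀ : t₀ ∈ φ.target) :
    ∃ b : Fin n → ℂ × EuclideanSpace ℂ (Fin n) → Matrix (Fin n) (Fin n) ℂ,
      (∀ k i j, AnalyticAt ℂ (fun w => b k w i j) (0, t₀)) ∧
      (∀ᶠ t in 𝓝 t₀, ∀ k, b k (0, t) = chartMul (inducedMul hζ) φ k t) ∧
      ∀ᶠ w in 𝓝 (0, t₀), w.1 ≠ 0 → IsFlatAt b w := by
  obtain ⟨x₀, hx₀, rfl⟩ : ∃ x ∈ φ.source, φ x = t₀ := ⟨_, φ.map_target ht₀, φ.right_inv ht₀⟩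
  obtain ⟨σ, s, -, hs, hbij, frame_eq⟩ := exists_frame hζh hζ hφ hx₀
  obtain ⟨b, hb⟩ := S.exists_isFrameAt hφ hx₀ hs hbij
  refine ⟨fun k w => b k (w.1, φ.symm w.2), fun k i j =>
    analyticAt_comp_prodMk_chart_symm hφ hx₀ (hb.holomorphic_matrix k i j),
    hb.eventually_eq_chartMul hζ hφ hx₀ (frame_eq.mono fun x hx => hx.2), ?_⟩
  filter_upwards [(tendsto_prodMk_symm hx₀ 0).eventually hb.eventually,
    continuousAt_snd.eventually_mem (φ.open_target.mem_nhds ht₀)] with ⟨z, t⟩ hframe ht hz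
  simpa only [φ.right_inv ht] using hframe.isFlatAt hφ (φ.map_target ht) hz

theorem TStructure.isAlgebraFamily (hζh : ∀ x, HolSectionZeroAt n F ζ x)
    (hζ : IsPrimitive S.higgs ζ)
    (hφ : φ ∈ IsManifold.maximalAtlas 𝓘(ℂ, EuclideanSpace ℂ (Fin n)) ω M) :
    IsAlgebraFamily φ.target (chartMul (inducedMul hζ) φ) (chartUnit (inducedUnit hζ) φ) := by
  refine ⟨φ.open_target, fun i k j t ht => ?_, fun k t ht => ?_, fun t ht => ?_⟩
  · obtain ⟨b, hb, hmul, -⟩ := exists_flat_extension hζh hζ hφ ht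
    refine ((hb i k j).comp (f := fun t : EuclideanSpace ℂ (Fin n) => ((0 : ℂ), t))
      (analyticAt_const.prod analyticAt_id)).congr (hmul.mono fun s hs => ?_)
    exact congrFun (congrFun (hs i) k) j
  · rw [← φ.right_inv ht]
    exact analyticAt_pi_iff.1 (analyticAt_chartUnit hζh hζ hφ (φ.map_target ht)) k
  · obtain ⟨b, hb, hmul, hflat⟩ := exists_flat_extension hζh hζ hφ ht
    obtain ⟨x, hx, rfl⟩ : ∃ x ∈ φ.source, φ x = t := ⟨_, φ.map_target ht, φ.right_inv ht⟩
    refine isAlgebraTable_chart hζ hφ hx fun i j => LinearMap.ext fun w => ?_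
    obtain ⟨c, rfl⟩ := (bijective_linearCombination_higgs hζ hφ hx).2 w
    have hcomm := comm_of_eventually_isFlatAt hb hflat i j
    rw [hmul.self_of_nhds, hmul.self_of_nhds] at hcomm
    simp only [LinearMap.comp_apply, higgs_linearCombination hζ hφ hx, mulVec_mulVec, hcomm]

theorem TStructure.isPotentialAt (hζh : ∀ x, HolSectionZeroAt n F ζ x)
    (hζ : IsPrimitive S.higgs ζ)
    (hφ : φ ∈ IsManifold.maximalAtlas 𝓘(ℂ, EuclideanSpace ℂ (Fin n)) ω M)
    {t : EuclideanSpace ℂ (Fin n)} (ht : t ∈ φ.target) :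
    IsPotentialAt (chartMul (inducedMul hζ) φ) t := by
  obtain ⟨b, hb, hmul, hflat⟩ := exists_flat_extension hζh hζ hφ ht
  obtain ⟨Γ, hΓ⟩ := isPotentialAt_of_eventually_isFlatAt hb hflat
  refine ⟨Γ, fun k l => ?_⟩
  simpa only [matrixDeriv_congr (hmul.mono fun _ h => h _), hmul.self_of_nhds] using hΓ k l

end TStructure

end FMan

theorem theorem6p7_general {n : ℕ} {M : Type*} [TopologicalSpace M]
    [ChartedSpace (EuclideanSpace ℂ (Fin n)) M]
    [IsManifold 𝓘(ℂ, EuclideanSpace ℂ (Fin n)) ω M] :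
    (∀ (F : Type*) [NormedAddCommGroup F] [NormedSpace ℂ F] [FiniteDimensional ℂ F]
      (K : M → Type*) [TopologicalSpace (TotalSpace F K)]
      [∀ x, AddCommGroup (K x)] [∀ x, Module ℂ (K x)] [∀ x, TopologicalSpace (K x)]
      [∀ x, IsTopologicalAddGroup (K x)] [∀ x, ContinuousSMul ℂ (K x)]
      [FiberBundle F K] [VectorBundle ℂ F K]
      [ContMDiffVectorBundle ω F K 𝓘(ℂ, EuclideanSpace ℂ (Fin n))]
      (C : ∀ x : M, TangentSpace 𝓘(ℂ, EuclideanSpace ℂ (Fin n)) x →ₗ[ℂ] K x →ₗ[ℂ] K x)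
      (D : CovariantDerivative 𝓘(ℂ, EuclideanSpace ℂ (Fin n)) F K) (ζ : ∀ x, K x),
      FMan.IsHiggsField F C → FMan.IsPotential F C D →
      (∀ x, FMan.HolSectionAt n F ζ x) → ∀ hζ : FMan.IsPrimitive C ζ,
        FMan.RadicalPoissonClosed (FMan.inducedMul hζ) (FMan.inducedUnit hζ) ∧
        FMan.ReducedSpectrumLagrangian (FMan.inducedMul hζ) (FMan.inducedUnit hζ)) ∧
    (∀ (F : Type*) [NormedAddCommGroup F] [NormedSpace ℂ F] [FiniteDimensional ℂ F]
      (H : ℂ × M → Type*) [TopologicalSpace (TotalSpace F H)]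
      [∀ p, AddCommGroup (H p)] [∀ p, Module ℂ (H p)] [∀ p, TopologicalSpace (H p)]
      [∀ p, IsTopologicalAddGroup (H p)] [∀ p, ContinuousSMul ℂ (H p)]
      [FiberBundle F H] [VectorBundle ℂ F H]
      [ContMDiffVectorBundle ω F H (𝓘(ℂ, ℂ).prod 𝓘(ℂ, EuclideanSpace ℂ (Fin n)))]
      (S : FMan.TStructure n F H) (ζ : ∀ x : M, H (0, x)),
      (∀ x, FMan.HolSectionZeroAt n F ζ x) → ∀ hζ : FMan.IsPrimitive S.higgs ζ,
        FMan.RadicalPoissonClosed (FMan.inducedMul hζ) (FMan.inducedUnit hζ) ∧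
        FMan.ReducedSpectrumLagrangian (FMan.inducedMul hζ) (FMan.inducedUnit hζ)) := by
  refine ⟨?_, ?_⟩
  · intro _ _ _ _ _ _ _ _ _ _ _ _ _ _ _ _ _ hC hD hζh hζ
    exact FMan.radicalPoissonClosed_and_lagrangian fun _ hφ =>
      ⟨hC.isAlgebraFamily hζh hζ hφ, fun _ ht => hC.isPotentialAt hD hζh hζ hφ ht⟩
  · intro _ _ _ _ _ _ _ _ _ _ _ _ _ _ _ _ hζh hζ
    exact FMan.radicalPoissonClosed_and_lagrangian fun _ hφ =>
      ⟨FMan.TStructure.isAlgebraFamily hζh hζ hφ,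
        fun _ ht => FMan.TStructure.isPotentialAt hζh hζ hφ ht⟩

theorem theorem6p7 {n : ℕ} {M : Type*} [TopologicalSpace M] [ChartedSpace (EuclideanSpace ℂ (Fin n)) M]
    [IsManifold 𝓘(ℂ, EuclideanSpace ℂ (Fin n)) ω M] :
    -- primitive Higgs bundles with good connection
    (∀ (F : Type*) [NormedAddCommGroup F] [NormedSpace ℂ F] [FiniteDimensional ℂ F]
      (K : M → Type*) [TopologicalSpace (TotalSpace F K)]
      [∀ x, AddCommGroup (K x)] [∀ x, Module ℂ (K x)] [∀ x, TopologicalSpace (K x)]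
      [∀ x, IsTopologicalAddGroup (K x)] [∀ x, ContinuousSMul ℂ (K x)]
      [FiberBundle F K] [VectorBundle ℂ F K] [ContMDiffVectorBundle ω F K 𝓘(ℂ, EuclideanSpace ℂ (Fin n))]
      (C : ∀ x : M, TangentSpace 𝓘(ℂ, EuclideanSpace ℂ (Fin n)) x →ₗ[ℂ] K x →ₗ[ℂ] K x)
      (D : CovariantDerivative 𝓘(ℂ, EuclideanSpace ℂ (Fin n)) F K) (ζ : ∀ x, K x),
      FMan.IsHiggsField F C → FMan.IsHolomorphicConnection F D → FMan.IsPotential F C D →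
      (∀ x, FMan.HolSectionAt n F ζ x) → ∀ hζ : FMan.IsPrimitive C ζ,
        FMan.RadicalPoissonClosed (FMan.inducedMul hζ) (FMan.inducedUnit hζ) ∧
        FMan.ReducedSpectrumLagrangian (FMan.inducedMul hζ) (FMan.inducedUnit hζ)) ∧
    -- (T)-structures over an F-manifold
    (∀ (F : Type*) [NormedAddCommGroup F] [NormedSpace ℂ F] [FiniteDimensional ℂ F]
      (H : ℂ × M → Type*) [TopologicalSpace (TotalSpace F H)]
      [∀ p, AddCommGroup (H p)] [∀ p, Module ℂ (H p)] [∀ p, TopologicalSpace (H p)]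
      [∀ p, IsTopologicalAddGroup (H p)] [∀ p, ContinuousSMul ℂ (H p)]
      [FiberBundle F H] [VectorBundle ℂ F H]
      [ContMDiffVectorBundle ω F H (𝓘(ℂ, ℂ).prod 𝓘(ℂ, EuclideanSpace ℂ (Fin n)))]
      (S : FMan.TStructure n F H) (ζ : ∀ x : M, H (0, x)),
      (∀ x, FMan.HolSectionZeroAt n F ζ x) → ∀ hζ : FMan.IsPrimitive S.higgs ζ,
        FMan.RadicalPoissonClosed (FMan.inducedMul hζ) (FMan.inducedUnit hζ) ∧
        FMan.ReducedSpectrumLagrangian (FMan.inducedMul hζ) (FMan.inducedUnit hζ)) :=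
  And.imp_left (fun general F _ _ _ K _ _ _ _ _ _ _ _ _ C D ζ hC _ hD =>
    general F K C D ζ hC hD) theorem6p7_general
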